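/- **Setting.** Let $\mathcal S,\mathcal A$ be nonempty sets, $r:\mathcal S\times\mathcal A\to[0,1]$ a known reward function, $P_1,\dots,P_d$ known (discrete) transition models on $\mathcal S\times\mathcal A$, and let the true transition law be $P=\sum_{i=1}^d\theta^*_iP_i$ with an unknown $\theta^*\in\mathbb R^d$, $\|\theta^*\|_1\le 1$. There are $K\ge1$ episodes of horizon $H\ge 1$. In episode $k$, an initial state $s_1^k$ is given (it may be chosen depending on the earlier episodes), the learner fixes a policy $\pi^k$, and for $h=1,\dots,H$ one has $a_h^k\sim\pi_h^k(s_h^k)$, $s_{h+1}^k\sim P(\cdot\mid s_h^k,a_h^k)$. Whatever policy is executed from an initial state, the total reward $\sum_{h=1}^H r(s_h,a_h)$ of an episode is at most $1$ almost surely. Let $V^{\pi}(s)$ be the expected total reward of an episode in which $\pi$ is executed from $s$, $V^*(s)=\sup_\pi V^\pi(s)$, and $\mathcal R^K=\sum_{k=1}^K\big(V^*(s_1^k)-V^{\pi^k}(s_1^k)\big)$. **Algorithm VARLin2.** Let $0<\delta\le e^{-1}$, $L_0=\lfloor\log_2H\rfloor$, $L'=\lfloor\log_2(HK)+1\rfloor$,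 $\iota=2\ln\big((2HK)^{2(d+3)}/\delta\big)$, and $\mathrm{clip}_\ell(x)=\min\{|x|,2^{-\ell}\}\,x/|x|$ (with $0/0=0$). In episode $k$, put $V_{H+1}^k=0$ and, for $h=H,\dots,1$, $$Q_h^k(s,a)=\min\Big\{1,\ r(s,a)+\max_{\theta\in\Theta_{k-1}}\sum_{i=1}^d\theta_i\,P^i_{s,a}V_{h+1}^k\Big\},\qquad V_h^k(s)=\max_aQ_h^k(s,a),$$ where $P^i_{s,a}f=\mathbb E_{s'\sim P_i(\cdot\mid s,a)}f(s')$; the learner plays $a_h^k\in\arg\max_aQ_h^k(s_h^k,a)$, ties being broken by any rule based on the earlier episodes. The confidence sets are defined through $$x_{k,h}^m=\big(P^i_{s_h^k,a_h^k}(V_{h+1}^k)^{2^m}\big)_{i=1}^d,\qquad \eta_{k,h}^m=\max_{\theta\in\Theta_{k-1}}\big\{\theta^\top x_{k,h}^{m+1}-(\theta^\top x_{k,h}^m)^2\big\},$$ $$\varepsilon_{v,u}^m(\theta)=\theta^\top x_{v,u}^m-\big(V_{u+1}^v(s_{u+1}^v)\big)^{2^m},\qquad \mathcal T_k^{m,i}=\{(v,u)\in[k-1]\times[H]:\eta_{v,u}^m\in(2^{-i},2^{1-i}]\}$$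 as follows: $\Theta_{k+1}$ is the set of all $\theta\in\mathbb R^d$ with $\|\theta\|_2\le1$ such that for all $m\in\{0,\dots,L_0\}$, $i\in\mathbb Z$, $\ell\in\{1,\dots,L'\}$ and all $\mu\in\mathbb R^d$ with $\|\mu\|_2\le2$ $$\Big|\sum_{(v,u)\in\mathcal T_k^{m,i}}\mathrm{clip}_\ell\big((x_{v,u}^m)^\top\mu\big)\,\varepsilon_{v,u}^m(\theta)\Big|\le4\sqrt{\sum_{(v,u)\in\mathcal T_k^{m,i}}\mathrm{clip}_\ell\big((x_{v,u}^m)^\top\mu\big)^2\,\eta_{v,u}^m\,\iota}+4\cdot2^{-\ell}\iota,$$ and $\Theta_0=\Theta_1=\{\theta:\|\theta\|_2\le1\}$ (there are no data yet). **Theorem.** There are absolute constants $C$ and $p$ such that in every such setting, for all $d,H,K\ge1$ and $0<\delta\le e^{-1}$, VARLin2 satisfies, with probability at least $1-\delta$, $$\mathcal R^K\le C\,\big(1+\log(d\,K\,H\,\log(1/\delta))\big)^{p}\,\Big(d^{1.5}\sqrt{K\log(1/\delta)}+d^3\log^3(1/\delta)\Big),$$ that is, $\mathcal R^K=\tilde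 O\big(d^{1.5}\sqrt{K\log(1/\delta)}+d^3\log^3(1/\delta)\big)$, where $\tilde O$ hides polylogarithmic factors in $d$, $K$, $H$, $\ln(1/\delta)$; in particular the dependence on $H$ is only polylogarithmic. -/

import Mathlib

open scoped BigOperators

noncomputable section

namespace LinMix

/-- Expectation of a real function under a discrete distribution. -/
def expect {X : Type*} (p : PMF X) (f : X → ℝ) : ℝ :=
  ∑' x, (p x).toReal * f x

/-! ### Linear mixture MDPs, policies, values -/

/-- A (time-homogeneous) linear mixture MDP: the reward `reward` and the `d` transition models
`base i` are known to the learner, the weights `θ` and hence the transition law `trans` are not. -/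
structure LinearMixtureMDP (d : ℕ) (S A : Type*) where
  /-- the known base models `P_1, …, P_d` -/
  base : Fin d → S → A → PMF S
  /-- the known reward function -/
  reward : S → A → ℝ
  /-- the unknown parameter -/
  θ : Fin d → ℝ
  /-- the true transition law `P(· | s, a)` -/
  trans : S → A → PMF S
  reward_nonneg : ∀ s a, 0 ≤ reward s a
  reward_le_one : ∀ s a, reward s a ≤ 1
  theta_mem_l1_ball : ∑ i, |θ i| ≤ 1
  trans_eq : ∀ s a s', (trans s a s').toReal = ∑ i, θ i * (base i s a s').toReal

/-- A policy: for every step `h` (counted from `1`) a map from states to distributions over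
actions. -/
abbrev Policy (S A : Type*) := ℕ → S → PMF A

/-- `policyValue P r π n h s`: expected total reward of the `n` steps `h, h+1, …, h+n-1`
when `π` is followed from state `s` at step `h`. -/
def policyValue {S A : Type*} (P : S → A → PMF S) (r : S → A → ℝ) (π : Policy S A) :
    ℕ → ℕ → S → ℝ
  | 0, _, _ => 0
  | n + 1, h, s =>
      expect (π h s) fun a => r s a + expect (P s a) (policyValue P r π n (h + 1))

/-- The optimal value `V^*(s)` at the first step of an episode of length `H`. -/
def optimalValue {S A : Type*} (P : S → A → PMF S) (r : S → A → ℝ) (H : ℕ) (s : S) : ℝ :=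
  ⨆ π : Policy S A, policyValue P r π H 1 s

/-- The states and actions of one episode, indexed by the step `h = 1, …, H`
(entries at other indices are irrelevant). -/
abbrev Trajectory (S A : Type*) := ℕ → S × A

/-- The states and actions `(s_h^k, a_h^k)` of all episodes, indexed first by the episode
`k = 1, …, K` and then by the step `h = 1, …, H` (entries at other indices are irrelevant). -/
abbrev History (S A : Type*) := ℕ → Trajectory S A

/-- Law of the trajectory obtained from `τ` by executing `π` for `n` steps, starting in state `s`
at step `h`: draw `a ∼ π_h(s)`, record `(s, a)` at index `h`, move to `s' ∼ P(· | s, a)`. -/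
def runSteps {S A : Type*} (P : S → A → PMF S) (π : Policy S A) :
    ℕ → ℕ → S → Trajectory S A → PMF (Trajectory S A)
  | 0, _, _, τ => PMF.pure τ
  | n + 1, h, s, τ =>
      (π h s).bind fun a => (P s a).bind fun s' =>
        runSteps P π n (h + 1) s' (Function.update τ h (s, a))

/-- Law of one episode of length `H` started at `s`. -/
def episodeLaw {S A : Type*} [Nonempty S] [Nonempty A] (P : S → A → PMF S) (π : Policy S A)
    (H : ℕ) (s : S) : PMF (Trajectory S A) :=
  runSteps P π H 1 s (fun _ => Classical.arbitrary (S × A))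

/-- The total reward of an episode started at `s` is at most `1` almost surely,
whatever policy is executed. -/
def TotalRewardLeOne {S A : Type*} [Nonempty S] [Nonempty A] (P : S → A → PMF S)
    (r : S → A → ℝ) (H : ℕ) (s : S) : Prop :=
  ∀ π : Policy S A, ∀ τ ∈ (episodeLaw P π H s).support,
    ∑ h ∈ Finset.Icc 1 H, r (τ h).1 (τ h).2 ≤ 1

/-- A learner that plays deterministic policies: in episode `k`, given the history, it plays
action `alg k ω h s` in state `s` at step `h`. -/
abbrev Learner (S A : Type*) := ℕ → History S A → ℕ → S → A

/-- The policy that the learner executes in episode `k`. -/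
def Learner.policy {S A : Type*} (alg : Learner S A) (k : ℕ) (ω : History S A) : Policy S A :=
  fun h s => PMF.pure (alg k ω h s)

/-- Law of the history after the first `k` episodes. The initial state of an episode is drawn from
a distribution that may depend on everything that happened in the earlier episodes. -/
def historyLaw {S A : Type*} [Nonempty S] [Nonempty A] (P : S → A → PMF S) (H : ℕ)
    (init : ℕ → History S A → PMF S) (alg : Learner S A) : ℕ → PMF (History S A)
  | 0 => PMF.pure (fun _ _ => Classical.arbitrary (S × A))
  | k + 1 =>
      (historyLaw P H init alg k).bind fun ω =>
        (init (k + 1) ω).bind fun s =>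
          (episodeLaw P (alg.policy (k + 1) ω) H s).map fun τ => Function.update ω (k + 1) τ

/-- The regret `∑_{k=1}^K V^*(s_1^k) - V^{π^k}(s_1^k)`. -/
def regret {S A : Type*} (P : S → A → PMF S) (r : S → A → ℝ) (H K : ℕ) (alg : Learner S A)
    (ω : History S A) : ℝ :=
  ∑ k ∈ Finset.Icc 1 K,
    (optimalValue P r H (ω k 1).1 - policyValue P r (alg.policy k ω) H 1 (ω k 1).1)

/-! ### The algorithm VARLin2 -/

/-- The clipping operator `min{|x|, 2^{-ℓ}} · x / |x|` (with `0 / 0 = 0`). -/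
def clip (ℓ : ℕ) (x : ℝ) : ℝ :=
  min |x| ((2 : ℝ)⁻¹ ^ ℓ) * (x / |x|)

/-- The pairing `θᵀ x`. -/
def dot {d : ℕ} (θ : EuclideanSpace ℝ (Fin d)) (x : Fin d → ℝ) : ℝ :=
  ∑ i, θ i * x i

/-- What VARLin2 is given: the base models, the reward function, the horizon, the number of
episodes and the confidence parameter. -/
structure Input (d : ℕ) (S A : Type*) where
  base : Fin d → S → A → PMF S
  reward : S → A → ℝ
  H : ℕ
  K : ℕ
  δ : ℝ

namespace Input

variable {d : ℕ} {S A : Type*}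

/-- `L₀ = ⌊log₂ H⌋`. -/
def L₀ (D : Input d S A) : ℕ := Nat.log 2 D.H

/-- `L' = ⌊log₂(HK) + 1⌋`. -/
def L' (D : Input d S A) : ℕ := Nat.log 2 (D.H * D.K) + 1

/-- `ι = 2 ln((2HK)^{2(d+3)} / δ)`. -/
def ι (D : Input d S A) : ℝ :=
  2 * Real.log ((2 * (D.H : ℝ) * (D.K : ℝ)) ^ (2 * (d + 3)) / D.δ)

/-- Optimistic planning with the parameter set `Θ`: `planValue Θ n s` is the optimistic value of
state `s` when `n` steps remain, i.e. `V_h(s)` for `n = H + 1 - h`. -/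
def planValue (D : Input d S A) (Θ : Set (EuclideanSpace ℝ (Fin d))) : ℕ → S → ℝ
  | 0, _ => 0
  | n + 1, s => ⨆ a : A, min 1 (D.reward s a +
      sSup ((fun θ => dot θ fun i => expect (D.base i s a) (planValue D Θ n)) '' Θ))

/-- The optimistic action value `min{1, r(s,a) + max_{θ ∈ Θ} ∑_i θ_i P^i_{s,a} V_{h+1}}`
at step `h`. -/
def planQ (D : Input d S A) (Θ : Set (EuclideanSpace ℝ (Fin d))) (h : ℕ) (s : S) (a : A) : ℝ :=
  min 1 (D.reward s a +
    sSup ((fun θ => dot θ fun i => expect (D.base i s a) (D.planValue Θ (D.H - h))) '' Θ))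

/-- The vector `x^m = (P^i_{s,a} (V_{h+1})^{2^m})_i`, where `V` is planned with `Θ`. -/
def feature (D : Input d S A) (Θ : Set (EuclideanSpace ℝ (Fin d))) (m h : ℕ) (s : S) (a : A) :
    Fin d → ℝ :=
  fun i => expect (D.base i s a) fun s' => D.planValue Θ (D.H - h) s' ^ (2 ^ m)

/-- The variance estimate `η^m = max_{θ ∈ Θ} {θᵀ x^{m+1} - (θᵀ x^m)²}`. -/
def varEst (D : Input d S A) (Θ : Set (EuclideanSpace ℝ (Fin d))) (m h : ℕ) (s : S) (a : A) : ℝ :=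
  sSup ((fun θ => dot θ (D.feature Θ (m + 1) h s a) - dot θ (D.feature Θ m h s a) ^ 2) '' Θ)

/-! In the following definitions `T j` is the confidence set `Θ_j`; episode `v` uses `Θ_{v-1}`
for planning, and so for the quantities `x_{v,u}^m`, `η_{v,u}^m`, `V_{u+1}^v`. -/

/-- `x_{v,u}^m`. -/
def xAt (D : Input d S A) (T : ℕ → Set (EuclideanSpace ℝ (Fin d))) (ω : History S A)
    (m v u : ℕ) : Fin d → ℝ :=
  D.feature (T (v - 1)) m u (ω v u).1 (ω v u).2

/-- `η_{v,u}^m`. -/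
def etaAt (D : Input d S A) (T : ℕ → Set (EuclideanSpace ℝ (Fin d))) (ω : History S A)
    (m v u : ℕ) : ℝ :=
  D.varEst (T (v - 1)) m u (ω v u).1 (ω v u).2

/-- `ε_{v,u}^m(θ) = θᵀ x_{v,u}^m - (V_{u+1}^v(s_{u+1}^v))^{2^m}`. -/
def epsAt (D : Input d S A) (T : ℕ → Set (EuclideanSpace ℝ (Fin d))) (ω : History S A)
    (m v u : ℕ) (θ : EuclideanSpace ℝ (Fin d)) : ℝ :=
  dot θ (D.xAt T ω m v u) - D.planValue (T (v - 1)) (D.H - u) (ω v (u + 1)).1 ^ (2 ^ m)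

open Classical in
/-- `𝒯_k^{m,i} = {(v,u) ∈ [k-1] × [H] : η_{v,u}^m ∈ (2^{-i}, 2^{1-i}]}`. -/
def layer (D : Input d S A) (T : ℕ → Set (EuclideanSpace ℝ (Fin d))) (ω : History S A)
    (k m : ℕ) (i : ℤ) : Finset (ℕ × ℕ) :=
  (Finset.Icc 1 (k - 1) ×ˢ Finset.Icc 1 D.H).filter fun q =>
    D.etaAt T ω m q.1 q.2 ∈ Set.Ioc ((2 : ℝ) ^ (-i)) ((2 : ℝ) ^ (1 - i))

/-- The set `⋂_{m,i,ℓ} Θ_{k+1}^{m,i,ℓ}`, built from the layers `𝒯_k^{m,i}`. -/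
def confNext (D : Input d S A) (T : ℕ → Set (EuclideanSpace ℝ (Fin d))) (ω : History S A)
    (k : ℕ) : Set (EuclideanSpace ℝ (Fin d)) :=
  {θ | ‖θ‖ ≤ 1 ∧ ∀ m ∈ Finset.range (D.L₀ + 1), ∀ i : ℤ, ∀ ℓ ∈ Finset.Icc 1 D.L',
    ∀ μ : EuclideanSpace ℝ (Fin d), ‖μ‖ ≤ 2 →
      |∑ q ∈ D.layer T ω k m i,
          clip ℓ (dot μ (D.xAt T ω m q.1 q.2)) * D.epsAt T ω m q.1 q.2 θ|
        ≤ 4 * √(∑ q ∈ D.layer T ω k m i,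
              clip ℓ (dot μ (D.xAt T ω m q.1 q.2)) ^ 2 * D.etaAt T ω m q.1 q.2 * D.ι)
          + 4 * (2 : ℝ)⁻¹ ^ ℓ * D.ι}

/-- The confidence set `Θ_j`, by recursion on `j`: `Θ_{k+1}` is built from the layers `𝒯_k^{m,i}`,
which refer to the earlier sets only (see `confSet_eq`). -/
def confSet (D : Input d S A) (ω : History S A) (j : ℕ) : Set (EuclideanSpace ℝ (Fin d)) :=
  D.confNext (fun j' => if _h : j' < j then D.confSet ω j' else ∅) ω (j - 1)
termination_by j

/-- `confNext` for `𝒯_k` depends only on the sets `Θ_{v-1}` with `1 ≤ v ≤ k - 1`. -/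
theorem confNext_congr (D : Input d S A) {T T' : ℕ → Set (EuclideanSpace ℝ (Fin d))}
    (ω : History S A) (k : ℕ) (hT : ∀ v ∈ Finset.Icc 1 (k - 1), T (v - 1) = T' (v - 1)) :
    D.confNext T ω k = D.confNext T' ω k := by
  have hx : ∀ m, ∀ v ∈ Finset.Icc 1 (k - 1), ∀ u, D.xAt T ω m v u = D.xAt T' ω m v u := by
    intro m v hv u
    simp only [xAt, hT v hv]
  have he : ∀ m, ∀ v ∈ Finset.Icc 1 (k - 1), ∀ u, D.etaAt T ω m v u = D.etaAt T' ω m v u := by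
    intro m v hv u
    simp only [etaAt, hT v hv]
  have hp : ∀ m, ∀ v ∈ Finset.Icc 1 (k - 1), ∀ u θ,
      D.epsAt T ω m v u θ = D.epsAt T' ω m v u θ := by
    intro m v hv u θ
    simp only [epsAt, hx m v hv, hT v hv]
  have hl : ∀ m i, D.layer T ω k m i = D.layer T' ω k m i := by
    intro m i
    unfold layer
    apply Finset.filter_congr
    intro q hq
    rw [he m q.1 (Finset.mem_product.mp hq).1]
  have hmem : ∀ m i, ∀ q ∈ D.layer T' ω k m i, q.1 ∈ Finset.Icc 1 (k - 1) := by
    intro m i q hq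
    unfold layer at hq
    exact (Finset.mem_product.mp (Finset.mem_filter.mp hq).1).1
  have h1 : ∀ m i ℓ μ θ,
      ∑ q ∈ D.layer T ω k m i,
          clip ℓ (dot μ (D.xAt T ω m q.1 q.2)) * D.epsAt T ω m q.1 q.2 θ =
      ∑ q ∈ D.layer T' ω k m i,
          clip ℓ (dot μ (D.xAt T' ω m q.1 q.2)) * D.epsAt T' ω m q.1 q.2 θ := by
    intro m i ℓ μ θ
    rw [hl]
    apply Finset.sum_congr rfl
    intro q hq
    rw [hx m _ (hmem m i q hq), hp m _ (hmem m i q hq)]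
  have h2 : ∀ m i ℓ μ,
      ∑ q ∈ D.layer T ω k m i,
          clip ℓ (dot μ (D.xAt T ω m q.1 q.2)) ^ 2 * D.etaAt T ω m q.1 q.2 * D.ι =
      ∑ q ∈ D.layer T' ω k m i,
          clip ℓ (dot μ (D.xAt T' ω m q.1 q.2)) ^ 2 * D.etaAt T' ω m q.1 q.2 * D.ι := by
    intro m i ℓ μ
    rw [hl]
    apply Finset.sum_congr rfl
    intro q hq
    rw [hx m _ (hmem m i q hq), he m _ (hmem m i q hq)]
  unfold confNext
  simp only [h1, h2]

/-- The recursion that defines the confidence sets, without the bookkeeping. -/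
theorem confSet_eq (D : Input d S A) (ω : History S A) (j : ℕ) :
    D.confSet ω j = D.confNext (D.confSet ω) ω (j - 1) := by
  rw [confSet]
  apply confNext_congr
  intro v hv
  have hlt : v - 1 < j := by
    have := Finset.mem_Icc.mp hv
    omega
  simp only [hlt, dif_pos]

/-- `Q_h^k(s,a)`, planned with `Θ_{k-1}`. -/
def Q (D : Input d S A) (ω : History S A) (k h : ℕ) (s : S) (a : A) : ℝ :=
  D.planQ (D.confSet ω (k - 1)) h s a

/-- `alg` is VARLin2 with some rule for breaking ties: in every episode it plays an action that
maximizes `Q_h^k(s, ·)`, and its choice is made on the basis of the earlier episodes. -/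
structure IsVARLin2 (D : Input d S A) (alg : Learner S A) : Prop where
  greedy : ∀ k ∈ Finset.Icc 1 D.K, ∀ ω, ∀ h ∈ Finset.Icc 1 D.H, ∀ s a,
    D.Q ω k h s a ≤ D.Q ω k h s (alg k ω h s)
  past_only : ∀ k ω ω', (∀ v < k, ω v = ω' v) → alg k ω = alg k ω'

end Input

end LinMix

end

/-!
The proof is a pathwise analysis on a good event, combined with a union bound.

*Concentration.* The prediction errors `ε` of the true parameter `θ*` are martingale differences
with conditional variance at most `η`. For one direction `μ` and one scale, the exponential
supermartingale `∏ exp (l ε - l² Var)` and Markov's inequality give a one-sided bound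
(`Input.Realizes.freedman`). A union bound over a net of directions, over the layers, the clipping
levels and dyadic scales `l` shows that `θ*` satisfies all constraints of the confidence sets with
room to spare (`Input.ConfEvent.abs_sum_clip_le`), so that the confidence sets contain `θ*` and even
a copy of the unit ball shrunken by the factor `1 / (HK)` around it
(`Input.ConfEvent.ball_subset`). Layers with extremely small `η` are treated by a direct tail bound.
Since the confidence sets contain `θ*`, planning is optimistic
(`Input.Realizes.policyValue_le_planValue`).

*Widths.* What the planner overestimates in one step is at most the width of the confidence set in
the direction of the feature. The steps are sorted into classes according to the size of `η` and of
the width. In one class a step comes with a parameter difference whose clipped predictions on the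
older steps of the class are small, but whose prediction on the step itself is large. Such steps can
be distributed over few bins in which every new step multiplies the determinant of the Gram matrix
by `3 / 2` (`exists_bins`), which bounds their number (`card_le_of_bins`). The bound requires that
an episode contributes boundedly many steps to a class; an episode is truncated at the step where
some class exceeds its cap, and few episodes are truncated (`Input.card_cutEpisodes_le`). Steps that
belong to no class have negligible width, by the shrunken ball
(`Input.Realizes.width_le_of_ball`). In total, the sum of the widths is at most
`Λ √(∑ η) + Γ` (`Input.sumWidth_le`).

*Variances.* Along an episode the powers `V ^ (2 ^ m)` of the planned values telescope. This bounds
the sum of the variances of `V ^ (2 ^ m)` by the prediction errors of `V ^ (2 ^ (m + 1))`, plus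
`2 ^ (m + 1)` times the number of episodes and the widths (`Input.sumTrueVar_le`); the prediction
errors are in turn controlled by the variances at level `m + 1`. After `log₂ H` levels the trivial
bound suffices (`recursion_bound`), and `∑ η` turns out to be of order `√d K` plus lower order
terms, without a factor `H`. The regret is bounded by the widths, the prediction errors at level
`0`, the number of truncated episodes and the deviation of the rewards from their expectations
(`Input.RegretEvent.sum_valueAt_sub_le`).
-/

open scoped BigOperators

noncomputable section

namespace LinMix

/-! ### Expectations under discrete distributions -/

section Expect

variable {X Y : Type*}

lemma hasSum_toReal (p : PMF X) : HasSum (fun x => (p x).toReal) 1 := by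
  have h := ENNReal.hasSum_toReal (f := fun x => p x) p.tsum_coe_ne_top
  rwa [← ENNReal.tsum_toReal_eq p.apply_ne_top, p.tsum_coe, ENNReal.toReal_one] at h

lemma summable_expect (p : PMF X) {f : X → ℝ} {B : ℝ} (hf : ∀ x, |f x| ≤ B) :
    Summable fun x => (p x).toReal * f x := by
  refine Summable.of_norm_bounded ((hasSum_toReal p).summable.mul_right B) fun x => ?_
  rw [Real.norm_eq_abs, abs_mul, abs_of_nonneg ENNReal.toReal_nonneg]
  exact mul_le_mul_of_nonneg_left (hf x) ENNReal.toReal_nonneg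

lemma expect_const (p : PMF X) (c : ℝ) : expect p (fun _ => c) = c := by
  unfold expect
  rw [tsum_mul_right, (hasSum_toReal p).tsum_eq, one_mul]

lemma expect_mono (p : PMF X) {f g : X → ℝ} {B B' : ℝ} (hf : ∀ x, |f x| ≤ B)
    (hg : ∀ x, |g x| ≤ B') (h : ∀ x ∈ p.support, f x ≤ g x) : expect p f ≤ expect p g := by
  refine (summable_expect p hf).tsum_le_tsum (fun x => ?_) (summable_expect p hg)
  by_cases hx : x ∈ p.support
  · exact mul_le_mul_of_nonneg_left (h x hx) ENNReal.toReal_nonneg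
  · rw [(p.apply_eq_zero_iff x).2 hx]; simp

lemma expect_add (p : PMF X) {f g : X → ℝ} {B B' : ℝ} (hf : ∀ x, |f x| ≤ B)
    (hg : ∀ x, |g x| ≤ B') : expect p (fun x => f x + g x) = expect p f + expect p g := by
  unfold expect
  rw [← (summable_expect p hf).tsum_add (summable_expect p hg)]
  exact tsum_congr fun x => by ring

lemma expect_mul_left (p : PMF X) (c : ℝ) (f : X → ℝ) :
    expect p (fun x => c * f x) = c * expect p f := by
  unfold expect
  rw [← tsum_mul_left]
  exact tsum_congr fun x => by ring

lemma expect_nonneg (p : PMF X) {f : X → ℝ} (h : ∀ x, 0 ≤ f x) : 0 ≤ expect p f :=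
  tsum_nonneg fun x => mul_nonneg ENNReal.toReal_nonneg (h x)

lemma expect_le_of_support (p : PMF X) {f : X → ℝ} {B c : ℝ} (hf : ∀ x, |f x| ≤ B)
    (h : ∀ x ∈ p.support, f x ≤ c) : expect p f ≤ c := by
  calc expect p f ≤ expect p (fun _ => c) := expect_mono p hf (B' := |c|) (fun _ => le_rfl) h
    _ = c := expect_const p c

lemma expect_le (p : PMF X) {f : X → ℝ} {c : ℝ} (h0 : ∀ x, 0 ≤ f x) (h : ∀ x, f x ≤ c) :
    expect p f ≤ c :=
  expect_le_of_support p (B := c) (fun x => by rw [abs_of_nonneg (h0 x)]; exact h x)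
    fun x _ => h x

lemma abs_expect_le (p : PMF X) {f : X → ℝ} {B : ℝ} (hf : ∀ x, |f x| ≤ B) :
    |expect p f| ≤ B := by
  refine abs_le.2 ⟨?_, expect_le_of_support p hf fun x _ => (abs_le.1 (hf x)).2⟩
  have := expect_le_of_support p (f := fun x => (-1) * f x) (B := B) (c := B)
    (fun x => by simpa using hf x) fun x _ => by linarith [(abs_le.1 (hf x)).1]
  rw [expect_mul_left] at this
  linarith

lemma expect_sq_dev (p : PMF X) {f : X → ℝ} {B : ℝ} (hf : ∀ x, |f x| ≤ B) (c : ℝ) :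
    expect p (fun x => (c - f x) ^ 2) =
      c ^ 2 - 2 * c * expect p f + expect p (fun x => f x ^ 2) := by
  have hf2 : ∀ x, |f x ^ 2| ≤ B ^ 2 := fun x => by
    rw [abs_pow]; exact pow_le_pow_left₀ (abs_nonneg _) (hf x) 2
  have h1 : ∀ x, |c ^ 2 + (-(2 * c)) * f x| ≤ c ^ 2 + |2 * c| * B := fun x => by
    refine (abs_add_le _ _).trans ?_
    rw [abs_mul, abs_neg, abs_of_nonneg (sq_nonneg c)]
    have := mul_le_mul_of_nonneg_left (hf x) (abs_nonneg (2 * c))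
    linarith
  have h2 : ∀ x, |(-(2 * c)) * f x| ≤ |2 * c| * B := fun x => by
    rw [abs_mul, abs_neg]
    exact mul_le_mul_of_nonneg_left (hf x) (abs_nonneg (2 * c))
  have e : (fun x => (c - f x) ^ 2) = fun x => (c ^ 2 + (-(2 * c)) * f x) + f x ^ 2 := by
    funext x; ring
  rw [e, expect_add p h1 hf2, expect_add p (B := c ^ 2) (fun _ => by simp) h2, expect_const,
    expect_mul_left]
  ring

lemma sq_expect_le (p : PMF X) {f : X → ℝ} {B : ℝ} (hf : ∀ x, |f x| ≤ B) :
    expect p f ^ 2 ≤ expect p (fun x => f x ^ 2) := by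
  have h := expect_nonneg p (f := fun x => (expect p f - f x) ^ 2) fun x => sq_nonneg _
  rw [expect_sq_dev p hf] at h
  nlinarith

lemma pow_two_pow_expect_le (p : PMF X) {f : X → ℝ} (h0 : ∀ x, 0 ≤ f x) (h1 : ∀ x, f x ≤ 1)
    (m : ℕ) : expect p f ^ 2 ^ m ≤ expect p (fun x => f x ^ 2 ^ m) := by
  induction m with
  | zero => simp
  | succ m ih =>
    have hb : ∀ x, |f x ^ 2 ^ m| ≤ 1 := fun x => by
      rw [abs_of_nonneg (pow_nonneg (h0 x) _)]; exact pow_le_one₀ (h0 x) (h1 x)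
    have := sq_expect_le p hb
    simp only [pow_succ 2 m, pow_mul]
    exact (pow_le_pow_left₀ (pow_nonneg (expect_nonneg p h0) _) ih 2).trans this

end Expect

/-! ### Extended nonnegative expectations -/

/-- Expectation of an extended nonnegative function under a discrete distribution; it needs
neither summability nor measurability. -/
def lexpect {X : Type*} (p : PMF X) (f : X → ENNReal) : ENNReal := ∑' x, p x * f x

section Lexpect

variable {X Y : Type*}

lemma lexpect_pure (x : X) (f : X → ENNReal) : lexpect (PMF.pure x) f = f x := by
  classical
  unfold lexpect
  rw [tsum_eq_single x]
  · simp
  · intro y hy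
    simp [PMF.pure_apply, hy]

lemma lexpect_bind (p : PMF X) (g : X → PMF Y) (f : Y → ENNReal) :
    lexpect (p.bind g) f = lexpect p fun x => lexpect (g x) f := by
  unfold lexpect
  simp only [PMF.bind_apply, ← ENNReal.tsum_mul_right, ← ENNReal.tsum_mul_left]
  rw [ENNReal.tsum_comm]
  simp only [mul_assoc]

lemma lexpect_map (p : PMF X) (g : X → Y) (f : Y → ENNReal) :
    lexpect (p.map g) f = lexpect p fun x => f (g x) := by
  rw [← PMF.bind_pure_comp, lexpect_bind]
  simp [lexpect_pure]

lemma lexpect_mono (p : PMF X) {f g : X → ENNReal} (h : ∀ x ∈ p.support, f x ≤ g x) :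
    lexpect p f ≤ lexpect p g := by
  refine ENNReal.tsum_le_tsum fun x => ?_
  by_cases hx : x ∈ p.support
  · gcongr; exact h x hx
  · rw [(p.apply_eq_zero_iff x).2 hx]; simp

lemma lexpect_congr (p : PMF X) {f g : X → ENNReal} (h : ∀ x ∈ p.support, f x = g x) :
    lexpect p f = lexpect p g :=
  le_antisymm (lexpect_mono p fun x hx => (h x hx).le) (lexpect_mono p fun x hx => (h x hx).ge)

lemma lexpect_const (p : PMF X) (c : ENNReal) : lexpect p (fun _ => c) = c := by
  unfold lexpect
  rw [ENNReal.tsum_mul_right, p.tsum_coe, one_mul]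

lemma lexpect_le (p : PMF X) {f : X → ENNReal} {c : ENNReal} (h : ∀ x ∈ p.support, f x ≤ c) :
    lexpect p f ≤ c :=
  (lexpect_mono p h).trans_eq (lexpect_const p c)

lemma lexpect_const_mul (p : PMF X) (c : ENNReal) (f : X → ENNReal) :
    lexpect p (fun x => c * f x) = c * lexpect p f := by
  unfold lexpect
  rw [← ENNReal.tsum_mul_left]
  exact tsum_congr fun x => by ring

lemma lexpect_const_add (p : PMF X) (c : ENNReal) (f : X → ENNReal) :
    lexpect p (fun x => c + f x) = c + lexpect p f := by
  unfold lexpect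
  simp only [mul_add]
  rw [ENNReal.tsum_add, ENNReal.tsum_mul_right, p.tsum_coe, one_mul]

lemma lexpect_ofReal (p : PMF X) {f : X → ℝ} {B : ℝ} (h0 : ∀ x, 0 ≤ f x) (hB : ∀ x, f x ≤ B) :
    lexpect p (fun x => ENNReal.ofReal (f x)) = ENNReal.ofReal (expect p f) := by
  unfold lexpect expect
  rw [ENNReal.ofReal_tsum_of_nonneg (fun x => mul_nonneg ENNReal.toReal_nonneg (h0 x))
    (summable_expect p (B := B) fun x => by rw [abs_of_nonneg (h0 x)]; exact hB x)]
  refine tsum_congr fun x => ?_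
  rw [ENNReal.ofReal_mul ENNReal.toReal_nonneg, ENNReal.ofReal_toReal (p.apply_ne_top x)]

/-- Markov's inequality, in exponential form. -/
lemma toOuterMeasure_exp_le (p : PMF X) (f : X → ℝ) (L : ℝ)
    (h : lexpect p (fun x => ENNReal.ofReal (Real.exp (f x))) ≤ 1) :
    p.toOuterMeasure {x | L < f x} ≤ ENNReal.ofReal (Real.exp (-L)) := by
  calc p.toOuterMeasure {x | L < f x}
      = ∑' x, Set.indicator {x | L < f x} p x := p.toOuterMeasure_apply _
    _ ≤ ∑' x, ENNReal.ofReal (Real.exp (-L)) * (p x * ENNReal.ofReal (Real.exp (f x))) := by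
        refine ENNReal.tsum_le_tsum fun x => ?_
        by_cases hx : L < f x
        · rw [Set.indicator_of_mem (by exact hx), mul_left_comm,
            ← ENNReal.ofReal_mul (Real.exp_pos _).le,
            ← Real.exp_add]
          have : (1 : ENNReal) ≤ ENNReal.ofReal (Real.exp (-L + f x)) := by
            rw [ENNReal.one_le_ofReal]
            exact Real.one_le_exp (by linarith)
          calc p x = p x * 1 := (mul_one _).symm
            _ ≤ _ := by gcongr
        · rw [Set.indicator_of_notMem (by exact hx)]; exact zero_le
    _ = ENNReal.ofReal (Real.exp (-L)) * lexpect p (fun x => ENNReal.ofReal (Real.exp (f x))) := by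
        rw [ENNReal.tsum_mul_left]; rfl
    _ ≤ _ := by
        calc _ ≤ ENNReal.ofReal (Real.exp (-L)) * 1 := by gcongr
          _ = _ := mul_one _

/-- Passing from a bound on the bad event to a bound on the good one. -/
lemma one_sub_le_toOuterMeasure (p : PMF X) {s t : Set X} {δ : ℝ} (hδ : 0 ≤ δ)
    (hs : p.toOuterMeasure s ≤ ENNReal.ofReal δ) (h : ∀ x ∈ p.support, x ∉ s → x ∈ t) :
    ENNReal.ofReal (1 - δ) ≤ p.toOuterMeasure t := by
  have h1 : (1 : ENNReal) ≤ p.toOuterMeasure (s ∪ t) := by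
    rw [(p.toOuterMeasure_apply_eq_one_iff (s := s ∪ t)).2]
    intro x hx
    by_cases hxs : x ∈ s
    · exact Or.inl hxs
    · exact Or.inr (h x hx hxs)
  have h2 : (1 : ENNReal) ≤ ENNReal.ofReal δ + p.toOuterMeasure t :=
    h1.trans ((MeasureTheory.measure_union_le s t).trans (by gcongr))
  rw [ENNReal.ofReal_sub _ hδ, ENNReal.ofReal_one]
  exact tsub_le_iff_left.2 h2

end Lexpect

/-! ### Laws of episodes and histories -/

section Laws

variable {S A : Type*}

lemma eq_of_mem_support_runSteps {P : S → A → PMF S} {π : Policy S A} :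
    ∀ {n h : ℕ} {s : S} {τ τ' : Trajectory S A}, τ' ∈ (runSteps P π n h s τ).support →
      (∀ u < h, τ' u = τ u) ∧ (n ≠ 0 → (τ' h).1 = s)
  | 0, h, s, τ, τ', hτ => by
    simp only [runSteps, PMF.mem_support_pure_iff] at hτ
    simp [hτ]
  | n + 1, h, s, τ, τ', hτ => by
    simp only [runSteps, PMF.mem_support_bind_iff] at hτ
    obtain ⟨a, -, s', -, hτ⟩ := hτ
    obtain ⟨h1, -⟩ := eq_of_mem_support_runSteps hτ
    refine ⟨fun u hu => ?_, fun _ => ?_⟩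
    · rw [h1 u (by omega), Function.update_of_ne (by omega)]
    · rw [h1 h (by omega), Function.update_self]

lemma action_of_mem_support_runSteps {P : S → A → PMF S} {π : Policy S A} {f : ℕ → S → A}
    (hπ : ∀ h s, π h s = PMF.pure (f h s)) :
    ∀ {n h : ℕ} {s : S} {τ τ' : Trajectory S A}, τ' ∈ (runSteps P π n h s τ).support →
      ∀ u, h ≤ u → u < h + n → (τ' u).2 = f u (τ' u).1
  | 0, h, s, τ, τ', _, u, h1, h2 => by omega
  | n + 1, h, s, τ, τ', hτ, u, h1, h2 => by
    simp only [runSteps, PMF.mem_support_bind_iff] at hτ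
    obtain ⟨a, ha, s', -, hτ⟩ := hτ
    rw [hπ, PMF.mem_support_pure_iff] at ha
    rcases h1.eq_or_lt with rfl | h1
    · rw [(eq_of_mem_support_runSteps hτ).1 h (by omega), Function.update_self, ha]
    · exact action_of_mem_support_runSteps hπ hτ u (by omega) (by omega)

/-- A product of adapted factors, one for each transition, has expectation at most `1` over an
episode as soon as every factor has conditional expectation at most `1`. The transition out of the
last step is left out, because its target state is not recorded. -/
lemma lexpect_runSteps_prod_le {P : S → A → PMF S} {π : Policy S A}
    {φ : Trajectory S A → ℕ → S → ENNReal}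
    (hpast : ∀ τ τ' h s', (∀ u ≤ h, τ u = τ' u) → φ τ h s' = φ τ' h s')
    (hφ : ∀ τ h, lexpect (P (τ h).1 (τ h).2) (φ τ h) ≤ 1) (n : ℕ) :
    ∀ (h : ℕ) (s : S) (τ : Trajectory S A),
      lexpect (runSteps P π (n + 1) h s τ)
        (fun τ' => ∏ u ∈ Finset.Ico h (h + n), φ τ' u (τ' (u + 1)).1) ≤ 1 := by
  induction n with
  | zero => intro h s τ; simp [lexpect_const]
  | succ n ih =>
    intro h s τ
    rw [runSteps, lexpect_bind]
    refine lexpect_le _ fun a _ => ?_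
    rw [lexpect_bind]
    have key : ∀ s', lexpect (runSteps P π (n + 1) (h + 1) s' (Function.update τ h (s, a)))
        (fun τ' => ∏ u ∈ Finset.Ico h (h + (n + 1)), φ τ' u (τ' (u + 1)).1) ≤
        φ (Function.update τ h (s, a)) h s' := by
      intro s'
      calc _ = lexpect (runSteps P π (n + 1) (h + 1) s' (Function.update τ h (s, a)))
            (fun τ' => φ (Function.update τ h (s, a)) h s' *
              ∏ u ∈ Finset.Ico (h + 1) (h + 1 + n), φ τ' u (τ' (u + 1)).1) := by
            refine lexpect_congr _ fun τ' hτ' => ?_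
            obtain ⟨h1, h2⟩ := eq_of_mem_support_runSteps hτ'
            rw [Finset.prod_eq_prod_Ico_succ_bot (by omega), h2 (by omega),
              hpast τ' (Function.update τ h (s, a)) h s' fun u hu => h1 u (by omega),
              show h + (n + 1) = h + 1 + n by omega]
        _ ≤ φ (Function.update τ h (s, a)) h s' * 1 := by
            rw [lexpect_const_mul]; gcongr; exact ih _ _ _
        _ = _ := mul_one _
    refine (lexpect_mono _ fun s' _ => key s').trans ?_
    have := hφ (Function.update τ h (s, a)) h
    simpa only [Function.update_self] using this

variable [Nonempty S] [Nonempty A]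

/-- A product of factors, one for each episode, has expectation at most `1` as soon as every factor
has conditional expectation at most `1` given the earlier episodes. -/
lemma lexpect_historyLaw_prod_le {P : S → A → PMF S} {H K : ℕ} {init : ℕ → History S A → PMF S}
    {alg : Learner S A} {G : ℕ → History S A → Trajectory S A → ENNReal}
    (hpast : ∀ k ω ω', (∀ v < k, ω v = ω' v) → G k ω = G k ω')
    (hG : ∀ k ∈ Finset.Icc 1 K, ∀ ω, ∀ s ∈ (init k ω).support,
      lexpect (episodeLaw P (alg.policy k ω) H s) (G k ω) ≤ 1) :
    ∀ k ≤ K, lexpect (historyLaw P H init alg k)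
      (fun ω => ∏ v ∈ Finset.Icc 1 k, G v ω (ω v)) ≤ 1 := by
  intro k
  induction k with
  | zero => intro _; simp [lexpect_const]
  | succ k ih =>
    intro hk
    rw [historyLaw, lexpect_bind]
    refine le_trans (lexpect_mono _ fun ω _ => ?_) (ih (by omega))
    rw [lexpect_bind]
    refine lexpect_le _ fun s hs => ?_
    rw [lexpect_map]
    have e : ∀ τ, ∏ v ∈ Finset.Icc 1 (k + 1), G v (Function.update ω (k + 1) τ)
        (Function.update ω (k + 1) τ v) = (∏ v ∈ Finset.Icc 1 k, G v ω (ω v)) * G (k + 1) ω τ := by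
      intro τ
      have hne : ∀ v < k + 1, Function.update ω (k + 1) τ v = ω v := fun v hv =>
        Function.update_of_ne (by omega) _ _
      rw [← Finset.insert_Icc_right_eq_Icc_add_one (by omega),
        Finset.prod_insert (by simp), mul_comm]
      congr 1
      · refine Finset.prod_congr rfl fun v hv => ?_
        have := Finset.mem_Icc.1 hv
        rw [hpast v _ ω fun u hu => hne u (by omega), hne v (by omega)]
      · rw [hpast (k + 1) _ ω hne, Function.update_self]
    simp only [e]
    rw [lexpect_const_mul]
    calc _ ≤ (∏ v ∈ Finset.Icc 1 k, G v ω (ω v)) * 1 := by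
          gcongr; exact hG (k + 1) (by simp; omega) ω s hs
      _ = _ := mul_one _

lemma exists_of_mem_support_historyLaw {P : S → A → PMF S} {H : ℕ}
    {init : ℕ → History S A → PMF S} {alg : Learner S A} :
    ∀ {k : ℕ} {ω : History S A}, ω ∈ (historyLaw P H init alg k).support →
      ∀ v ∈ Finset.Icc 1 k, ∃ ω', (∀ u < v, ω' u = ω u) ∧
        ∃ s ∈ (init v ω').support, ω v ∈ (episodeLaw P (alg.policy v ω') H s).support
  | 0, ω, _, v, hv => by simp at hv
  | k + 1, ω, hω, v, hv => by
    simp only [historyLaw, PMF.mem_support_bind_iff, PMF.mem_support_map_iff] at hω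
    obtain ⟨ω₀, hω₀, s, hs, τ, hτ, rfl⟩ := hω
    have := Finset.mem_Icc.1 hv
    by_cases hvk : v = k + 1
    · subst hvk
      refine ⟨ω₀, fun u hu => ?_, s, hs, ?_⟩
      · rw [Function.update_of_ne (by omega)]
      · rwa [Function.update_self]
    · obtain ⟨ω', h1, s', hs', h2⟩ := exists_of_mem_support_historyLaw hω₀ v (by simp; omega)
      refine ⟨ω', fun u hu => ?_, s', hs', ?_⟩
      · rw [h1 u hu, Function.update_of_ne (by omega)]
      · rwa [Function.update_of_ne (by omega)]

end Laws

/-! ### Policies and their values -/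

section Policies

variable {S A : Type*} {P : S → A → PMF S} {r : S → A → ℝ}

lemma policyValue_nonneg (hr0 : ∀ s a, 0 ≤ r s a) (π : Policy S A) :
    ∀ n h s, 0 ≤ policyValue P r π n h s
  | 0, _, _ => le_rfl
  | n + 1, h, _ => expect_nonneg _ fun a => add_nonneg (hr0 _ a)
      (expect_nonneg _ fun s' => policyValue_nonneg hr0 π n (h + 1) s')

lemma policyValue_le_natCast (hr0 : ∀ s a, 0 ≤ r s a) (hr1 : ∀ s a, r s a ≤ 1) (π : Policy S A) :
    ∀ n h s, policyValue P r π n h s ≤ n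
  | 0, _, _ => by simp [policyValue]
  | n + 1, h, s => by
    rw [policyValue]
    refine expect_le _ (fun a => add_nonneg (hr0 _ a)
      (expect_nonneg _ fun s' => policyValue_nonneg hr0 π n (h + 1) s')) fun a => ?_
    have := expect_le (P s a) (fun s' => policyValue_nonneg (P := P) hr0 π n (h + 1) s')
      (policyValue_le_natCast hr0 hr1 π n (h + 1))
    push_cast
    linarith [hr1 s a]

lemma abs_policyValue_le (hr0 : ∀ s a, 0 ≤ r s a) (hr1 : ∀ s a, r s a ≤ 1) (π : Policy S A)
    (n h : ℕ) (s : S) : |policyValue P r π n h s| ≤ n := by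
  rw [abs_of_nonneg (policyValue_nonneg hr0 π n h s)]
  exact policyValue_le_natCast hr0 hr1 π n h s

lemma abs_reward_add_expect_le (hr0 : ∀ s a, 0 ≤ r s a) (hr1 : ∀ s a, r s a ≤ 1)
    (π : Policy S A) (n h : ℕ) (s : S) (a : A) :
    |r s a + expect (P s a) (policyValue P r π n h)| ≤ 1 + n := by
  refine (abs_add_le _ _).trans (add_le_add ?_ (abs_expect_le _ (abs_policyValue_le hr0 hr1 π n h)))
  rw [abs_of_nonneg (hr0 s a)]
  exact hr1 s a

/-- `c` plus the reward of the next `n` steps from `s` is at most `1`, along every path that has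
positive probability for some choice of the actions. -/
def RestLeOne (P : S → A → PMF S) (r : S → A → ℝ) : ℕ → ℝ → S → Prop
  | 0, c, _ => c ≤ 1
  | n + 1, c, s => ∀ a, ∀ s' ∈ (P s a).support, RestLeOne P r n (c + r s a) s'

lemma runSteps_congr {π π' : Policy S A} :
    ∀ {n h : ℕ} {s : S} {τ : Trajectory S A}, (∀ u ≥ h, π u = π' u) →
      runSteps P π n h s τ = runSteps P π' n h s τ
  | 0, _, _, _, _ => rfl
  | n + 1, h, s, τ, hπ => by
    rw [runSteps, runSteps, hπ h le_rfl]
    congr 1; funext a; congr 1; funext s'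
    exact runSteps_congr fun u hu => hπ u (by omega)

/-- Every path is followed by a policy that plays a fixed sequence of actions, so that a bound for
all policies is a bound for all paths. -/
lemma restLeOne_of_forall_openLoop :
    ∀ (n h : ℕ) (s : S) (τ : Trajectory S A) (c : ℝ),
      (∀ f : ℕ → A, ∀ τ' ∈ (runSteps P (fun u _ => PMF.pure (f u)) n h s τ).support,
        c + ∑ u ∈ Finset.Ico h (h + n), r (τ' u).1 (τ' u).2 ≤ 1) → ∀ [Nonempty A],
      RestLeOne P r n c s
  | 0, h, s, τ, c, H, _ => by
    have := H (fun _ => Classical.arbitrary A) τ (by simp [runSteps])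
    simpa [RestLeOne] using this
  | n + 1, h, s, τ, c, H, _ => by
    intro a s' hs'
    refine restLeOne_of_forall_openLoop n (h + 1) s' (Function.update τ h (s, a)) _
      fun f τ' hτ' => ?_
    have h1 := (eq_of_mem_support_runSteps hτ').1 h (by omega)
    rw [Function.update_self] at h1
    have h2 := H (Function.update f h a) τ' (by
      simp only [runSteps, PMF.mem_support_bind_iff, PMF.mem_support_pure_iff, Function.update_self]
      refine ⟨a, rfl, s', hs', ?_⟩
      rw [runSteps_congr (π' := fun u _ => PMF.pure (f u))]
      · exact hτ'
      · intro u hu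
        funext _
        rw [Function.update_of_ne (by omega)])
    rw [Finset.sum_eq_sum_Ico_succ_bot (by omega), h1] at h2
    rw [show h + 1 + n = h + (n + 1) by omega]
    linarith

lemma TotalRewardLeOne.restLeOne [Nonempty S] [Nonempty A] {H : ℕ} {s : S}
    (h : TotalRewardLeOne P r H s) : RestLeOne P r H 0 s := by
  refine restLeOne_of_forall_openLoop H 1 s
    (fun _ => Classical.arbitrary (S × A)) 0 fun f τ' hτ' => ?_
  have := h (fun u _ => PMF.pure (f u)) τ' hτ'
  rw [show Finset.Ico 1 (1 + H) = Finset.Icc 1 H by ext; simp; omega, zero_add]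
  exact this

lemma RestLeOne.policyValue_le (hr0 : ∀ s a, 0 ≤ r s a) (hr1 : ∀ s a, r s a ≤ 1)
    (π : Policy S A) : ∀ {n : ℕ} {c : ℝ} {s : S} (h : ℕ), RestLeOne P r n c s →
      policyValue P r π n h s ≤ 1 - c
  | 0, c, s, h, H => by
    have : c ≤ 1 := H
    rw [policyValue]; linarith
  | n + 1, c, s, h, H => by
    rw [policyValue]
    refine expect_le_of_support _ (abs_reward_add_expect_le hr0 hr1 π n (h + 1) s) fun a _ => ?_
    have := expect_le_of_support (P s a) (abs_policyValue_le hr0 hr1 π n (h + 1)) fun s' hs' =>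
      RestLeOne.policyValue_le hr0 hr1 π (h + 1) (H a s' hs')
    linarith

/-- The total reward of an episode has expectation `policyValue`. -/
lemma lexpect_runSteps_sum_reward (hr0 : ∀ s a, 0 ≤ r s a) (hr1 : ∀ s a, r s a ≤ 1)
    (π : Policy S A) : ∀ (n h : ℕ) (s : S) (τ : Trajectory S A),
      lexpect (runSteps P π n h s τ)
        (fun τ' => ENNReal.ofReal (∑ u ∈ Finset.Ico h (h + n), r (τ' u).1 (τ' u).2)) =
      ENNReal.ofReal (policyValue P r π n h s)
  | 0, h, s, τ => by simp [policyValue, lexpect_const]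
  | n + 1, h, s, τ => by
    have hb : ∀ a, r s a + expect (P s a) (policyValue P r π n (h + 1)) ≤ 1 + n := fun a =>
      (abs_le.1 (abs_reward_add_expect_le hr0 hr1 π n (h + 1) s a)).2
    have h0 : ∀ a, 0 ≤ expect (P s a) (policyValue P r π n (h + 1)) := fun a =>
      expect_nonneg _ (policyValue_nonneg hr0 π n (h + 1))
    rw [runSteps, policyValue, lexpect_bind,
      ← lexpect_ofReal _ (fun a => add_nonneg (hr0 s a) (h0 a)) hb]
    refine lexpect_congr _ fun a _ => ?_
    rw [lexpect_bind, ENNReal.ofReal_add (hr0 s a) (h0 a),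
      ← lexpect_ofReal _ (policyValue_nonneg hr0 π n (h + 1))
        (policyValue_le_natCast hr0 hr1 π n (h + 1)),
      ← lexpect_const_add]
    refine lexpect_congr _ fun s' _ => ?_
    rw [← lexpect_runSteps_sum_reward hr0 hr1 π n (h + 1) s' (Function.update τ h (s, a)),
      ← lexpect_const_add]
    refine lexpect_congr _ fun τ' hτ' => ?_
    have h1 := (eq_of_mem_support_runSteps hτ').1 h (by omega)
    rw [Function.update_self] at h1
    rw [Finset.sum_eq_sum_Ico_succ_bot (by omega), h1, ENNReal.ofReal_add (hr0 _ _)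
      (Finset.sum_nonneg fun u _ => hr0 _ _), show h + 1 + n = h + (n + 1) by omega]

lemma exp_le_one_add_add_sq {y : ℝ} (hy : |y| ≤ 1) : Real.exp y ≤ 1 + y + y ^ 2 := by
  have := (abs_le.1 (Real.abs_exp_sub_one_sub_id_le hy)).2
  linarith

/-- The total reward of an episode deviates from its expectation like a bounded variable. -/
lemma lexpect_episodeLaw_exp_reward_le [Nonempty S] [Nonempty A] (hr0 : ∀ s a, 0 ≤ r s a)
    (hr1 : ∀ s a, r s a ≤ 1) {H : ℕ} {s : S} (hs : TotalRewardLeOne P r H s) (π : Policy S A)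
    {l : ℝ} (hl0 : 0 ≤ l) (hl1 : l ≤ 1) :
    lexpect (episodeLaw P π H s) (fun τ => ENNReal.ofReal (Real.exp
      (l * (∑ h ∈ Finset.Icc 1 H, r (τ h).1 (τ h).2 - policyValue P r π H 1 s) - l ^ 2))) ≤ 1 := by
  set v := policyValue P r π H 1 s with hv
  have hv0 : 0 ≤ v := policyValue_nonneg hr0 π H 1 s
  have hv1 : v ≤ 1 := by
    have := RestLeOne.policyValue_le hr0 hr1 π 1 hs.restLeOne
    linarith
  have hc0 : 0 ≤ 1 + l ^ 2 - l * v := by nlinarith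
  have e : Finset.Ico 1 (1 + H) = Finset.Icc 1 H := by ext; simp; omega
  have hE : lexpect (episodeLaw P π H s)
      (fun τ => ENNReal.ofReal (∑ h ∈ Finset.Icc 1 H, r (τ h).1 (τ h).2)) = ENNReal.ofReal v := by
    have := lexpect_runSteps_sum_reward (P := P) hr0 hr1 π H 1 s
      (fun _ => Classical.arbitrary (S × A))
    rw [e] at this
    exact this
  calc _ ≤ lexpect (episodeLaw P π H s) (fun τ => ENNReal.ofReal (Real.exp (-l ^ 2)) *
        (ENNReal.ofReal (1 + l ^ 2 - l * v) +
          ENNReal.ofReal l * ENNReal.ofReal (∑ h ∈ Finset.Icc 1 H, r (τ h).1 (τ h).2))) := by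
        refine lexpect_mono _ fun τ hτ => ?_
        have hx1 := hs π τ hτ
        have hx0 : 0 ≤ ∑ h ∈ Finset.Icc 1 H, r (τ h).1 (τ h).2 :=
          Finset.sum_nonneg fun u _ => hr0 _ _
        generalize ∑ h ∈ Finset.Icc 1 H, r (τ h).1 (τ h).2 = X at hx0 hx1
        rw [← ENNReal.ofReal_mul hl0, ← ENNReal.ofReal_add hc0 (mul_nonneg hl0 hx0),
          ← ENNReal.ofReal_mul (Real.exp_pos _).le]
        refine ENNReal.ofReal_le_ofReal ?_
        rw [show l * (X - v) - l ^ 2 = -l ^ 2 + l * (X - v) by ring, Real.exp_add]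
        refine mul_le_mul_of_nonneg_left ?_ (Real.exp_pos _).le
        have hab : |X - v| ≤ 1 := abs_le.2 ⟨by linarith, by linarith⟩
        have h1 : |l * (X - v)| ≤ 1 := by
          rw [abs_mul, abs_of_nonneg hl0]
          exact mul_le_one₀ hl1 (abs_nonneg _) hab
        have h2 := exp_le_one_add_add_sq h1
        have h3 : (X - v) ^ 2 ≤ 1 := by rw [sq_le_one_iff_abs_le_one]; exact hab
        nlinarith [sq_nonneg l]
    _ = ENNReal.ofReal (Real.exp (-l ^ 2)) *
        (ENNReal.ofReal (1 + l ^ 2 - l * v) + ENNReal.ofReal l * ENNReal.ofReal v) := by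
        rw [lexpect_const_mul, lexpect_const_add, lexpect_const_mul, hE]
    _ ≤ 1 := by
        rw [← ENNReal.ofReal_mul hl0, ← ENNReal.ofReal_add hc0 (mul_nonneg hl0 hv0),
          ← ENNReal.ofReal_mul (Real.exp_pos _).le, ENNReal.ofReal_le_one, Real.exp_neg,
          inv_mul_le_iff₀ (Real.exp_pos _), mul_one]
        have := Real.add_one_le_exp (l ^ 2)
        linarith

end Policies

/-! ### Optimistic planning -/

section Dot

variable {d : ℕ}

lemma dot_eq_inner (θ : EuclideanSpace ℝ (Fin d)) (x : Fin d → ℝ) :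
    dot θ x = inner ℝ (WithLp.toLp 2 x) θ := by
  simp [dot, PiLp.inner_apply]

lemma dot_sub_left (θ θ' : EuclideanSpace ℝ (Fin d)) (x : Fin d → ℝ) :
    dot (θ - θ') x = dot θ x - dot θ' x := by
  simp [dot, sub_mul, Finset.sum_sub_distrib]

lemma dot_add_left (θ θ' : EuclideanSpace ℝ (Fin d)) (x : Fin d → ℝ) :
    dot (θ + θ') x = dot θ x + dot θ' x := by
  simp [dot, add_mul, Finset.sum_add_distrib]

lemma dot_smul_left (c : ℝ) (θ : EuclideanSpace ℝ (Fin d)) (x : Fin d → ℝ) :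
    dot (c • θ) x = c * dot θ x := by
  simp [dot, mul_assoc, Finset.mul_sum]

lemma dot_zero_right (θ : EuclideanSpace ℝ (Fin d)) : dot θ (fun _ => 0) = 0 := by
  simp [dot]

lemma dot_single (i : Fin d) (x : Fin d → ℝ) : dot (EuclideanSpace.single i 1) x = x i := by
  simp [dot]

lemma norm_toLp_le {x : Fin d → ℝ} {c : ℝ} (hc : 0 ≤ c) (hx : ∀ i, |x i| ≤ c) :
    ‖(WithLp.toLp 2 x : EuclideanSpace ℝ (Fin d))‖ ≤ √d * c := by
  rw [EuclideanSpace.norm_eq]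
  calc √(∑ i, ‖x i‖ ^ 2) ≤ √(∑ _i : Fin d, c ^ 2) := by
        refine Real.sqrt_le_sqrt (Finset.sum_le_sum fun i _ => ?_)
        exact pow_le_pow_left₀ (norm_nonneg _) (hx i) 2
    _ = √d * c := by
        rw [Finset.sum_const, Finset.card_univ, Fintype.card_fin, nsmul_eq_mul,
          Real.sqrt_mul (Nat.cast_nonneg d), Real.sqrt_sq hc]

lemma abs_dot_le {θ : EuclideanSpace ℝ (Fin d)} {x : Fin d → ℝ} {c : ℝ} (hθ : ‖θ‖ ≤ 1)
    (hc : 0 ≤ c) (hx : ∀ i, |x i| ≤ c) : |dot θ x| ≤ √d * c := by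
  rw [dot_eq_inner]
  refine (abs_real_inner_le_norm _ _).trans ?_
  calc _ ≤ (√d * c) * 1 := mul_le_mul (norm_toLp_le hc hx) hθ (norm_nonneg _) (by positivity)
    _ = _ := mul_one _

end Dot

namespace Input

variable {d : ℕ} {S A : Type*}

/-- The transition law `P` is the mixture of the base models of `D` with the weights `θ` in the
unit ball, and the rewards lie in `[0, 1]`. -/
structure Realizes (D : Input d S A) (P : S → A → PMF S) (θ : EuclideanSpace ℝ (Fin d)) : Prop where
  trans_eq : ∀ s a s', (P s a s').toReal = ∑ i, θ i * (D.base i s a s').toReal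
  norm_le : ‖θ‖ ≤ 1
  reward_nonneg : ∀ s a, 0 ≤ D.reward s a
  reward_le_one : ∀ s a, D.reward s a ≤ 1

/-- A set of candidate parameters inside the unit ball that contains the true one. -/
structure Valid (θ : EuclideanSpace ℝ (Fin d)) (Θ : Set (EuclideanSpace ℝ (Fin d))) : Prop where
  mem : θ ∈ Θ
  norm_le : ∀ θ' ∈ Θ, ‖θ'‖ ≤ 1

variable {D : Input d S A} {P : S → A → PMF S} {θs : EuclideanSpace ℝ (Fin d)}
  {Θ : Set (EuclideanSpace ℝ (Fin d))}

lemma Realizes.dot_expect (hM : D.Realizes P θs) {f : S → ℝ} {B : ℝ} (hf : ∀ x, |f x| ≤ B)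
    (s : S) (a : A) : dot θs (fun i => expect (D.base i s a) f) = expect (P s a) f := by
  unfold dot expect
  simp only [hM.trans_eq, ← tsum_mul_left, Finset.sum_mul]
  rw [Summable.tsum_finsetSum]
  · exact Finset.sum_congr rfl fun i _ => tsum_congr fun x => by ring
  · intro i _
    simp only [mul_assoc]
    exact (summable_expect (D.base i s a) hf).mul_left (θs i)

lemma bddAbove_dot (hΘ : Valid θs Θ) {x : Fin d → ℝ} {c : ℝ} (hc : 0 ≤ c) (hx : ∀ i, |x i| ≤ c) :
    BddAbove ((fun θ => dot θ x) '' Θ) := by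
  refine ⟨√d * c, ?_⟩
  rintro _ ⟨θ, hθ, rfl⟩
  exact (abs_le.1 (abs_dot_le (hΘ.norm_le θ hθ) hc hx)).2

lemma Realizes.planValue_mem [Nonempty A] (hM : D.Realizes P θs) (hΘ : Valid θs Θ) :
    ∀ n s, 0 ≤ D.planValue Θ n s ∧ D.planValue Θ n s ≤ 1
  | 0, s => by simp [planValue]
  | n + 1, s => by
    have ih := Realizes.planValue_mem hM hΘ n
    have hb : ∀ s', |D.planValue Θ n s'| ≤ 1 := fun s' => by
      rw [abs_of_nonneg (ih s').1]; exact (ih s').2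
    have key : ∀ a, 0 ≤ min 1 (D.reward s a +
        sSup ((fun θ => dot θ fun i => expect (D.base i s a) (planValue D Θ n)) '' Θ)) := by
      intro a
      refine le_min zero_le_one (add_nonneg (hM.reward_nonneg s a) ?_)
      refine le_trans ?_ (le_csSup (bddAbove_dot hΘ zero_le_one fun i =>
        abs_expect_le _ hb) ⟨θs, hΘ.mem, rfl⟩)
      change 0 ≤ dot θs _
      rw [hM.dot_expect hb]
      exact expect_nonneg _ fun s' => (ih s').1
    rw [planValue]
    exact ⟨Real.iSup_nonneg key, Real.iSup_le (fun a => min_le_left _ _) zero_le_one⟩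

lemma Realizes.planValue_nonneg [Nonempty A] (hM : D.Realizes P θs) (hΘ : Valid θs Θ)
    (n : ℕ) (s : S) : 0 ≤ D.planValue Θ n s :=
  (hM.planValue_mem hΘ n s).1

lemma Realizes.planValue_le_one [Nonempty A] (hM : D.Realizes P θs) (hΘ : Valid θs Θ)
    (n : ℕ) (s : S) : D.planValue Θ n s ≤ 1 :=
  (hM.planValue_mem hΘ n s).2

lemma Realizes.planValue_pow_nonneg [Nonempty A] (hM : D.Realizes P θs) (hΘ : Valid θs Θ)
    (n k : ℕ) (s : S) : 0 ≤ D.planValue Θ n s ^ k :=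
  pow_nonneg (hM.planValue_nonneg hΘ n s) k

lemma Realizes.planValue_pow_le_one [Nonempty A] (hM : D.Realizes P θs) (hΘ : Valid θs Θ)
    (n k : ℕ) (s : S) : D.planValue Θ n s ^ k ≤ 1 :=
  pow_le_one₀ (hM.planValue_nonneg hΘ n s) (hM.planValue_le_one hΘ n s)

lemma Realizes.abs_planValue_pow_le_one [Nonempty A] (hM : D.Realizes P θs) (hΘ : Valid θs Θ)
    (n k : ℕ) (s : S) : |D.planValue Θ n s ^ k| ≤ 1 := by
  rw [abs_of_nonneg (hM.planValue_pow_nonneg hΘ n k s)]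
  exact hM.planValue_pow_le_one hΘ n k s

lemma Realizes.feature_nonneg [Nonempty A] (hM : D.Realizes P θs) (hΘ : Valid θs Θ)
    (m h : ℕ) (s : S) (a : A) (i : Fin d) :
    0 ≤ D.feature Θ m h s a i :=
  expect_nonneg _ (hM.planValue_pow_nonneg hΘ _ _)

lemma Realizes.feature_le_one [Nonempty A] (hM : D.Realizes P θs) (hΘ : Valid θs Θ)
    (m h : ℕ) (s : S) (a : A) (i : Fin d) :
    D.feature Θ m h s a i ≤ 1 :=
  expect_le _ (hM.planValue_pow_nonneg hΘ _ _) (hM.planValue_pow_le_one hΘ _ _)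

lemma Realizes.abs_feature_le_one [Nonempty A] (hM : D.Realizes P θs) (hΘ : Valid θs Θ)
    (m h : ℕ) (s : S) (a : A) (i : Fin d) :
    |D.feature Θ m h s a i| ≤ 1 := by
  rw [abs_of_nonneg (hM.feature_nonneg hΘ m h s a i)]
  exact hM.feature_le_one hΘ m h s a i

lemma Realizes.sq_feature_le [Nonempty A] (hM : D.Realizes P θs) (hΘ : Valid θs Θ)
    (m h : ℕ) (s : S) (a : A) (i : Fin d) :
    D.feature Θ m h s a i ^ 2 ≤ D.feature Θ (m + 1) h s a i := by
  have := sq_expect_le (D.base i s a) (hM.abs_planValue_pow_le_one hΘ (D.H - h) (2 ^ m))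
  simp only [← pow_mul, ← pow_succ] at this
  exact this

lemma Realizes.abs_dot_feature_le [Nonempty A] (hM : D.Realizes P θs) (hΘ : Valid θs Θ)
    {θ : EuclideanSpace ℝ (Fin d)} (hθ : ‖θ‖ ≤ 1) (m h : ℕ) (s : S)
    (a : A) : |dot θ (D.feature Θ m h s a)| ≤ √d := by
  simpa using abs_dot_le hθ zero_le_one (hM.abs_feature_le_one hΘ m h s a)

lemma Realizes.dot_feature [Nonempty A] (hM : D.Realizes P θs) (hΘ : Valid θs Θ)
    (m h : ℕ) (s : S) (a : A) :
    dot θs (D.feature Θ m h s a) = expect (P s a) fun s' => D.planValue Θ (D.H - h) s' ^ 2 ^ m :=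
  hM.dot_expect (hM.abs_planValue_pow_le_one hΘ _ _) s a

lemma Realizes.dot_feature_nonneg [Nonempty A] (hM : D.Realizes P θs) (hΘ : Valid θs Θ)
    (m h : ℕ) (s : S) (a : A) :
    0 ≤ dot θs (D.feature Θ m h s a) := by
  rw [hM.dot_feature hΘ]
  exact expect_nonneg _ (hM.planValue_pow_nonneg hΘ _ _)

lemma Realizes.dot_feature_le_one [Nonempty A] (hM : D.Realizes P θs) (hΘ : Valid θs Θ)
    (m h : ℕ) (s : S) (a : A) :
    dot θs (D.feature Θ m h s a) ≤ 1 := by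
  rw [hM.dot_feature hΘ]
  exact expect_le _ (hM.planValue_pow_nonneg hΘ _ _) (hM.planValue_pow_le_one hΘ _ _)

/-- The true conditional variance of `(V_{h+1})^{2^m}`, with `V` planned with `Θ`. -/
def trueVar (D : Input d S A) (θs : EuclideanSpace ℝ (Fin d))
    (Θ : Set (EuclideanSpace ℝ (Fin d))) (m h : ℕ) (s : S) (a : A) : ℝ :=
  dot θs (D.feature Θ (m + 1) h s a) - dot θs (D.feature Θ m h s a) ^ 2

/-- The width of `Θ` in the direction `x^m`, seen from the true parameter. -/
def width (D : Input d S A) (θs : EuclideanSpace ℝ (Fin d))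
    (Θ : Set (EuclideanSpace ℝ (Fin d))) (m h : ℕ) (s : S) (a : A) : ℝ :=
  sSup ((fun θ => |dot θ (D.feature Θ m h s a) - dot θs (D.feature Θ m h s a)|) '' Θ)

lemma Realizes.expect_sq_dev_eq_trueVar [Nonempty A] (hM : D.Realizes P θs) (hΘ : Valid θs Θ)
    (m h : ℕ) (s : S) (a : A) :
    expect (P s a) (fun s' => (dot θs (D.feature Θ m h s a) -
      D.planValue Θ (D.H - h) s' ^ 2 ^ m) ^ 2) = D.trueVar θs Θ m h s a := by
  rw [expect_sq_dev _ (hM.abs_planValue_pow_le_one hΘ _ _), ← hM.dot_feature hΘ]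
  simp only [← pow_mul, ← pow_succ]
  rw [← hM.dot_feature hΘ, trueVar]
  ring

lemma Realizes.trueVar_nonneg [Nonempty A] (hM : D.Realizes P θs) (hΘ : Valid θs Θ)
    (m h : ℕ) (s : S) (a : A) : 0 ≤ D.trueVar θs Θ m h s a := by
  rw [← hM.expect_sq_dev_eq_trueVar hΘ]
  exact expect_nonneg _ fun _ => sq_nonneg _

lemma Realizes.trueVar_le_one [Nonempty A] (hM : D.Realizes P θs) (hΘ : Valid θs Θ)
    (m h : ℕ) (s : S) (a : A) : D.trueVar θs Θ m h s a ≤ 1 := by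
  have := hM.dot_feature_le_one hΘ (m + 1) h s a
  rw [trueVar]
  nlinarith [sq_nonneg (dot θs (D.feature Θ m h s a))]

lemma Realizes.varEst_elem_le [Nonempty A] (hM : D.Realizes P θs) (hΘ : Valid θs Θ)
    {θ : EuclideanSpace ℝ (Fin d)} (hθ : ‖θ‖ ≤ 1) (m h : ℕ) (s : S)
    (a : A) : dot θ (D.feature Θ (m + 1) h s a) - dot θ (D.feature Θ m h s a) ^ 2 ≤ √d := by
  have := (abs_le.1 (hM.abs_dot_feature_le hΘ hθ (m + 1) h s a)).2
  nlinarith [sq_nonneg (dot θ (D.feature Θ m h s a))]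

lemma Realizes.le_varEst [Nonempty A] (hM : D.Realizes P θs) (hΘ : Valid θs Θ)
    {θ : EuclideanSpace ℝ (Fin d)} (hθ : θ ∈ Θ) (m h : ℕ) (s : S) (a : A) :
    dot θ (D.feature Θ (m + 1) h s a) - dot θ (D.feature Θ m h s a) ^ 2 ≤ D.varEst Θ m h s a := by
  refine le_csSup ⟨√d, ?_⟩ ⟨θ, hθ, rfl⟩
  rintro _ ⟨θ', hθ', rfl⟩
  exact hM.varEst_elem_le hΘ (hΘ.norm_le θ' hθ') m h s a

lemma Realizes.trueVar_le_varEst [Nonempty A] (hM : D.Realizes P θs) (hΘ : Valid θs Θ)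
    (m h : ℕ) (s : S) (a : A) :
    D.trueVar θs Θ m h s a ≤ D.varEst Θ m h s a :=
  hM.le_varEst hΘ hΘ.mem m h s a

lemma Realizes.varEst_nonneg [Nonempty A] (hM : D.Realizes P θs) (hΘ : Valid θs Θ)
    (m h : ℕ) (s : S) (a : A) : 0 ≤ D.varEst Θ m h s a :=
  (hM.trueVar_nonneg hΘ m h s a).trans (hM.trueVar_le_varEst hΘ m h s a)

lemma Realizes.varEst_le [Nonempty A] (hM : D.Realizes P θs) (hΘ : Valid θs Θ)
    (m h : ℕ) (s : S) (a : A) : D.varEst Θ m h s a ≤ √d := by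
  refine csSup_le ⟨_, θs, hΘ.mem, rfl⟩ ?_
  rintro _ ⟨θ, hθ, rfl⟩
  exact hM.varEst_elem_le hΘ (hΘ.norm_le θ hθ) m h s a

lemma Realizes.width_elem_le [Nonempty A] (hM : D.Realizes P θs) (hΘ : Valid θs Θ)
    {θ : EuclideanSpace ℝ (Fin d)} (hθ : θ ∈ Θ) (m h : ℕ) (s : S)
    (a : A) : |dot θ (D.feature Θ m h s a) - dot θs (D.feature Θ m h s a)| ≤ 2 * √d := by
  refine (abs_sub _ _).trans ?_
  have h1 := hM.abs_dot_feature_le hΘ (hΘ.norm_le θ hθ) m h s a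
  have h2 := hM.abs_dot_feature_le hΘ hM.norm_le m h s a
  linarith

lemma Realizes.le_width [Nonempty A] (hM : D.Realizes P θs) (hΘ : Valid θs Θ)
    {θ : EuclideanSpace ℝ (Fin d)} (hθ : θ ∈ Θ) (m h : ℕ) (s : S) (a : A) :
    |dot θ (D.feature Θ m h s a) - dot θs (D.feature Θ m h s a)| ≤ D.width θs Θ m h s a := by
  refine le_csSup ⟨2 * √d, ?_⟩ ⟨θ, hθ, rfl⟩
  rintro _ ⟨θ', hθ', rfl⟩
  exact hM.width_elem_le hΘ hθ' m h s a

lemma width_le_of_forall (hΘ : Valid θs Θ) {m h : ℕ} {s : S} {a : A} {c : ℝ}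
    (H : ∀ θ ∈ Θ, |dot θ (D.feature Θ m h s a) - dot θs (D.feature Θ m h s a)| ≤ c) :
    D.width θs Θ m h s a ≤ c := by
  refine csSup_le ⟨_, θs, hΘ.mem, rfl⟩ ?_
  rintro _ ⟨θ, hθ, rfl⟩
  exact H θ hθ

lemma Realizes.width_le [Nonempty A] (hM : D.Realizes P θs) (hΘ : Valid θs Θ)
    (m h : ℕ) (s : S) (a : A) : D.width θs Θ m h s a ≤ 2 * √d :=
  width_le_of_forall hΘ fun _ hθ => hM.width_elem_le hΘ hθ m h s a

lemma Realizes.width_nonneg [Nonempty A] (hM : D.Realizes P θs) (hΘ : Valid θs Θ)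
    (m h : ℕ) (s : S) (a : A) : 0 ≤ D.width θs Θ m h s a :=
  (abs_nonneg _).trans (hM.le_width hΘ hΘ.mem m h s a)

lemma exists_of_lt_width (hΘ : Valid θs Θ) {m h : ℕ} {s : S} {a : A} {c : ℝ}
    (hc : c < D.width θs Θ m h s a) :
    ∃ θ ∈ Θ, c < |dot (θ - θs) (D.feature Θ m h s a)| := by
  by_contra! H
  refine absurd (width_le_of_forall hΘ fun θ hθ => ?_) (not_le.2 hc)
  rw [← dot_sub_left]
  exact H θ hθ

lemma Realizes.varEst_le_trueVar_add [Nonempty A] (hM : D.Realizes P θs) (hΘ : Valid θs Θ)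
    (m h : ℕ) (s : S) (a : A) :
    D.varEst Θ m h s a ≤ D.trueVar θs Θ m h s a + D.width θs Θ (m + 1) h s a +
      2 * D.width θs Θ m h s a := by
  refine csSup_le ⟨_, θs, hΘ.mem, rfl⟩ ?_
  rintro _ ⟨θ, hθ, rfl⟩
  have h1 := (abs_le.1 (hM.le_width hΘ hθ (m + 1) h s a)).2
  have h2 := (abs_le.1 (hM.le_width hΘ hθ m h s a)).1
  have hw := hM.width_nonneg hΘ m h s a
  have p0 := hM.dot_feature_nonneg hΘ m h s a
  have p1 := hM.dot_feature_le_one hΘ m h s a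
  simp only [trueVar]
  nlinarith [sq_nonneg (dot θ (D.feature Θ m h s a) - dot θs (D.feature Θ m h s a))]

/-- One step of planning overestimates by at most the width of the parameter set. -/
lemma Realizes.planQ_le [Nonempty A] (hM : D.Realizes P θs) (hΘ : Valid θs Θ)
    (h : ℕ) (s : S) (a : A) :
    D.planQ Θ h s a ≤ D.reward s a + dot θs (D.feature Θ 0 h s a) + D.width θs Θ 0 h s a := by
  refine (min_le_right _ _).trans ?_
  rw [add_assoc]
  gcongr
  refine csSup_le ⟨_, θs, hΘ.mem, rfl⟩ ?_
  rintro _ ⟨θ, hθ, rfl⟩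
  have h1 := (abs_le.1 (hM.le_width hΘ hθ 0 h s a)).2
  have e : D.feature Θ 0 h s a = fun i => expect (D.base i s a) (D.planValue Θ (D.H - h)) := by
    funext i; simp [feature]
  rw [e] at h1 ⊢
  linarith

/-- Optimism: planning with a set that contains the true parameter dominates every policy, as long
as the truncation at `1` is harmless. -/
lemma Realizes.policyValue_le_planValue [Nonempty A] (hM : D.Realizes P θs) (hΘ : Valid θs Θ)
    (π : Policy S A) :
    ∀ {n : ℕ} {c : ℝ} {s : S} (h : ℕ), 0 ≤ c → RestLeOne P D.reward n c s →
      policyValue P D.reward π n h s ≤ D.planValue Θ n s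
  | 0, c, s, h, hc, H => by simp [policyValue, planValue]
  | n + 1, c, s, h, hc, H => by
    have hr0 := hM.reward_nonneg
    have hr1 := hM.reward_le_one
    have hb : ∀ s', |D.planValue Θ n s'| ≤ 1 := fun s' => by
      simpa using hM.abs_planValue_pow_le_one hΘ n 1 s'
    rw [policyValue, planValue]
    refine expect_le_of_support _ (abs_reward_add_expect_le hr0 hr1 π n (h + 1) s) fun a _ => ?_
    refine le_trans (le_min ?_ ?_) (le_ciSup (f := fun a => min 1 (D.reward s a +
      sSup ((fun θ => dot θ fun i => expect (D.base i s a) (planValue D Θ n)) '' Θ)))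
      ⟨1, by rintro _ ⟨a, rfl⟩; exact min_le_left _ _⟩ a)
    · have := expect_le_of_support (P s a) (abs_policyValue_le hr0 hr1 π n (h + 1)) fun s' hs' =>
        (H a s' hs').policyValue_le hr0 hr1 π (h + 1)
      linarith
    · gcongr
      refine le_trans ?_ (le_csSup (bddAbove_dot hΘ zero_le_one fun i =>
        abs_expect_le _ hb) ⟨θs, hΘ.mem, rfl⟩)
      change _ ≤ dot θs _
      rw [hM.dot_expect hb]
      exact expect_mono _ (abs_policyValue_le hr0 hr1 π n (h + 1)) hb fun s' hs' =>
        Realizes.policyValue_le_planValue hM hΘ π (h + 1) (add_nonneg hc (hr0 s a)) (H a s' hs')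

/-- If the set contains a shrunken copy of the unit ball around the true parameter, then a small
variance estimate forces the features, and with them the width, to be small. -/
lemma Realizes.width_le_of_ball [Nonempty A] (hM : D.Realizes P θs) (hΘ : Valid θs Θ)
    {σ : ℝ} (hσ0 : 0 < σ) (hσ : σ ≤ 1 / 2) (hd : 1 ≤ d)
    (hball : ∀ θ : EuclideanSpace ℝ (Fin d), ‖θ‖ ≤ 1 → (1 - σ) • θs + σ • θ ∈ Θ)
    (m h : ℕ) (s : S) (a : A) :
    D.width θs Θ m h s a ≤ 5 * √(d * (D.varEst Θ m h s a / σ)) := by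
  set η := D.varEst Θ m h s a
  set x := D.feature Θ m h s a with hx
  set q := dot θs x with hq
  have hη : 0 ≤ η := hM.varEst_nonneg hΘ m h s a
  have hv : q ^ 2 ≤ dot θs (D.feature Θ (m + 1) h s a) := by
    have := hM.trueVar_nonneg hΘ m h s a
    rw [trueVar] at this
    linarith
  have hq0 : 0 ≤ q := hM.dot_feature_nonneg hΘ m h s a
  -- the variance functional is concave along the segment from `θs` to `θ`, and nonnegative at
  -- both ends
  have key : ∀ θ : EuclideanSpace ℝ (Fin d), ‖θ‖ ≤ 1 →
      dot θ x ^ 2 ≤ dot θ (D.feature Θ (m + 1) h s a) → (dot θ x - q) ^ 2 ≤ 2 * (η / σ) := by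
    intro θ hθ hθx
    have h1 := hM.le_varEst hΘ (hball θ hθ) m h s a
    simp only [dot_add_left, dot_smul_left, ← hx, ← hq] at h1
    have h2 : σ * (1 - σ) * (dot θ x - q) ^ 2 ≤ η := by
      have := mul_le_mul_of_nonneg_left hv (by linarith : 0 ≤ 1 - σ)
      have := mul_le_mul_of_nonneg_left hθx hσ0.le
      nlinarith
    have h3 : σ * ((dot θ x - q) ^ 2 / 2) ≤ η := by
      have : 0 ≤ σ * (1 / 2 - σ) * (dot θ x - q) ^ 2 :=
        mul_nonneg (mul_nonneg hσ0.le (by linarith)) (sq_nonneg _)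
      linarith
    have h4 : (dot θ x - q) ^ 2 / 2 ≤ η / σ := by
      rw [le_div_iff₀ hσ0]; linarith
    linarith
  set y := √(2 * (η / σ)) with hy
  have hy0 : 0 ≤ y := Real.sqrt_nonneg _
  -- the parameter `0`
  have hqy : q ≤ y := by
    refine Real.le_sqrt_of_sq_le ?_
    have := key 0 (by simp) (by simp [dot])
    simpa [dot] using this
  -- the parameter `e i`: by Jensen's inequality it satisfies the condition of `key`
  have hxy : ∀ i, |x i| ≤ 2 * y := by
    intro i
    have h1 := key (EuclideanSpace.single i 1) (by simp) (by
      rw [dot_single, dot_single]; exact hM.sq_feature_le hΘ m h s a i)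
    rw [dot_single] at h1
    have h2 : |x i - q| ≤ y := Real.abs_le_sqrt h1
    have h3 := abs_le.1 h2
    exact abs_le.2 ⟨by linarith [hM.feature_nonneg hΘ m h s a i], by linarith⟩
  have hd1 : 1 ≤ √(d : ℝ) := Real.one_le_sqrt.2 (by exact_mod_cast hd)
  refine (width_le_of_forall hΘ (c := 3 * √d * y) fun θ hθ => ?_).trans ?_
  · refine (abs_sub _ _).trans ?_
    have h1 := abs_dot_le (hΘ.norm_le θ hθ) (by positivity) hxy
    have h2 : |dot θs x| ≤ y := by rw [abs_of_nonneg hq0]; exact hqy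
    nlinarith
  · rw [hy, Real.sqrt_mul (by norm_num), Real.sqrt_mul (Nat.cast_nonneg d)]
    have h2 : √(2 : ℝ) ≤ 5 / 3 := by
      rw [Real.sqrt_le_left (by norm_num)]; norm_num
    have h3 : 0 ≤ √(d : ℝ) * √(η / σ) := by positivity
    nlinarith

/-- In the last step there is nothing left to predict. -/
lemma feature_last (D : Input d S A) (Θ : Set (EuclideanSpace ℝ (Fin d))) (m : ℕ) (s : S) (a : A) :
    D.feature Θ m D.H s a = fun _ => 0 := by
  funext i
  simp [feature, planValue, expect]

lemma planValue_eq_planQ {Θ : Set (EuclideanSpace ℝ (Fin d))} {h : ℕ} (hh : h ∈ Finset.Icc 1 D.H)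
    {s : S} {a : A} (H : ∀ a', D.planQ Θ h s a' ≤ D.planQ Θ h s a) :
    D.planValue Θ (D.H + 1 - h) s = D.planQ Θ h s a := by
  have := Finset.mem_Icc.1 hh
  rw [show D.H + 1 - h = D.H - h + 1 by omega, planValue]
  have : Nonempty A := ⟨a⟩
  exact le_antisymm (ciSup_le H)
    (le_ciSup (f := fun a => D.planQ Θ h s a) ⟨_, by rintro _ ⟨a', rfl⟩; exact H a'⟩ a)

end Input

namespace Input

variable {d : ℕ} {S A : Type*}

/-! ### Confidence sets depend on the past only -/

lemma confNext_congr_history (D : Input d S A) (T : ℕ → Set (EuclideanSpace ℝ (Fin d)))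
    {ω ω' : History S A} (k : ℕ) (hω : ∀ v ∈ Finset.Icc 1 (k - 1), ω v = ω' v) :
    D.confNext T ω k = D.confNext T ω' k := by
  have hl : ∀ m i, D.layer T ω k m i = D.layer T ω' k m i := by
    intro m i
    unfold layer
    refine Finset.filter_congr fun q hq => ?_
    rw [etaAt, etaAt, hω q.1 (Finset.mem_product.mp hq).1]
  have hmem : ∀ m i, ∀ q ∈ D.layer T ω' k m i, ω q.1 = ω' q.1 := by
    intro m i q hq
    exact hω q.1 (Finset.mem_product.mp (Finset.mem_filter.mp hq).1).1
  have h1 : ∀ m i ℓ μ θ,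
      ∑ q ∈ D.layer T ω k m i,
          clip ℓ (dot μ (D.xAt T ω m q.1 q.2)) * D.epsAt T ω m q.1 q.2 θ =
      ∑ q ∈ D.layer T ω' k m i,
          clip ℓ (dot μ (D.xAt T ω' m q.1 q.2)) * D.epsAt T ω' m q.1 q.2 θ := by
    intro m i ℓ μ θ
    rw [hl]
    refine Finset.sum_congr rfl fun q hq => ?_
    simp only [xAt, epsAt, hmem m i q hq]
  have h2 : ∀ m i ℓ μ,
      ∑ q ∈ D.layer T ω k m i,
          clip ℓ (dot μ (D.xAt T ω m q.1 q.2)) ^ 2 * D.etaAt T ω m q.1 q.2 * D.ι =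
      ∑ q ∈ D.layer T ω' k m i,
          clip ℓ (dot μ (D.xAt T ω' m q.1 q.2)) ^ 2 * D.etaAt T ω' m q.1 q.2 * D.ι := by
    intro m i ℓ μ
    rw [hl]
    refine Finset.sum_congr rfl fun q hq => ?_
    simp only [xAt, etaAt, hmem m i q hq]
  unfold confNext
  simp only [h1, h2]

lemma confSet_congr (D : Input d S A) {ω ω' : History S A} (j : ℕ)
    (hω : ∀ v < j, ω v = ω' v) : D.confSet ω j = D.confSet ω' j := by
  induction j using Nat.strong_induction_on with
  | _ j ih =>
    rw [D.confSet_eq ω, D.confSet_eq ω',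
      D.confNext_congr_history (ω' := ω') _ _ fun v hv => hω v ?_]
    · refine D.confNext_congr _ _ fun v hv => ih _ ?_ fun u hu => hω u ?_
      · have := Finset.mem_Icc.1 hv; omega
      · have := Finset.mem_Icc.1 hv; omega
    · have := Finset.mem_Icc.1 hv; omega

lemma norm_le_of_mem_confSet {D : Input d S A} {ω : History S A} {j : ℕ}
    {θ : EuclideanSpace ℝ (Fin d)} (h : θ ∈ D.confSet ω j) : ‖θ‖ ≤ 1 := by
  rw [confSet_eq] at h
  exact h.1

variable {D : Input d S A} {P : S → A → PMF S} {θs : EuclideanSpace ℝ (Fin d)}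
  {Θ : Set (EuclideanSpace ℝ (Fin d))}

lemma valid_confSet_iff {ω : History S A} {j : ℕ} :
    Valid θs (D.confSet ω j) ↔ θs ∈ D.confSet ω j :=
  ⟨fun h => h.mem, fun h => ⟨h, fun _ => norm_le_of_mem_confSet⟩⟩

/-! ### Exponential supermartingales -/

/-- The prediction error of the true parameter in one transition. -/
def dev (D : Input d S A) (θs : EuclideanSpace ℝ (Fin d)) (Θ : Set (EuclideanSpace ℝ (Fin d)))
    (m h : ℕ) (s : S) (a : A) (s' : S) : ℝ :=
  dot θs (D.feature Θ m h s a) - D.planValue Θ (D.H - h) s' ^ 2 ^ m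

lemma Realizes.abs_dev_le_one [Nonempty A] (hM : D.Realizes P θs) (hΘ : Valid θs Θ)
    (m h : ℕ) (s : S) (a : A) (s' : S) :
    |D.dev θs Θ m h s a s'| ≤ 1 := by
  have h1 := hM.dot_feature_nonneg hΘ m h s a
  have h2 := hM.dot_feature_le_one hΘ m h s a
  have h3 := hM.planValue_pow_nonneg hΘ (D.H - h) (2 ^ m) s'
  have h4 := hM.planValue_pow_le_one hΘ (D.H - h) (2 ^ m) s'
  exact abs_le.2 ⟨by rw [dev]; linarith, by rw [dev]; linarith⟩

lemma Realizes.expect_dev [Nonempty A] (hM : D.Realizes P θs) (hΘ : Valid θs Θ)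
    (m h : ℕ) (s : S) (a : A) :
    expect (P s a) (D.dev θs Θ m h s a) = 0 := by
  have e : D.dev θs Θ m h s a = fun s' => dot θs (D.feature Θ m h s a) +
      (-1) * D.planValue Θ (D.H - h) s' ^ 2 ^ m := by funext s'; simp [dev, sub_eq_add_neg]
  rw [e, expect_add _ (B := |dot θs (D.feature Θ m h s a)|) (B' := 1) (fun _ => le_rfl)
    (fun s' => by simpa using hM.abs_planValue_pow_le_one hΘ (D.H - h) (2 ^ m) s'),
    expect_const, expect_mul_left, ← hM.dot_feature hΘ]
  ring

lemma Realizes.expect_dev_sq [Nonempty A] (hM : D.Realizes P θs) (hΘ : Valid θs Θ)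
    (m h : ℕ) (s : S) (a : A) :
    expect (P s a) (fun s' => D.dev θs Θ m h s a s' ^ 2) = D.trueVar θs Θ m h s a :=
  hM.expect_sq_dev_eq_trueVar hΘ m h s a

lemma Realizes.lexpect_exp_dev_le [Nonempty A] (hM : D.Realizes P θs) (hΘ : Valid θs Θ)
    (m h : ℕ) (s : S) (a : A) {c : ℝ} (hc : |c| ≤ 1) :
    lexpect (P s a) (fun s' => ENNReal.ofReal (Real.exp
      (c * D.dev θs Θ m h s a s' - c ^ 2 * D.trueVar θs Θ m h s a))) ≤ 1 := by
  set v := D.trueVar θs Θ m h s a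
  set Y := D.dev θs Θ m h s a with hY
  have hY1 : ∀ s', |Y s'| ≤ 1 := hM.abs_dev_le_one hΘ m h s a
  have hcY : ∀ s', |c * Y s'| ≤ 1 := fun s' => by
    rw [abs_mul]; exact mul_le_one₀ hc (abs_nonneg _) (hY1 s')
  have hY2 : ∀ s', |c ^ 2 * Y s' ^ 2| ≤ 1 := fun s' => by
    rw [← mul_pow, abs_pow]; exact pow_le_one₀ (abs_nonneg _) (hcY s')
  calc _ ≤ lexpect (P s a) (fun s' => ENNReal.ofReal (Real.exp (-(c ^ 2 * v))) *
        ENNReal.ofReal (1 + (c * Y s' + c ^ 2 * Y s' ^ 2))) := by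
        refine lexpect_mono _ fun s' _ => ?_
        rw [← ENNReal.ofReal_mul (Real.exp_pos _).le]
        refine ENNReal.ofReal_le_ofReal ?_
        rw [sub_eq_neg_add, Real.exp_add]
        refine mul_le_mul_of_nonneg_left ?_ (Real.exp_pos _).le
        have := exp_le_one_add_add_sq (hcY s')
        linarith [mul_pow c (Y s') 2]
    _ = ENNReal.ofReal (Real.exp (-(c ^ 2 * v))) * ENNReal.ofReal (1 + c ^ 2 * v) := by
        rw [lexpect_const_mul,
          lexpect_ofReal (f := fun s' => 1 + (c * Y s' + c ^ 2 * Y s' ^ 2)) (B := 3)]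
        · rw [expect_add _ (B := 1) (B' := 2) (by simp)
            (fun s' => (abs_add_le _ _).trans (by linarith [hcY s', hY2 s'])),
            expect_const, expect_add _ hcY hY2, expect_mul_left, expect_mul_left, hY,
            hM.expect_dev hΘ, hM.expect_dev_sq hΘ]
          simp [v]
        · intro s'
          have := (abs_le.1 (hcY s')).1
          nlinarith [sq_nonneg (c * Y s')]
        · intro s'
          have := (abs_le.1 (hcY s')).2
          have := (abs_le.1 (hY2 s')).2
          linarith
    _ ≤ 1 := by
        rw [← ENNReal.ofReal_mul (Real.exp_pos _).le, ENNReal.ofReal_le_one, Real.exp_neg,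
          inv_mul_le_iff₀ (Real.exp_pos _), mul_one]
        have := Real.add_one_le_exp (c ^ 2 * v)
        linarith

lemma Realizes.lexpect_exp_abs_dev_le [Nonempty A] (hM : D.Realizes P θs) (hΘ : Valid θs Θ)
    (m h : ℕ) (s : S) (a : A) :
    lexpect (P s a) (fun s' => ENNReal.ofReal (Real.exp
      (|D.dev θs Θ m h s a s'| - 2 * √(D.trueVar θs Θ m h s a)))) ≤ 1 := by
  set v := D.trueVar θs Θ m h s a
  set Y := D.dev θs Θ m h s a with hY
  have hY1 : ∀ s', |Y s'| ≤ 1 := hM.abs_dev_le_one hΘ m h s a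
  have hY2 : ∀ s', |(|Y s'|)| ≤ 1 := fun s' => by rw [abs_abs]; exact hY1 s'
  have hE : expect (P s a) (fun s' => |Y s'|) ≤ √v := by
    refine Real.le_sqrt_of_sq_le ?_
    refine (sq_expect_le _ hY2).trans ?_
    simp only [sq_abs]
    exact (hM.expect_dev_sq hΘ m h s a).le
  calc _ ≤ lexpect (P s a) (fun s' => ENNReal.ofReal (Real.exp (-(2 * √v))) *
        ENNReal.ofReal (1 + 2 * |Y s'|)) := by
        refine lexpect_mono _ fun s' _ => ?_
        rw [← ENNReal.ofReal_mul (Real.exp_pos _).le]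
        refine ENNReal.ofReal_le_ofReal ?_
        rw [sub_eq_neg_add, Real.exp_add]
        refine mul_le_mul_of_nonneg_left ?_ (Real.exp_pos _).le
        have := exp_le_one_add_add_sq (hY2 s')
        nlinarith [hY1 s', abs_nonneg (Y s')]
    _ = ENNReal.ofReal (Real.exp (-(2 * √v))) *
        ENNReal.ofReal (1 + 2 * expect (P s a) (fun s' => |Y s'|)) := by
        rw [lexpect_const_mul, lexpect_ofReal (f := fun s' => 1 + 2 * |Y s'|) (B := 3)]
        · rw [expect_add _ (B := 1) (B' := 2) (by simp)
            (fun s' => by rw [abs_mul, abs_abs, abs_two]; linarith [hY1 s']),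
            expect_const, expect_mul_left]
        · intro s'; positivity
        · intro s'; linarith [hY1 s']
    _ ≤ 1 := by
        rw [← ENNReal.ofReal_mul (Real.exp_pos _).le, ENNReal.ofReal_le_one, Real.exp_neg,
          inv_mul_le_iff₀ (Real.exp_pos _), mul_one]
        have := Real.add_one_le_exp (2 * √v)
        linarith

variable [Nonempty S] [Nonempty A]

/-- Tail bound for a sum of adapted terms, each with conditional exponential moment at most `1`. A
term may depend on the confidence set in use, on the trajectory up to its step, and on the next
state. -/
lemma toOuterMeasure_sum_gt_le (D : Input d S A) (hH : 1 ≤ D.H) (init : ℕ → History S A → PMF S)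
    (alg : Learner S A)
    {F : ℕ → Set (EuclideanSpace ℝ (Fin d)) → Trajectory S A → ℕ → S → ℝ}
    (hpast : ∀ k Θ τ τ' h s', (∀ u ≤ h, τ u = τ' u) → F k Θ τ h s' = F k Θ τ' h s')
    (hF : ∀ k ω τ h, lexpect (P (τ h).1 (τ h).2)
      (fun s' => ENNReal.ofReal (Real.exp (F k (D.confSet ω (k - 1)) τ h s'))) ≤ 1) (L : ℝ) :
    (historyLaw P D.H init alg D.K).toOuterMeasure
      {ω | L < ∑ k ∈ Finset.Icc 1 D.K, ∑ h ∈ Finset.Ico 1 D.H,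
        F k (D.confSet ω (k - 1)) (ω k) h (ω k (h + 1)).1} ≤ ENNReal.ofReal (Real.exp (-L)) := by
  refine toOuterMeasure_exp_le _ (fun ω => ∑ k ∈ Finset.Icc 1 D.K, ∑ h ∈ Finset.Ico 1 D.H,
        F k (D.confSet ω (k - 1)) (ω k) h (ω k (h + 1)).1) L ?_
  have key := lexpect_historyLaw_prod_le (P := P) (H := D.H) (K := D.K) (init := init) (alg := alg)
    (G := fun k ω τ => ∏ h ∈ Finset.Ico 1 D.H,
      ENNReal.ofReal (Real.exp (F k (D.confSet ω (k - 1)) τ h (τ (h + 1)).1))) ?_ ?_ D.K le_rfl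
  · convert key using 3 with ω
    rw [Real.exp_sum, ENNReal.ofReal_prod_of_nonneg fun _ _ => (Real.exp_pos _).le]
    refine Finset.prod_congr rfl fun k _ => ?_
    rw [Real.exp_sum, ENNReal.ofReal_prod_of_nonneg fun _ _ => (Real.exp_pos _).le]
  · intro k ω ω' h
    rw [D.confSet_congr (ω' := ω') (k - 1) fun v hv => h v (by omega)]
  · intro k _ ω s _
    obtain ⟨n, hn⟩ : ∃ n, D.H = n + 1 := ⟨D.H - 1, by omega⟩
    have := lexpect_runSteps_prod_le (P := P) (π := alg.policy k ω)
      (φ := fun τ h s' => ENNReal.ofReal (Real.exp (F k (D.confSet ω (k - 1)) τ h s')))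
      (fun τ τ' h s' hτ => by rw [hpast k _ τ τ' h s' hτ]) (fun τ h => hF k ω τ h) n 1 s
      (fun _ => Classical.arbitrary (S × A))
    rw [hn, episodeLaw]
    rwa [Nat.add_comm 1 n] at this

/-- The variance of the `m`-th power of the planned value in step `h` of episode `k`. -/
def trueVarAt (D : Input d S A) (θs : EuclideanSpace ℝ (Fin d)) (ω : History S A) (m k h : ℕ) : ℝ :=
  D.trueVar θs (D.confSet ω (k - 1)) m h (ω k h).1 (ω k h).2

open Classical in
/-- Freedman's inequality for weighted prediction errors, with a fixed scale `l`. The errors are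
counted as long as the confidence sets contain the true parameter. -/
lemma Realizes.freedman (hM : D.Realizes P θs) (hH : 1 ≤ D.H) (init : ℕ → History S A → PMF S)
    (alg : Learner S A) (m : ℕ)
    {w : ℕ → Set (EuclideanSpace ℝ (Fin d)) → Trajectory S A → ℕ → ℝ}
    (hpast : ∀ k Θ τ τ' h, (∀ u ≤ h, τ u = τ' u) → w k Θ τ h = w k Θ τ' h)
    (hw : ∀ k Θ τ h, |w k Θ τ h| ≤ 1) {l : ℝ} (hl0 : 0 ≤ l) (hl1 : l ≤ 1) (L : ℝ) :
    (historyLaw P D.H init alg D.K).toOuterMeasure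
      {ω | L < ∑ k ∈ Finset.Icc 1 D.K, ∑ h ∈ Finset.Icc 1 D.H,
        if θs ∈ D.confSet ω (k - 1) then
          l * w k (D.confSet ω (k - 1)) (ω k) h * D.epsAt (D.confSet ω) ω m k h θs -
            (l * w k (D.confSet ω (k - 1)) (ω k) h) ^ 2 * D.trueVarAt θs ω m k h
        else 0} ≤ ENNReal.ofReal (Real.exp (-L)) := by
  have := D.toOuterMeasure_sum_gt_le (P := P) hH init alg
    (F := fun k Θ τ h s' => if θs ∈ Θ then
      l * w k Θ τ h * D.dev θs Θ m h (τ h).1 (τ h).2 s' -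
            (l * w k Θ τ h) ^ 2 * D.trueVar θs Θ m h (τ h).1 (τ h).2 else 0) ?_ ?_ L
  · convert this using 5 with ω
    refine Finset.sum_congr rfl fun k _ => ?_
    rw [← Finset.Ico_insert_right hH, Finset.sum_insert (by simp)]
    have e : D.epsAt (D.confSet ω) ω m k D.H θs = 0 := by
      simp [epsAt, xAt, feature_last, dot_zero_right, planValue]
    have e' : D.trueVarAt θs ω m k D.H = 0 := by
      simp [trueVarAt, trueVar, feature_last, dot_zero_right]
    rw [e, e']
    simp only [mul_zero, sub_zero, ite_self, zero_add]
    rfl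
  · intro k Θ τ τ' h s' hτ
    simp only [hpast k Θ τ τ' h hτ, hτ h le_rfl]
  · intro k ω τ h
    by_cases hΘ : θs ∈ D.confSet ω (k - 1)
    · simp only [if_pos hΘ]
      refine hM.lexpect_exp_dev_le (valid_confSet_iff.2 hΘ) m h _ _ ?_
      rw [abs_mul, abs_of_nonneg hl0]
      exact mul_le_one₀ hl1 (abs_nonneg _) (hw _ _ _ _)
    · simp [hΘ, lexpect_const]

open Classical in
/-- The prediction errors in the steps with a very small variance estimate are negligible even
without any cancellation. -/
lemma Realizes.sum_abs_eps_tail (hM : D.Realizes P θs) (hH : 1 ≤ D.H)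
    (init : ℕ → History S A → PMF S) (alg : Learner S A) (m : ℕ) (c L : ℝ) :
    (historyLaw P D.H init alg D.K).toOuterMeasure
      {ω | L < ∑ k ∈ Finset.Icc 1 D.K, ∑ h ∈ Finset.Icc 1 D.H,
        if θs ∈ D.confSet ω (k - 1) ∧ D.etaAt (D.confSet ω) ω m k h ≤ c then
          |D.epsAt (D.confSet ω) ω m k h θs| - 2 * √(D.trueVarAt θs ω m k h)
        else 0} ≤ ENNReal.ofReal (Real.exp (-L)) := by
  have := D.toOuterMeasure_sum_gt_le (P := P) hH init alg
    (F := fun k Θ τ h s' => if θs ∈ Θ ∧ D.varEst Θ m h (τ h).1 (τ h).2 ≤ c then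
      |D.dev θs Θ m h (τ h).1 (τ h).2 s'| - 2 * √(D.trueVar θs Θ m h (τ h).1 (τ h).2)
      else 0) ?_ ?_ L
  · convert this using 5 with ω
    refine Finset.sum_congr rfl fun k _ => ?_
    rw [← Finset.Ico_insert_right hH, Finset.sum_insert (by simp)]
    have e : D.epsAt (D.confSet ω) ω m k D.H θs = 0 := by
      simp [epsAt, xAt, feature_last, dot_zero_right, planValue]
    have e' : D.trueVarAt θs ω m k D.H = 0 := by
      simp [trueVarAt, trueVar, feature_last, dot_zero_right]
    rw [e, e']
    simp only [mul_zero, sub_zero, Real.sqrt_zero, abs_zero, ite_self, zero_add]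
    rfl
  · intro k Θ τ τ' h s' hτ
    simp only [hτ h le_rfl]
  · intro k ω τ h
    by_cases hΘ : θs ∈ D.confSet ω (k - 1) ∧ D.varEst (D.confSet ω (k - 1)) m h (τ h).1 (τ h).2 ≤ c
    · simp only [if_pos hΘ]
      exact hM.lexpect_exp_abs_dev_le (valid_confSet_iff.2 hΘ.1) m h _ _
    · simp [hΘ, lexpect_const]

/-- Tail bound for the difference between the rewards collected in all episodes and their
expectations. -/
lemma Realizes.sum_reward_tail (hM : D.Realizes P θs) (init : ℕ → History S A → PMF S)
    (hinit : ∀ k ∈ Finset.Icc 1 D.K, ∀ ω, ∀ s ∈ (init k ω).support,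
      TotalRewardLeOne P D.reward D.H s) (hH : 1 ≤ D.H) {alg : Learner S A}
    (halg : ∀ k ω ω', (∀ v < k, ω v = ω' v) → alg k ω = alg k ω') {l : ℝ} (hl0 : 0 ≤ l)
    (hl1 : l ≤ 1) (L : ℝ) :
    (historyLaw P D.H init alg D.K).toOuterMeasure
      {ω | L < ∑ k ∈ Finset.Icc 1 D.K, (l * (∑ h ∈ Finset.Icc 1 D.H,
        D.reward (ω k h).1 (ω k h).2 - policyValue P D.reward (alg.policy k ω) D.H 1 (ω k 1).1) -
          l ^ 2)} ≤ ENNReal.ofReal (Real.exp (-L)) := by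
  refine toOuterMeasure_exp_le _ (fun ω => ∑ k ∈ Finset.Icc 1 D.K, (l * (∑ h ∈ Finset.Icc 1 D.H,
        D.reward (ω k h).1 (ω k h).2 - policyValue P D.reward (alg.policy k ω) D.H 1 (ω k 1).1) -
          l ^ 2)) L ?_
  have key := lexpect_historyLaw_prod_le (P := P) (H := D.H) (K := D.K) (init := init) (alg := alg)
    (G := fun k ω τ => ENNReal.ofReal (Real.exp (l * (∑ h ∈ Finset.Icc 1 D.H,
        D.reward (τ h).1 (τ h).2 - policyValue P D.reward (alg.policy k ω) D.H 1 (τ 1).1) -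
          l ^ 2))) ?_ ?_ D.K le_rfl
  · convert key using 3 with ω
    rw [Real.exp_sum, ENNReal.ofReal_prod_of_nonneg fun _ _ => (Real.exp_pos _).le]
  · intro k ω ω' h
    have e : alg.policy k ω = alg.policy k ω' := by
      unfold Learner.policy; rw [halg k ω ω' h]
    rw [e]
  · intro k hk ω s hs
    refine (lexpect_congr _ fun τ hτ => ?_).trans_le (lexpect_episodeLaw_exp_reward_le
      hM.reward_nonneg hM.reward_le_one (hinit k hk ω s hs) (alg.policy k ω) hl0 hl1)
    rw [(eq_of_mem_support_runSteps hτ).2 (by omega)]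

end Input

/-! ### Clipping and nets -/

lemma clip_eq (ℓ : ℕ) (x : ℝ) : clip ℓ x = max (-(2 : ℝ)⁻¹ ^ ℓ) (min x ((2 : ℝ)⁻¹ ^ ℓ)) := by
  have hp : (0 : ℝ) < (2 : ℝ)⁻¹ ^ ℓ := by positivity
  unfold clip
  generalize (2 : ℝ)⁻¹ ^ ℓ = c at hp
  rcases lt_trichotomy x 0 with hx | rfl | hx
  · rw [abs_of_neg hx, div_neg, div_self hx.ne, min_eq_left (by linarith : x ≤ c), mul_neg, mul_one,
      ← max_neg_neg, neg_neg, max_comm]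
  · simp [hp.le]
  · rw [abs_of_pos hx, div_self hx.ne', mul_one, max_eq_right]
    exact le_min (by linarith) (by linarith)

/-- The clipping operator, rescaled to have range `[-1, 1]`. -/
def unitClip (ℓ : ℕ) (x : ℝ) : ℝ := 2 ^ ℓ * clip ℓ x

lemma clip_eq_mul_unitClip (ℓ : ℕ) (x : ℝ) : clip ℓ x = (2 : ℝ)⁻¹ ^ ℓ * unitClip ℓ x := by
  rw [unitClip, ← mul_assoc, ← mul_pow]; norm_num

lemma unitClip_eq (ℓ : ℕ) (x : ℝ) : unitClip ℓ x = max (-1) (min (2 ^ ℓ * x) 1) := by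
  have hp : (0 : ℝ) ≤ 2 ^ ℓ := by positivity
  have e : (2 : ℝ) ^ ℓ * (2 : ℝ)⁻¹ ^ ℓ = 1 := by rw [← mul_pow]; norm_num
  rw [unitClip, clip_eq, mul_max_of_nonneg _ _ hp, mul_min_of_nonneg _ _ hp, mul_neg, e]

lemma abs_unitClip_le_one (ℓ : ℕ) (x : ℝ) : |unitClip ℓ x| ≤ 1 := by
  rw [unitClip_eq]
  exact abs_le.2 ⟨le_max_left _ _, max_le (by norm_num) (min_le_right _ _)⟩

lemma abs_unitClip_sub_le (ℓ : ℕ) (x y : ℝ) :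
    |unitClip ℓ x - unitClip ℓ y| ≤ 2 ^ ℓ * |x - y| := by
  rw [unitClip_eq, unitClip_eq]
  have h1 := abs_max_sub_max_le_max (-1) (min (2 ^ ℓ * x) 1) (-1) (min (2 ^ ℓ * y) 1)
  have h2 := abs_min_sub_min_le_max (2 ^ ℓ * x) 1 (2 ^ ℓ * y) 1
  rw [sub_self, abs_zero, max_eq_right (a := 0) (abs_nonneg _)] at h1
  rw [sub_self, abs_zero, max_eq_left (b := 0) (abs_nonneg _)] at h2
  refine h1.trans (h2.trans (le_of_eq ?_))
  rw [← mul_sub, abs_mul, abs_of_nonneg (by positivity)]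

lemma clip_sq (ℓ : ℕ) (x : ℝ) : clip ℓ x ^ 2 = min (x ^ 2) (((2 : ℝ)⁻¹ ^ ℓ) ^ 2) := by
  have hp : (0 : ℝ) < (2 : ℝ)⁻¹ ^ ℓ := by positivity
  rw [clip_eq]
  generalize (2 : ℝ)⁻¹ ^ ℓ = c at hp
  rcases le_total x c with h1 | h1
  · rcases le_total (-c) x with h2 | h2
    · rw [min_eq_left h1, max_eq_right h2, min_eq_left]
      exact sq_le_sq' h2 h1
    · rw [min_eq_left h1, max_eq_left h2, min_eq_right]
      · ring
      · nlinarith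
  · rw [min_eq_right h1, max_eq_right (by linarith), min_eq_right]
    nlinarith

lemma clip_sq_le_mul (ℓ : ℕ) (x : ℝ) : clip ℓ x ^ 2 ≤ clip ℓ x * x := by
  have hp : (0 : ℝ) < (2 : ℝ)⁻¹ ^ ℓ := by positivity
  rw [clip_eq]
  generalize (2 : ℝ)⁻¹ ^ ℓ = c at hp
  rcases le_total x c with h1 | h1
  · rcases le_total (-c) x with h2 | h2
    · rw [min_eq_left h1, max_eq_right h2, sq]
    · rw [min_eq_left h1, max_eq_left h2]
      nlinarith
  · rw [min_eq_right h1, max_eq_right (by linarith)]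
    nlinarith

lemma mul_le_half_five {t y : ℝ} (ht : 1 / 2 ≤ t) (ht1 : t ≤ 1) (hy : 0 ≤ y) :
    t * y + y / t ≤ 5 / 2 * y := by
  have h0 : 0 < t := by linarith
  have : t + 1 / t ≤ 5 / 2 := by
    rw [← sub_nonneg, show 5 / 2 - (t + 1 / t) = (t - 1 / 2) * (2 - t) / t by field_simp; ring]
    exact div_nonneg (mul_nonneg (by linarith) (by linarith)) h0.le
  calc t * y + y / t = (t + 1 / t) * y := by ring
    _ ≤ _ := mul_le_mul_of_nonneg_right this hy

/-- Optimizing a family of linearized tail bounds over dyadic scales. -/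
lemma le_of_forall_dyadic {X W L B : ℝ} {J : ℕ} (hW : 0 ≤ W) (hL : 1 ≤ L) (hB : 1 ≤ B) (hWB : W ≤ B)
    (hJ : B < 2 ^ J)
    (h : ∀ j ∈ Finset.range (J + 1), (2 : ℝ)⁻¹ ^ j * X - ((2 : ℝ)⁻¹ ^ j) ^ 2 * W ≤ L) :
    X ≤ 5 / 2 * √(L * W) + L := by
  have hs : 0 ≤ √(L * W) := Real.sqrt_nonneg _
  rcases le_total W L with hWL | hWL
  · have h0 := h 0 (by simp)
    have h1 : W ≤ √(L * W) := Real.le_sqrt_of_sq_le (by nlinarith)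
    simp only [pow_zero, one_mul, one_pow] at h0
    linarith
  · have hW0 : 0 < W := by linarith
    -- the optimal scale, rounded to a power of two
    set l := √(L / W) with hl
    have hl0 : 0 < l := Real.sqrt_pos.2 (by positivity)
    have hl1 : l ≤ 1 := Real.sqrt_le_one.2 (div_le_one_of_le₀ hWL hW)
    obtain ⟨n, hn1, hn2⟩ := exists_nat_pow_near_of_lt_one hl0 hl1 (y := (2 : ℝ)⁻¹) (by norm_num)
      (by norm_num)
    have hnJ : n < J := by
      by_contra! hJn
      have h1 : l * 2 ^ J ≤ 1 := by
        calc l * 2 ^ J ≤ (2 : ℝ)⁻¹ ^ n * 2 ^ n :=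
              mul_le_mul hn2 (pow_le_pow_right₀ (by norm_num) hJn) (by positivity) (by positivity)
          _ = 1 := by rw [← mul_pow]; norm_num
      have h2 : 1 / B ≤ l := by
        refine Real.le_sqrt_of_sq_le ?_
        rw [div_pow, one_pow, div_le_div_iff₀ (by positivity) hW0]
        nlinarith
      have h3 : 1 < l * 2 ^ J := by
        calc (1 : ℝ) = 1 / B * B := by field_simp
          _ < 1 / B * 2 ^ J := by gcongr
          _ ≤ l * 2 ^ J := by gcongr
      linarith
    have hj := h (n + 1) (by simp; omega)
    set c := (2 : ℝ)⁻¹ ^ (n + 1) with hc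
    have hc0 : 0 < c := by positivity
    have hc2 : l / 2 ≤ c := by rw [hc, pow_succ]; linarith
    have hX : X ≤ c * W + L / c := by
      have : c * X ≤ c * (c * W + L / c) := by
        rw [mul_add, mul_div_cancel₀ _ hc0.ne']; linarith
      exact le_of_mul_le_mul_left this hc0
    set y := √(L * W) with hy
    have e1 : y = l * W := by
      rw [hy, hl, Real.sqrt_eq_iff_mul_self_eq (by positivity) (by positivity)]
      have := Real.mul_self_sqrt (show 0 ≤ L / W by positivity)
      rw [mul_mul_mul_comm, this]
      field_simp
    have e2 : L = y * l := by
      rw [e1, mul_right_comm, hl, Real.mul_self_sqrt (by positivity)]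
      field_simp
    have h3 := mul_le_half_five (t := c / l) (y := y) (by rw [le_div_iff₀ hl0]; linarith)
      (by rw [div_le_one hl0]; exact hn1.le) hs
    have e3 : c / l * y = c * W := by rw [e1]; field_simp
    have e4 : y / (c / l) = L / c := by rw [e2]; field_simp
    rw [e3, e4] at h3
    linarith

/-- Passing from a point of the net to an arbitrary direction: the weights `g'` of the net point
are close to the weights `g`. -/
lemma abs_sum_le_of_close {Q : Type*} (T : Finset Q) {g g' e v : Q → ℝ} {L ρ : ℝ}
    (hL : 0 ≤ L) (hg : ∀ q ∈ T, |g q| ≤ 1) (hg' : ∀ q ∈ T, |g' q| ≤ 1) (he : ∀ q ∈ T, |e q| ≤ 1)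
    (hv0 : ∀ q ∈ T, 0 ≤ v q) (hv1 : ∀ q ∈ T, v q ≤ 1) (hρ : ∀ q ∈ T, |g' q - g q| ≤ ρ)
    (hTρ : T.card * ρ ≤ L / 160)
    (h : |∑ q ∈ T, g' q * e q| ≤ 5 / 2 * √(2 * L * ∑ q ∈ T, g' q ^ 2 * v q) + 2 * L) :
    |∑ q ∈ T, g q * e q| ≤ 4 * √(∑ q ∈ T, g q ^ 2 * v q * L) + 3 * L := by
  have h1 : |∑ q ∈ T, g q * e q| ≤ |∑ q ∈ T, g' q * e q| + L / 160 := by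
    have e1 : ∑ q ∈ T, g q * e q = ∑ q ∈ T, g' q * e q - ∑ q ∈ T, (g' q - g q) * e q := by
      rw [← Finset.sum_sub_distrib]; exact Finset.sum_congr rfl fun q _ => by ring
    rw [e1]
    refine (abs_sub _ _).trans ?_
    gcongr
    refine (Finset.abs_sum_le_sum_abs _ _).trans (le_trans ?_ hTρ)
    rw [← nsmul_eq_mul]
    refine Finset.sum_le_card_nsmul _ _ _ fun q hq => ?_
    rw [abs_mul]
    calc _ ≤ ρ * 1 := mul_le_mul (hρ q hq) (he q hq) (abs_nonneg _) ((abs_nonneg _).trans (hρ q hq))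
      _ = ρ := mul_one _
  have h2 : ∑ q ∈ T, g' q ^ 2 * v q ≤ 5 / 4 * ∑ q ∈ T, g q ^ 2 * v q + 10 * (L / 160) := by
    have h3 : ∑ q ∈ T, g' q ^ 2 * v q ≤ ∑ q ∈ T, (5 / 4 * (g q ^ 2 * v q) + 10 * ρ) := by
      refine Finset.sum_le_sum fun q hq => ?_
      have a1 := hv0 q hq
      have a2 := hv1 q hq
      have a3 : (g' q - g q) ^ 2 ≤ 2 * ρ := by
        rw [← sq_abs, sq]
        refine mul_le_mul ?_ (hρ q hq) (abs_nonneg _) (by norm_num)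
        exact (abs_sub _ _).trans (by linarith [hg q hq, hg' q hq])
      have a4 : g' q ^ 2 ≤ 5 / 4 * g q ^ 2 + 5 * (g' q - g q) ^ 2 := by
        nlinarith [sq_nonneg (g q / 2 - 2 * (g' q - g q))]
      have a5 : 0 ≤ ρ := (abs_nonneg _).trans (hρ q hq)
      nlinarith
    refine h3.trans ?_
    rw [Finset.sum_add_distrib, ← Finset.mul_sum, Finset.sum_const, nsmul_eq_mul]
    linarith
  have hW : 0 ≤ ∑ q ∈ T, g q ^ 2 * v q :=
    Finset.sum_nonneg fun q hq => mul_nonneg (sq_nonneg _) (hv0 q hq)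
  rw [← Finset.sum_mul]
  generalize ∑ q ∈ T, g q ^ 2 * v q = W at *
  generalize ∑ q ∈ T, g' q ^ 2 * v q = W' at *
  have h4 : √(2 * L * W') ≤ 8 / 5 * √(W * L) + 9 / 25 * L := by
    rw [Real.sqrt_le_left (by positivity)]
    have := Real.sq_sqrt (show 0 ≤ W * L by positivity)
    have h5 : 0 ≤ √(W * L) * L := by positivity
    nlinarith [mul_nonneg hW hL, mul_nonneg hL (sub_nonneg.2 h2)]
  linarith

/-- The least `k` with `n < 2 ^ k`, for `n ≠ 0`. -/
def logCeil (n : ℕ) : ℕ := Nat.log 2 n + 1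

lemma lt_two_pow_logCeil (n : ℕ) : (n : ℝ) < 2 ^ logCeil n := by
  exact_mod_cast Nat.lt_pow_succ_log_self (by norm_num) n

lemma two_pow_logCeil_le {n : ℕ} (hn : n ≠ 0) : (2 : ℝ) ^ logCeil n ≤ 2 * n := by
  rw [logCeil, pow_succ, mul_comm]
  have : 2 ^ Nat.log 2 n ≤ n := Nat.pow_log_le_self 2 hn
  have : (2 : ℝ) ^ Nat.log 2 n ≤ n := by exact_mod_cast this
  linarith

/-- The point of the net with integer coordinates `z`, at mesh `1 / (128 n ^ 2)`. -/
def gridPoint {d : ℕ} (n : ℕ) (z : Fin d → ℤ) : EuclideanSpace ℝ (Fin d) :=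
  WithLp.toLp 2 fun i => (z i : ℝ) / (128 * (n : ℝ) ^ 2)

/-- The integer coordinates of the points of the net. -/
def gridBox (d n : ℕ) : Finset (Fin d → ℤ) :=
  Fintype.piFinset fun _ => Finset.Icc (-(256 * n ^ 2 : ℕ) : ℤ) (256 * n ^ 2 : ℕ)

lemma exists_gridPoint_close {d n : ℕ} (hn : 0 < n) {μ : EuclideanSpace ℝ (Fin d)} (hμ : ‖μ‖ ≤ 2) :
    ∃ z ∈ gridBox d n, ∀ x : Fin d → ℝ, (∀ i, |x i| ≤ 1) →
      |dot (gridPoint n z) x - dot μ x| ≤ d / (128 * (n : ℝ) ^ 2) := by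
  set c : ℝ := 128 * (n : ℝ) ^ 2 with hc
  have hc0 : 0 < c := by positivity
  have hμi : ∀ i, |μ i| ≤ 2 := fun i => by
    have := PiLp.norm_apply_le μ i
    rw [Real.norm_eq_abs] at this
    linarith
  refine ⟨fun i => ⌊c * μ i⌋, ?_, fun x hx => ?_⟩
  · rw [gridBox, Fintype.mem_piFinset]
    intro i
    have h := abs_le.1 (hμi i)
    have h1 : ((256 * n ^ 2 : ℕ) : ℝ) = c * 2 := by rw [hc]; push_cast; ring
    rw [Finset.mem_Icc]
    constructor
    · rw [Int.le_floor]; push_cast at h1 ⊢; nlinarith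
    · have h3 := Int.floor_le (c * μ i)
      have : ((⌊c * μ i⌋ : ℤ) : ℝ) ≤ ((256 * n ^ 2 : ℕ) : ℝ) := by rw [h1]; nlinarith
      exact_mod_cast this
  · rw [← dot_sub_left, dot]
    refine (Finset.abs_sum_le_sum_abs _ _).trans ?_
    calc _ ≤ ∑ _i : Fin d, 1 / c := by
          refine Finset.sum_le_sum fun i _ => ?_
          rw [abs_mul]
          have h1 := Int.floor_le (c * μ i)
          have h2 := Int.lt_floor_add_one (c * μ i)
          have h3 : |(gridPoint n (fun i => ⌊c * μ i⌋) - μ) i| ≤ 1 / c := by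
            have e : (gridPoint n (fun i => ⌊c * μ i⌋) - μ) i = (⌊c * μ i⌋ - c * μ i) / c := by
              simp only [gridPoint, PiLp.sub_apply, ← hc]
              field_simp
            rw [e, abs_div, abs_of_pos hc0]
            gcongr
            exact abs_le.2 ⟨by linarith, by linarith⟩
          calc _ ≤ 1 / c * 1 := mul_le_mul h3 (hx i) (abs_nonneg _) (by positivity)
            _ = _ := mul_one _
      _ = d / c := by simp [div_eq_mul_inv]

namespace Input

variable {d : ℕ} {S A : Type*}

/-! ### The confidence sets contain the true parameter -/

/-- The indices `i` of the variance layers that matter: outside of this range a layer is empty or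
has negligible variance. -/
def layers (D : Input d S A) : Finset ℤ :=
  Finset.Ioc (-(logCeil d : ℤ)) (logCeil (d * (D.H * D.K) ^ 3))

/-- The weights that belong to one constraint in the definition of the confidence sets, with
sign `σ` and direction `μ`. -/
def confWeight (D : Input d S A) (k₀ m : ℕ) (i : ℤ) (ℓ : ℕ) (μ : EuclideanSpace ℝ (Fin d)) (σ : ℝ) :
    ℕ → Set (EuclideanSpace ℝ (Fin d)) → Trajectory S A → ℕ → ℝ := by
  classical exact fun k Θ τ h =>
    if k ∈ Finset.Icc 1 (k₀ - 1) ∧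
      D.varEst Θ m h (τ h).1 (τ h).2 ∈ Set.Ioc ((2 : ℝ) ^ (-i)) ((2 : ℝ) ^ (1 - i))
    then σ * unitClip ℓ (dot μ (D.feature Θ m h (τ h).1 (τ h).2)) else 0

open Classical in
/-- The exponent in Freedman's inequality, with weights `w` and scale `l`. -/
def freedmanSum (D : Input d S A) (θs : EuclideanSpace ℝ (Fin d)) (m : ℕ)
    (w : ℕ → Set (EuclideanSpace ℝ (Fin d)) → Trajectory S A → ℕ → ℝ) (l : ℝ)
    (ω : History S A) : ℝ :=
  ∑ k ∈ Finset.Icc 1 D.K, ∑ h ∈ Finset.Icc 1 D.H,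
    if θs ∈ D.confSet ω (k - 1) then
      l * w k (D.confSet ω (k - 1)) (ω k) h * D.epsAt (D.confSet ω) ω m k h θs -
        (l * w k (D.confSet ω (k - 1)) (ω k) h) ^ 2 * D.trueVarAt θs ω m k h
    else 0

open Classical in
/-- The compensated sum of the absolute prediction errors in the steps with a variance estimate of
at most `1 / (d (HK) ^ 3)`. -/
def tinySum (D : Input d S A) (θs : EuclideanSpace ℝ (Fin d)) (m : ℕ) (ω : History S A) : ℝ :=
  ∑ k ∈ Finset.Icc 1 D.K, ∑ h ∈ Finset.Icc 1 D.H,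
    if θs ∈ D.confSet ω (k - 1) ∧
        D.etaAt (D.confSet ω) ω m k h ≤ 1 / ((d * (D.H * D.K) ^ 3 : ℕ) : ℝ) then
      |D.epsAt (D.confSet ω) ω m k h θs| - 2 * √(D.trueVarAt θs ω m k h)
    else 0

/-- The event on which all confidence sets contain the true parameter. -/
structure ConfEvent (D : Input d S A) (θs : EuclideanSpace ℝ (Fin d)) (ω : History S A) : Prop where
  grid : ∀ k₀ ∈ Finset.range D.K, ∀ m ∈ Finset.range (D.L₀ + 1), ∀ i ∈ D.layers,
    ∀ ℓ ∈ Finset.Icc 1 D.L', ∀ z ∈ gridBox d (D.H * D.K),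
    ∀ j ∈ Finset.range (logCeil (D.H * D.K) + 1), ∀ σ ∈ ({1, -1} : Finset ℝ),
      D.freedmanSum θs m (D.confWeight k₀ m i ℓ (gridPoint (D.H * D.K) z) σ) ((2 : ℝ)⁻¹ ^ j) ω ≤
        2 * D.ι
  tiny : ∀ m ∈ Finset.range (D.L₀ + 1), D.tinySum θs m ω ≤ 2 * D.ι

variable {D : Input d S A} {P : S → A → PMF S} {θs : EuclideanSpace ℝ (Fin d)} {ω : History S A}

lemma layer_subset (T : ℕ → Set (EuclideanSpace ℝ (Fin d))) (k m : ℕ) (i : ℤ) :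
    D.layer T ω k m i ⊆ Finset.Icc 1 (k - 1) ×ˢ Finset.Icc 1 D.H := by
  unfold layer
  exact Finset.filter_subset _ _

lemma mem_layer {T : ℕ → Set (EuclideanSpace ℝ (Fin d))} {k m : ℕ} {i : ℤ} {q : ℕ × ℕ} :
    q ∈ D.layer T ω k m i ↔ q ∈ Finset.Icc 1 (k - 1) ×ˢ Finset.Icc 1 D.H ∧
      D.etaAt T ω m q.1 q.2 ∈ Set.Ioc ((2 : ℝ) ^ (-i)) ((2 : ℝ) ^ (1 - i)) := by
  unfold layer
  exact Finset.mem_filter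

lemma freedmanSum_confWeight {k₀ m : ℕ} (hk : k₀ ≤ D.K)
    (hθ : ∀ v ∈ Finset.Icc 1 (k₀ - 1), θs ∈ D.confSet ω (v - 1)) (i : ℤ) (ℓ : ℕ)
    (μ : EuclideanSpace ℝ (Fin d)) {σ : ℝ} (hσ : σ ^ 2 = 1) (l : ℝ) :
    D.freedmanSum θs m (D.confWeight k₀ m i ℓ μ σ) l ω =
      l * (σ * ∑ q ∈ D.layer (D.confSet ω) ω k₀ m i,
        unitClip ℓ (dot μ (D.xAt (D.confSet ω) ω m q.1 q.2)) *
          D.epsAt (D.confSet ω) ω m q.1 q.2 θs) -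
      l ^ 2 * ∑ q ∈ D.layer (D.confSet ω) ω k₀ m i,
        unitClip ℓ (dot μ (D.xAt (D.confSet ω) ω m q.1 q.2)) ^ 2 * D.trueVarAt θs ω m q.1 q.2 := by
  classical
  have hsub : D.layer (D.confSet ω) ω k₀ m i ⊆ Finset.Icc 1 D.K ×ˢ Finset.Icc 1 D.H :=
    (layer_subset _ _ _ _).trans (Finset.product_subset_product_left
      (Finset.Icc_subset_Icc_right (by omega)))
  rw [freedmanSum, ← Finset.sum_product', Finset.mul_sum, Finset.mul_sum, Finset.mul_sum,
    ← Finset.sum_sub_distrib, ← Finset.sum_subset hsub]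
  · refine Finset.sum_congr rfl fun q hq => ?_
    obtain ⟨hq1, hq2⟩ := mem_layer.1 hq
    have hq3 := (Finset.mem_product.1 hq1).1
    rw [if_pos (hθ _ hq3)]
    have e : D.confWeight k₀ m i ℓ μ σ q.1 (D.confSet ω (q.1 - 1)) (ω q.1) q.2 =
        σ * unitClip ℓ (dot μ (D.xAt (D.confSet ω) ω m q.1 q.2)) := by
      unfold confWeight
      exact if_pos ⟨hq3, hq2⟩
    rw [e, show ∀ u : ℝ, (l * (σ * u)) ^ 2 = l ^ 2 * u ^ 2 * σ ^ 2 by intro u; ring, hσ]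
    ring
  · intro q hq hq'
    have e : D.confWeight k₀ m i ℓ μ σ q.1 (D.confSet ω (q.1 - 1)) (ω q.1) q.2 = 0 := by
      unfold confWeight
      refine if_neg fun h => hq' (mem_layer.2 ⟨?_, h.2⟩)
      exact Finset.mem_product.2 ⟨h.1, (Finset.mem_product.1 hq).2⟩
    rw [e]
    simp

lemma two_pow_le_of_mem {ℓ : ℕ} (hN : D.H * D.K ≠ 0) (hℓ : ℓ ∈ Finset.Icc 1 D.L') :
    (2 : ℝ) ^ ℓ ≤ 2 * (D.H * D.K : ℕ) :=
  (pow_le_pow_right₀ (by norm_num) (Finset.mem_Icc.1 hℓ).2).trans (two_pow_logCeil_le hN)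

lemma Realizes.abs_epsAt_le_one [Nonempty A] (hM : D.Realizes P θs) {m k h : ℕ}
    (hΘ : θs ∈ D.confSet ω (k - 1)) : |D.epsAt (D.confSet ω) ω m k h θs| ≤ 1 :=
  hM.abs_dev_le_one (valid_confSet_iff.2 hΘ) m h (ω k h).1 (ω k h).2 (ω k (h + 1)).1

lemma trueVarAt_le_etaAt [Nonempty A] (hM : D.Realizes P θs) {m k h : ℕ}
    (hΘ : θs ∈ D.confSet ω (k - 1)) : D.trueVarAt θs ω m k h ≤ D.etaAt (D.confSet ω) ω m k h :=
  hM.trueVar_le_varEst (valid_confSet_iff.2 hΘ) m h (ω k h).1 (ω k h).2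

lemma card_layer_le {k₀ : ℕ} (hk : k₀ ≤ D.K) (T : ℕ → Set (EuclideanSpace ℝ (Fin d))) (m : ℕ)
    (i : ℤ) : (D.layer T ω k₀ m i).card ≤ D.H * D.K := by
  refine (Finset.card_le_card (layer_subset _ _ _ _)).trans ?_
  rw [Finset.card_product, Nat.card_Icc, Nat.card_Icc, mul_comm]
  exact Nat.mul_le_mul (by omega) (by omega)

/-- On a relevant layer, the true parameter satisfies the constraints with room to spare. -/
lemma ConfEvent.abs_sum_unitClip_le [Nonempty A] (hE : D.ConfEvent θs ω) (hM : D.Realizes P θs)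
    (hN : D.H * D.K ≠ 0) (hι : 4 * ((d : ℝ) + 3) ≤ D.ι) {k₀ : ℕ} (hk : k₀ < D.K)
    (hθ : ∀ v ∈ Finset.Icc 1 (k₀ - 1), θs ∈ D.confSet ω (v - 1)) {m : ℕ}
    (hm : m ∈ Finset.range (D.L₀ + 1)) {i : ℤ} (hi : i ∈ D.layers) {ℓ : ℕ}
    (hℓ : ℓ ∈ Finset.Icc 1 D.L') {μ : EuclideanSpace ℝ (Fin d)} (hμ : ‖μ‖ ≤ 2) :
    |∑ q ∈ D.layer (D.confSet ω) ω k₀ m i, unitClip ℓ (dot μ (D.xAt (D.confSet ω) ω m q.1 q.2)) *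
          D.epsAt (D.confSet ω) ω m q.1 q.2 θs| ≤
      4 * √(∑ q ∈ D.layer (D.confSet ω) ω k₀ m i,
        unitClip ℓ (dot μ (D.xAt (D.confSet ω) ω m q.1 q.2)) ^ 2 *
          D.trueVarAt θs ω m q.1 q.2 * D.ι) + 3 * D.ι := by
  obtain ⟨z, hz, hzμ⟩ := exists_gridPoint_close (Nat.pos_of_ne_zero hN) hμ
  have hd0 : (0 : ℝ) ≤ d := Nat.cast_nonneg d
  have hι0 : 0 ≤ D.ι := by linarith
  have hN1 : (1 : ℝ) ≤ (D.H * D.K : ℕ) := by exact_mod_cast Nat.pos_of_ne_zero hN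
  set T := D.layer (D.confSet ω) ω k₀ m i with hT
  have hθT : ∀ q ∈ T, Valid θs (D.confSet ω (q.1 - 1)) := fun q hq =>
    valid_confSet_iff.2 (hθ _ (Finset.mem_product.1 (mem_layer.1 hq).1).1)
  have hv0 : ∀ q ∈ T, 0 ≤ D.trueVarAt θs ω m q.1 q.2 := fun q hq =>
    hM.trueVar_nonneg (hθT q hq) _ _ _ _
  have hv1 : ∀ q ∈ T, D.trueVarAt θs ω m q.1 q.2 ≤ 1 := fun q hq =>
    hM.trueVar_le_one (hθT q hq) _ _ _ _
  have hcard : (T.card : ℝ) ≤ (D.H * D.K : ℕ) := by exact_mod_cast card_layer_le hk.le _ m i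
  refine abs_sum_le_of_close T
    (g' := fun q => unitClip ℓ (dot (gridPoint (D.H * D.K) z) (D.xAt (D.confSet ω) ω m q.1 q.2)))
    (ρ := 2 ^ ℓ * (d / (128 * ((D.H * D.K : ℕ) : ℝ) ^ 2))) hι0
    (fun _ _ => abs_unitClip_le_one _ _) (fun _ _ => abs_unitClip_le_one _ _)
    (fun q hq => hM.abs_epsAt_le_one (hθT q hq).mem) hv0 hv1 ?_ ?_ ?_
  · intro q hq
    refine (abs_unitClip_sub_le _ _ _).trans ?_
    gcongr
    exact hzμ _ (hM.abs_feature_le_one (hθT q hq) _ _ _ _)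
  · calc (T.card : ℝ) * (2 ^ ℓ * (d / (128 * ((D.H * D.K : ℕ) : ℝ) ^ 2)))
        ≤ ((D.H * D.K : ℕ) : ℝ) *
            (2 * ((D.H * D.K : ℕ) : ℝ) * (d / (128 * ((D.H * D.K : ℕ) : ℝ) ^ 2))) := by
          gcongr
          exact two_pow_le_of_mem hN hℓ
      _ = (d : ℝ) / 64 := by
          have : ((D.H * D.K : ℕ) : ℝ) ≠ 0 := by positivity
          generalize ((D.H * D.K : ℕ) : ℝ) = n at this
          field_simp; ring
      _ ≤ D.ι / 160 := by linarith
  · have hW0 : 0 ≤ ∑ q ∈ T, unitClip ℓ (dot (gridPoint (D.H * D.K) z)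
        (D.xAt (D.confSet ω) ω m q.1 q.2)) ^ 2 * D.trueVarAt θs ω m q.1 q.2 :=
      Finset.sum_nonneg fun q hq => mul_nonneg (sq_nonneg _) (hv0 q hq)
    have hW1 : ∑ q ∈ T, unitClip ℓ (dot (gridPoint (D.H * D.K) z)
        (D.xAt (D.confSet ω) ω m q.1 q.2)) ^ 2 * D.trueVarAt θs ω m q.1 q.2 ≤ (D.H * D.K : ℕ) := by
      refine le_trans (Finset.sum_le_card_nsmul _ _ 1 fun q hq => ?_) ?_
      · refine mul_le_one₀ ?_ (hv0 q hq) (hv1 q hq)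
        rw [sq_le_one_iff_abs_le_one]
        exact abs_unitClip_le_one _ _
      · rw [nsmul_eq_mul, mul_one]; exact hcard
    have key : ∀ σ ∈ ({1, -1} : Finset ℝ), σ * ∑ q ∈ T, unitClip ℓ (dot (gridPoint (D.H * D.K) z)
        (D.xAt (D.confSet ω) ω m q.1 q.2)) * D.epsAt (D.confSet ω) ω m q.1 q.2 θs ≤
        5 / 2 * √(2 * D.ι * ∑ q ∈ T, unitClip ℓ (dot (gridPoint (D.H * D.K) z)
          (D.xAt (D.confSet ω) ω m q.1 q.2)) ^ 2 * D.trueVarAt θs ω m q.1 q.2) + 2 * D.ι := by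
      intro σ hσ
      refine le_of_forall_dyadic hW0 (L := 2 * D.ι) (by linarith) hN1 hW1 (lt_two_pow_logCeil _)
        fun j hj => ?_
      have := hE.grid k₀ (Finset.mem_range.2 hk) m hm i hi ℓ hℓ z hz j hj σ hσ
      rwa [freedmanSum_confWeight hk.le hθ i ℓ _ (by
        rcases Finset.mem_insert.1 hσ with rfl | h
        · norm_num
        · rw [Finset.mem_singleton.1 h]; norm_num)] at this
    have h1 := key 1 (by simp)
    have h2 := key (-1) (by simp)
    exact abs_le.2 ⟨by linarith, by linarith⟩

/-- The true parameter satisfies all constraints with room to spare. -/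
lemma ConfEvent.abs_sum_clip_le [Nonempty A] (hE : D.ConfEvent θs ω) (hM : D.Realizes P θs)
    (hd : d ≠ 0) (hN : D.H * D.K ≠ 0) (hι : 4 * ((d : ℝ) + 3) ≤ D.ι) {k₀ : ℕ} (hk : k₀ < D.K)
    (hθ : ∀ v ∈ Finset.Icc 1 D.K, v ≤ k₀ - 1 → θs ∈ D.confSet ω (v - 1)) {m : ℕ}
    (hm : m ∈ Finset.range (D.L₀ + 1)) (i : ℤ) {ℓ : ℕ}
    (hℓ : ℓ ∈ Finset.Icc 1 D.L') {μ : EuclideanSpace ℝ (Fin d)} (hμ : ‖μ‖ ≤ 2) :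
    |∑ q ∈ D.layer (D.confSet ω) ω k₀ m i, clip ℓ (dot μ (D.xAt (D.confSet ω) ω m q.1 q.2)) *
          D.epsAt (D.confSet ω) ω m q.1 q.2 θs| ≤
      4 * √(∑ q ∈ D.layer (D.confSet ω) ω k₀ m i,
        clip ℓ (dot μ (D.xAt (D.confSet ω) ω m q.1 q.2)) ^ 2 *
          D.etaAt (D.confSet ω) ω m q.1 q.2 * D.ι) + 3 * (2 : ℝ)⁻¹ ^ ℓ * D.ι := by
  classical
  have hθ' : ∀ v ∈ Finset.Icc 1 (k₀ - 1), θs ∈ D.confSet ω (v - 1) := fun v hv => by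
    have := Finset.mem_Icc.1 hv
    exact hθ v (by simp; omega) this.2
  have hd0 : (0 : ℝ) ≤ d := Nat.cast_nonneg d
  have hι0 : 0 ≤ D.ι := by linarith
  have hN1 : (1 : ℝ) ≤ (D.H * D.K : ℕ) := by exact_mod_cast Nat.pos_of_ne_zero hN
  have hp : (0 : ℝ) < (2 : ℝ)⁻¹ ^ ℓ := by positivity
  set T := D.layer (D.confSet ω) ω k₀ m i with hT
  have hTθ : ∀ q ∈ T, θs ∈ D.confSet ω (q.1 - 1) := fun q hq =>
    hθ' _ (Finset.mem_product.1 (mem_layer.1 hq).1).1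
  have hd1 : (1 : ℝ) ≤ d := by exact_mod_cast Nat.one_le_iff_ne_zero.2 hd
  by_cases hi : i ∈ D.layers
  · have h := hE.abs_sum_unitClip_le hM hN hι hk hθ' hm hi hℓ hμ
    have e1 : ∑ q ∈ T, clip ℓ (dot μ (D.xAt (D.confSet ω) ω m q.1 q.2)) *
          D.epsAt (D.confSet ω) ω m q.1 q.2 θs = (2 : ℝ)⁻¹ ^ ℓ *
        ∑ q ∈ T, unitClip ℓ (dot μ (D.xAt (D.confSet ω) ω m q.1 q.2)) *
          D.epsAt (D.confSet ω) ω m q.1 q.2 θs := by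
      rw [Finset.mul_sum]
      exact Finset.sum_congr rfl fun q _ => by rw [clip_eq_mul_unitClip]; ring
    have e2 : √(∑ q ∈ T, clip ℓ (dot μ (D.xAt (D.confSet ω) ω m q.1 q.2)) ^ 2 *
          D.etaAt (D.confSet ω) ω m q.1 q.2 * D.ι) = (2 : ℝ)⁻¹ ^ ℓ *
        √(∑ q ∈ T, unitClip ℓ (dot μ (D.xAt (D.confSet ω) ω m q.1 q.2)) ^ 2 *
          D.etaAt (D.confSet ω) ω m q.1 q.2 * D.ι) := by
      have e3 : (2 : ℝ)⁻¹ ^ ℓ = √(((2 : ℝ)⁻¹ ^ ℓ) ^ 2) := (Real.sqrt_sq hp.le).symm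
      conv_rhs => rw [e3, ← Real.sqrt_mul (sq_nonneg _), Finset.mul_sum]
      congr 1
      exact Finset.sum_congr rfl fun q _ => by rw [clip_eq_mul_unitClip]; ring
    rw [e1, e2, abs_mul, abs_of_pos hp]
    have h3 : √(∑ q ∈ T, unitClip ℓ (dot μ (D.xAt (D.confSet ω) ω m q.1 q.2)) ^ 2 *
          D.trueVarAt θs ω m q.1 q.2 * D.ι) ≤
        √(∑ q ∈ T, unitClip ℓ (dot μ (D.xAt (D.confSet ω) ω m q.1 q.2)) ^ 2 *
          D.etaAt (D.confSet ω) ω m q.1 q.2 * D.ι) := by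
      refine Real.sqrt_le_sqrt (Finset.sum_le_sum fun q hq => ?_)
      gcongr
      exact trueVarAt_le_etaAt hM (hTθ q hq)
    have := mul_le_mul_of_nonneg_left (h.trans (add_le_add_left (mul_le_mul_of_nonneg_left h3
      (by norm_num : (0 : ℝ) ≤ 4)) _)) hp.le
    refine this.trans (le_of_eq ?_)
    ring
  · rw [layers, Finset.mem_Ioc, not_and_or, not_lt, not_le] at hi
    have hR : 0 ≤ 4 * √(∑ q ∈ T, clip ℓ (dot μ (D.xAt (D.confSet ω) ω m q.1 q.2)) ^ 2 *
          D.etaAt (D.confSet ω) ω m q.1 q.2 * D.ι) := by positivity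
    rcases hi with hi | hi
    -- variance estimates are at most `√d`, so that the layer is empty
    · have hT0 : T = ∅ := by
        rw [Finset.eq_empty_iff_forall_notMem]
        intro q hq
        have h1 := (mem_layer.1 hq).2.1
        have h2 : D.etaAt (D.confSet ω) ω m q.1 q.2 ≤ √d :=
          hM.varEst_le (valid_confSet_iff.2 (hTθ q hq)) _ _ _ _
        have h3 : √(d : ℝ) ≤ d := Real.sqrt_le_left hd0 |>.2 (by nlinarith)
        have h4 : (2 : ℝ) ^ (logCeil d : ℤ) ≤ (2 : ℝ) ^ (-i) :=
          zpow_le_zpow_right₀ (by norm_num) (by omega)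
        rw [zpow_natCast] at h4
        linarith [lt_two_pow_logCeil d]
      rw [hT0]
      simp only [Finset.sum_empty, abs_zero, Real.sqrt_zero]
      positivity
    -- the variance estimates in the layer are tiny
    · have htiny := hE.tiny m hm
      set c : ℝ := 1 / ((d * (D.H * D.K) ^ 3 : ℕ) : ℝ) with hc
      have hTη : ∀ q ∈ T, D.etaAt (D.confSet ω) ω m q.1 q.2 ≤ c := by
        intro q hq
        refine (mem_layer.1 hq).2.2.trans ?_
        have h4 : (2 : ℝ) ^ (1 - i) ≤ (2 : ℝ) ^ (-(logCeil (d * (D.H * D.K) ^ 3) : ℤ)) :=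
          zpow_le_zpow_right₀ (by norm_num) (by omega)
        refine h4.trans ?_
        rw [zpow_neg, zpow_natCast, hc, ← one_div]
        refine one_div_le_one_div_of_le ?_ (lt_two_pow_logCeil _).le
        exact_mod_cast Nat.pos_of_ne_zero (mul_ne_zero hd (pow_ne_zero 3 hN))
      have hc1 : c ≤ (1 / ((D.H * D.K : ℕ) : ℝ)) ^ 2 := by
        rw [hc, div_pow, one_pow]
        refine one_div_le_one_div_of_le (by positivity) ?_
        push_cast at hN1 ⊢
        have : ((D.H : ℝ) * D.K) ^ 2 * 1 ≤ ((D.H : ℝ) * D.K) ^ 2 * ((D.H * D.K) * d) := by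
          gcongr; nlinarith
        linarith
      have hsq : ∀ q ∈ Finset.Icc 1 D.K ×ˢ Finset.Icc 1 D.H, θs ∈ D.confSet ω (q.1 - 1) →
          D.etaAt (D.confSet ω) ω m q.1 q.2 ≤ c →
          √(D.trueVarAt θs ω m q.1 q.2) ≤ 1 / ((D.H * D.K : ℕ) : ℝ) := by
        intro q _ hq1 hq2
        rw [Real.sqrt_le_left (by positivity)]
        exact ((trueVarAt_le_etaAt hM hq1).trans hq2).trans hc1
      rw [tinySum, ← Finset.sum_product'] at htiny
      have hsub : T ⊆ Finset.Icc 1 D.K ×ˢ Finset.Icc 1 D.H :=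
        (layer_subset _ _ _ _).trans (Finset.product_subset_product_left
          (Finset.Icc_subset_Icc_right (by omega)))
      have h5 : ∑ q ∈ T, |D.epsAt (D.confSet ω) ω m q.1 q.2 θs| ≤ 2 * D.ι + 2 := by
        have h6 : ∀ q ∈ Finset.Icc 1 D.K ×ˢ Finset.Icc 1 D.H,
            (if q ∈ T then |D.epsAt (D.confSet ω) ω m q.1 q.2 θs| else 0) ≤
            (if θs ∈ D.confSet ω (q.1 - 1) ∧ D.etaAt (D.confSet ω) ω m q.1 q.2 ≤ c then
              |D.epsAt (D.confSet ω) ω m q.1 q.2 θs| - 2 * √(D.trueVarAt θs ω m q.1 q.2) else 0) +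
            2 * (1 / ((D.H * D.K : ℕ) : ℝ)) := by
          intro q hq
          by_cases hqT : q ∈ T
          · rw [if_pos hqT, if_pos ⟨hTθ q hqT, hTη q hqT⟩]
            linarith [hsq q hq (hTθ q hqT) (hTη q hqT)]
          · rw [if_neg hqT]
            split_ifs with h7
            · linarith [hsq q hq h7.1 h7.2, abs_nonneg (D.epsAt (D.confSet ω) ω m q.1 q.2 θs)]
            · positivity
        have h8 := Finset.sum_le_sum h6
        rw [Finset.sum_ite_mem, Finset.inter_eq_right.2 hsub, Finset.sum_add_distrib,
          Finset.sum_const, Finset.card_product, Nat.card_Icc, Nat.card_Icc, nsmul_eq_mul] at h8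
        have e : ((D.K + 1 - 1) * (D.H + 1 - 1) : ℕ) = D.H * D.K := by simp [mul_comm]
        rw [e, mul_left_comm, mul_one_div_cancel (by positivity)] at h8
        linarith
      calc _ ≤ ∑ q ∈ T, (2 : ℝ)⁻¹ ^ ℓ * |D.epsAt (D.confSet ω) ω m q.1 q.2 θs| := by
            refine (Finset.abs_sum_le_sum_abs _ _).trans (Finset.sum_le_sum fun q _ => ?_)
            rw [clip_eq_mul_unitClip, abs_mul, abs_mul, abs_of_pos hp]
            have := abs_unitClip_le_one ℓ (dot μ (D.xAt (D.confSet ω) ω m q.1 q.2))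
            gcongr
            exact mul_le_of_le_one_right hp.le this
        _ ≤ (2 : ℝ)⁻¹ ^ ℓ * (3 * D.ι) := by
            rw [← Finset.mul_sum]
            gcongr
            linarith
        _ ≤ _ := by linarith

/-- On the event, every confidence set in use contains the true parameter, and even a shrunken copy
of the unit ball around it: the true parameter satisfies the constraints with a slack of
`2 ^ (-ℓ) * ι`, and a parameter at distance at most `2 / (HK)` changes the sums by less. -/
lemma ConfEvent.ball_subset [Nonempty A] (hE : D.ConfEvent θs ω) (hM : D.Realizes P θs)
    (hd : d ≠ 0) (hN : D.H * D.K ≠ 0) (hι : 4 * ((d : ℝ) + 3) ≤ D.ι) :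
    ∀ j < D.K, ∀ θ : EuclideanSpace ℝ (Fin d), ‖θ‖ ≤ 1 → ∀ σ : ℝ, 0 ≤ σ →
      σ ≤ 1 / ((D.H * D.K : ℕ) : ℝ) → (1 - σ) • θs + σ • θ ∈ D.confSet ω j := by
  intro j
  induction j using Nat.strong_induction_on with
  | _ j ih =>
    intro hj θ hθn σ hσ0 hσ1
    have hN1 : (1 : ℝ) ≤ (D.H * D.K : ℕ) := by exact_mod_cast Nat.pos_of_ne_zero hN
    have hσ2 : σ ≤ 1 := hσ1.trans (div_le_one_of_le₀ hN1 (by positivity))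
    have hd0 : (0 : ℝ) ≤ d := Nat.cast_nonneg d
    have hd1 : (1 : ℝ) ≤ d := by exact_mod_cast Nat.one_le_iff_ne_zero.2 hd
    rw [confSet_eq]
    refine ⟨?_, ?_⟩
    · refine (norm_add_le _ _).trans ?_
      rw [norm_smul, norm_smul, Real.norm_of_nonneg hσ0, Real.norm_of_nonneg (by linarith)]
      have := hM.norm_le
      nlinarith
    · intro m hm i ℓ hℓ μ hμ
      have hp : (0 : ℝ) < (2 : ℝ)⁻¹ ^ ℓ := by positivity
      have hmem : ∀ v ∈ Finset.Icc 1 D.K, v ≤ j - 1 - 1 → θs ∈ D.confSet ω (v - 1) := by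
        intro v hv hvj
        have hv' := Finset.mem_Icc.1 hv
        have := ih (v - 1) (by omega) (by omega) θ hθn 0 le_rfl (by positivity)
        simpa using this
      have h := hE.abs_sum_clip_le hM hd hN hι (by omega : j - 1 < D.K) hmem hm i hℓ hμ
      set T := D.layer (D.confSet ω) ω (j - 1) m i with hT
      have hTθ : ∀ q ∈ T, θs ∈ D.confSet ω (q.1 - 1) := fun q hq => by
        have := Finset.mem_Icc.1 (Finset.mem_product.1 (mem_layer.1 hq).1).1
        exact hmem _ (by simp; omega) this.2
      have e : ∀ q : ℕ × ℕ, D.epsAt (D.confSet ω) ω m q.1 q.2 ((1 - σ) • θs + σ • θ) =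
          D.epsAt (D.confSet ω) ω m q.1 q.2 θs +
            σ * (dot θ (D.xAt (D.confSet ω) ω m q.1 q.2) -
              dot θs (D.xAt (D.confSet ω) ω m q.1 q.2)) := by
        intro q
        simp only [epsAt, dot_add_left, dot_smul_left]
        ring
      simp only [e, mul_add, Finset.sum_add_distrib]
      refine (abs_add_le _ _).trans ?_
      have h2 : |∑ q ∈ T, clip ℓ (dot μ (D.xAt (D.confSet ω) ω m q.1 q.2)) *
          (σ * (dot θ (D.xAt (D.confSet ω) ω m q.1 q.2) -
              dot θs (D.xAt (D.confSet ω) ω m q.1 q.2)))| ≤ (2 : ℝ)⁻¹ ^ ℓ * D.ι := by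
        refine (Finset.abs_sum_le_sum_abs _ _).trans ?_
        refine (Finset.sum_le_card_nsmul T _ ((2 : ℝ)⁻¹ ^ ℓ * (σ * (2 * √d)))
          fun (q : ℕ × ℕ) hq => ?_).trans ?_
        · rw [clip_eq_mul_unitClip, abs_mul, abs_mul, abs_mul, abs_of_pos hp, abs_of_nonneg hσ0]
          have h3 := abs_unitClip_le_one ℓ (dot μ (D.xAt (D.confSet ω) ω m q.1 q.2))
          have hv := valid_confSet_iff.2 (hTθ q hq)
          have h4 : |dot θ (D.xAt (D.confSet ω) ω m q.1 q.2)| ≤ √d :=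
            hM.abs_dot_feature_le hv hθn _ _ _ _
          have h5 : |dot θs (D.xAt (D.confSet ω) ω m q.1 q.2)| ≤ √d :=
            hM.abs_dot_feature_le hv hM.norm_le _ _ _ _
          have h6 := (abs_sub (dot θ (D.xAt (D.confSet ω) ω m q.1 q.2))
            (dot θs (D.xAt (D.confSet ω) ω m q.1 q.2)))
          gcongr
          · exact mul_le_of_le_one_right hp.le h3
          · linarith
        · rw [nsmul_eq_mul]
          have h3 : √(d : ℝ) ≤ d := Real.sqrt_le_left hd0 |>.2 (by nlinarith)
          have hcard : (T.card : ℝ) ≤ (D.H * D.K : ℕ) := by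
            exact_mod_cast card_layer_le (by omega) _ m i
          have h4 : (T.card : ℝ) * σ ≤ 1 := by
            calc (T.card : ℝ) * σ ≤ (D.H * D.K : ℕ) * (1 / ((D.H * D.K : ℕ) : ℝ)) := by gcongr
              _ = 1 := by field_simp
          calc (T.card : ℝ) * ((2 : ℝ)⁻¹ ^ ℓ * (σ * (2 * √d)))
              = (2 : ℝ)⁻¹ ^ ℓ * ((T.card * σ) * (2 * √d)) := by ring
            _ ≤ (2 : ℝ)⁻¹ ^ ℓ * (1 * (2 * √d)) := by gcongr
            _ ≤ (2 : ℝ)⁻¹ ^ ℓ * D.ι := by gcongr; linarith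
      linarith

lemma ConfEvent.valid [Nonempty A] (hE : D.ConfEvent θs ω) (hM : D.Realizes P θs)
    (hd : d ≠ 0) (hN : D.H * D.K ≠ 0) (hι : 4 * ((d : ℝ) + 3) ≤ D.ι) {k : ℕ}
    (hk : k ∈ Finset.Icc 1 D.K) : Valid θs (D.confSet ω (k - 1)) := by
  have hk' := Finset.mem_Icc.1 hk
  have := hE.ball_subset hM hd hN hι (k - 1) (by omega) θs hM.norm_le 0 le_rfl (by positivity)
  rw [valid_confSet_iff]
  simpa using this

end Input

/-! ### Counting informative directions -/

section Eluder

open Matrix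

variable {d : ℕ}

/-- The regularized Gram matrix `c I + ∑ x xᵀ` of a finite family of vectors. -/
def gram {Q : Type*} (c : ℝ) (B : Finset Q) (x : Q → Fin d → ℝ) : Matrix (Fin d) (Fin d) ℝ :=
  c • (1 : Matrix (Fin d) (Fin d) ℝ) + ∑ q ∈ B, vecMulVec (x q) (x q)

lemma posDef_gram {Q : Type*} {c : ℝ} (hc : 0 < c) (B : Finset Q) (x : Q → Fin d → ℝ) :
    (gram c B x).PosDef := by
  refine Matrix.PosDef.add_posSemidef (Matrix.PosDef.one.smul hc) ?_
  exact posSemidef_sum _ fun q _ => by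
    simpa using posSemidef_vecMulVec_self_star (x q)

lemma gram_insert {Q : Type*} [DecidableEq Q] (c : ℝ) {B : Finset Q} {p : Q} (hp : p ∉ B)
    (x : Q → Fin d → ℝ) : gram c (insert p B) x = gram c B x + vecMulVec (x p) (x p) := by
  rw [gram, gram, Finset.sum_insert hp]
  abel

lemma dotProduct_gram_mulVec {Q : Type*} (c : ℝ) (B : Finset Q) (x : Q → Fin d → ℝ)
    (μ : Fin d → ℝ) : μ ⬝ᵥ (gram c B x *ᵥ μ) = c * (μ ⬝ᵥ μ) + ∑ q ∈ B, (x q ⬝ᵥ μ) ^ 2 := by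
  rw [gram, add_mulVec, smul_mulVec, one_mulVec, dotProduct_add, dotProduct_smul, smul_eq_mul,
    sum_mulVec, dotProduct_sum]
  congr 1
  refine Finset.sum_congr rfl fun q _ => ?_
  rw [vecMulVec_mulVec]
  simp only [dotProduct_smul, MulOpposite.smul_eq_mul_unop, MulOpposite.unop_op]
  rw [dotProduct_comm μ (x q), sq]

/-- A rank-one update in a direction in which the quadratic form is small increases the
determinant by a constant factor. -/
lemma det_add_vecMulVec_ge {V : Matrix (Fin d) (Fin d) ℝ} (hV : V.PosDef) {x μ : Fin d → ℝ}
    (hμ : 0 < μ ⬝ᵥ (V *ᵥ μ)) (h : μ ⬝ᵥ (V *ᵥ μ) ≤ 2 * (x ⬝ᵥ μ) ^ 2) :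
    3 / 2 * V.det ≤ (V + vecMulVec x x).det := by
  have hdet : 0 < V.det := hV.det_pos
  have hu : IsUnit V.det := isUnit_iff_ne_zero.2 hdet.ne'
  have e : (V + vecMulVec x x).det = V.det * (1 + x ⬝ᵥ (V⁻¹ *ᵥ x)) := by
    rw [vecMulVec_eq Unit, det_add_replicateCol_mul_replicateRow hu]
    congr 1
    rw [det_unique, Matrix.mul_assoc, ← replicateCol_mulVec]
    simp [replicateRow_mul_replicateCol_apply]
  rw [e]
  set y := V⁻¹ *ᵥ x with hy
  have hVy : V *ᵥ y = x := by
    rw [hy, mulVec_mulVec, mul_nonsing_inv _ hu, one_mulVec]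
  have hsymm : μ ⬝ᵥ (V *ᵥ y) = y ⬝ᵥ (V *ᵥ μ) := by
    rw [dotProduct_mulVec, ← mulVec_transpose, dotProduct_comm]
    have : Vᵀ = V := by simpa using hV.isHermitian.eq
    rw [this]
  set b := x ⬝ᵥ μ with hb
  set m := μ ⬝ᵥ (V *ᵥ μ) with hm
  set g := x ⬝ᵥ y with hg
  have e1 : μ ⬝ᵥ (V *ᵥ y) = b := by rw [hVy, dotProduct_comm]
  have e2 : y ⬝ᵥ (V *ᵥ y) = g := by rw [hVy, dotProduct_comm]
  -- Cauchy–Schwarz for the form `V`, from positivity at `m y - b μ`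
  have key : 0 ≤ (m • y - b • μ) ⬝ᵥ (V *ᵥ (m • y - b • μ)) := by
    simpa using hV.posSemidef.dotProduct_mulVec_nonneg (m • y - b • μ)
  rw [mulVec_sub, mulVec_smul, mulVec_smul, dotProduct_sub, sub_dotProduct, sub_dotProduct] at key
  simp only [dotProduct_smul, smul_dotProduct, smul_eq_mul, ← hsymm, e1, e2, ← hm] at key
  have h1 : b ^ 2 ≤ m * g := by
    have : 0 ≤ m * (m * g - b ^ 2) := by nlinarith
    have := nonneg_of_mul_nonneg_right this hμ
    linarith
  have h2 : 1 / 2 ≤ g := by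
    by_contra! hlt
    have : m * g < m * (1 / 2) := by gcongr
    linarith
  nlinarith

lemma det_le_trace_pow {V : Matrix (Fin d) (Fin d) ℝ} (hV : V.PosSemidef) :
    V.det ≤ V.trace ^ d := by
  have h0 := hV.eigenvalues_nonneg
  rw [hV.isHermitian.det_eq_prod_eigenvalues, hV.isHermitian.trace_eq_sum_eigenvalues]
  simp only [RCLike.ofReal_real_eq_id, id_eq]
  calc _ ≤ ∏ _i : Fin d, ∑ j, hV.isHermitian.eigenvalues j :=
        Finset.prod_le_prod (fun i _ => h0 i) fun i hi =>
          Finset.single_le_sum (fun j _ => h0 j) hi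
    _ = _ := by simp

lemma trace_gram_le {Q : Type*} (c : ℝ) (B : Finset Q) {x : Q → Fin d → ℝ}
    (hx : ∀ q ∈ B, ∀ i, |x q i| ≤ 1) : (gram c B x).trace ≤ d * (c + B.card) := by
  rw [gram, trace_add, trace_smul, trace_one, trace_sum, Fintype.card_fin, smul_eq_mul, mul_add,
    mul_comm c]
  gcongr
  calc _ ≤ ∑ _q ∈ B, (d : ℝ) := by
        refine Finset.sum_le_sum fun q hq => ?_
        rw [trace_vecMulVec, dotProduct]
        calc _ ≤ ∑ _i : Fin d, (1 : ℝ) := Finset.sum_le_sum fun i _ => by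
              rw [← sq, sq_le_one_iff_abs_le_one]; exact hx q hq i
          _ = d := by simp
    _ = d * B.card := by simp [mul_comm]

lemma le_sum_min {Q : Type*} {s : Finset Q} {y : Q → ℝ} {c : ℝ} (hy : ∀ q ∈ s, 0 ≤ y q)
    (hc : 0 ≤ c) (h : c < ∑ q ∈ s, y q) : c ≤ ∑ q ∈ s, min (y q) c := by
  by_cases hex : ∃ q ∈ s, c ≤ y q
  · obtain ⟨q, hq, hqc⟩ := hex
    calc c = min (y q) c := (min_eq_right hqc).symm
      _ ≤ _ := Finset.single_le_sum (f := fun q => min (y q) c) (fun q hq => le_min (hy q hq) hc) hq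
  · push Not at hex
    rw [Finset.sum_congr rfl fun q hq => min_eq_left (hex q hq).le]
    exact h.le

/-- Elements that arrive in rounds `f`, each of them hardly predicted in its direction `μ` by the
elements that are at least three rounds older, can be distributed over a number of bins so that in
each bin every element increases the determinant of the Gram matrix by a constant factor. An
element goes to a bin that holds only older elements, whose total effect in the direction `μ` is
small. -/
lemma exists_bins {Q : Type*} [DecidableEq Q] (f : Q → ℕ) (x μ : Q → Fin d → ℝ) {ε a : ℝ}
    {cap n : ℕ} (hε : 0 < ε) (han : a < n) (E : Finset Q)
    (hμ : ∀ q ∈ E, μ q ⬝ᵥ μ q ≤ 4) (hxμ : ∀ q ∈ E, ε < |x q ⬝ᵥ μ q|)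
    (hpast : ∀ q ∈ E, ∑ q' ∈ E with f q' + 3 ≤ f q, min ((x q' ⬝ᵥ μ q) ^ 2) (ε ^ 2) ≤ a * ε ^ 2)
    (hcap : ∀ k, (E.filter fun q => f q = k).card ≤ cap) :
    ∃ c : Q → ℕ, (∀ q ∈ E, c q < 3 * cap + n) ∧ ∀ b,
      (3 / 2 : ℝ) ^ (E.filter fun q => c q = b).card * (ε ^ 2 / 4) ^ d ≤
        (gram (ε ^ 2 / 4) (E.filter fun q => c q = b) x).det := by
  have hε2 : 0 < ε ^ 2 := by positivity
  induction E using Finset.induction_on_max_value f with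
  | empty =>
    refine ⟨fun _ => 0, by simp, fun b => ?_⟩
    simp [gram]
  | insert p s hp hmax ih =>
    obtain ⟨c, hc, hdet⟩ := ih (fun q hq => hμ q (Finset.mem_insert_of_mem hq))
      (fun q hq => hxμ q (Finset.mem_insert_of_mem hq))
      (fun q hq => le_trans (Finset.sum_le_sum_of_subset_of_nonneg
        (Finset.filter_subset_filter _ (Finset.subset_insert _ _))
        fun _ _ _ => le_min (sq_nonneg _) hε2.le) (hpast q (Finset.mem_insert_of_mem hq)))
      (fun k => (Finset.card_le_card
        (Finset.filter_subset_filter _ (Finset.subset_insert _ _))).trans (hcap k))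
    -- the bins that hold one of the recent elements
    set U₁ := (s.filter fun q => f p < f q + 3).image c with hU₁
    -- the bins that predict the direction of `p` too well; each uses up `ε ^ 2` of the budget
    set U₂ := (Finset.range (3 * cap + n)).filter fun b =>
      ε ^ 2 < ∑ q ∈ s with f q + 3 ≤ f p ∧ c q = b, (x q ⬝ᵥ μ p) ^ 2 with hU₂
    have h1 : U₁.card < 3 * cap := by
      refine lt_of_le_of_lt Finset.card_image_le ?_
      have h2 : insert p (s.filter fun q => f p < f q + 3) ⊆
          ((insert p s).filter fun q => f q = f p) ∪ (((insert p s).filter fun q => f q = f p - 1) ∪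
            ((insert p s).filter fun q => f q = f p - 2)) := by
        intro q hq
        rcases Finset.mem_insert.1 hq with rfl | hq
        · simp
        · obtain ⟨hq1, hq2⟩ := Finset.mem_filter.1 hq
          have := hmax q hq1
          simp only [Finset.mem_union, Finset.mem_filter, Finset.mem_insert_of_mem hq1, true_and]
          omega
      have h3 := Finset.card_le_card h2
      rw [Finset.card_insert_of_notMem (fun h => hp (Finset.mem_filter.1 h).1)] at h3
      have h4 := Finset.card_union_le ((insert p s).filter fun q => f q = f p)
        (((insert p s).filter fun q => f q = f p - 1) ∪
          ((insert p s).filter fun q => f q = f p - 2))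
      have h5 := Finset.card_union_le ((insert p s).filter fun q => f q = f p - 1)
        ((insert p s).filter fun q => f q = f p - 2)
      have := hcap (f p)
      have := hcap (f p - 1)
      have := hcap (f p - 2)
      omega
    have h2 : U₂.card ≤ n := by
      have h3 : (U₂.card : ℝ) * ε ^ 2 ≤ a * ε ^ 2 := by
        calc (U₂.card : ℝ) * ε ^ 2 = ∑ _b ∈ U₂, ε ^ 2 := by simp
          _ ≤ ∑ b ∈ U₂, ∑ q ∈ s with f q + 3 ≤ f p ∧ c q = b,
                min ((x q ⬝ᵥ μ p) ^ 2) (ε ^ 2) := by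
              refine Finset.sum_le_sum fun b hb => ?_
              exact le_sum_min (fun _ _ => sq_nonneg _) hε2.le (Finset.mem_filter.1 hb).2
          _ = ∑ q ∈ U₂.biUnion fun b => s.filter fun q => f q + 3 ≤ f p ∧ c q = b,
                min ((x q ⬝ᵥ μ p) ^ 2) (ε ^ 2) := by
              rw [Finset.sum_biUnion]
              intro b _ b' _ hbb
              refine Finset.disjoint_left.2 fun q hq hq' => hbb ?_
              rw [← (Finset.mem_filter.1 hq).2.2, (Finset.mem_filter.1 hq').2.2]
          _ ≤ ∑ q ∈ insert p s with f q + 3 ≤ f p, min ((x q ⬝ᵥ μ p) ^ 2) (ε ^ 2) := by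
              refine Finset.sum_le_sum_of_subset_of_nonneg (fun q hq => ?_)
                fun _ _ _ => le_min (sq_nonneg _) hε2.le
              obtain ⟨b, _, hq⟩ := Finset.mem_biUnion.1 hq
              obtain ⟨hq1, hq2, _⟩ := Finset.mem_filter.1 hq
              exact Finset.mem_filter.2 ⟨Finset.mem_insert_of_mem hq1, hq2⟩
          _ ≤ a * ε ^ 2 := hpast p (Finset.mem_insert_self _ _)
      have h4 : (U₂.card : ℝ) ≤ a := le_of_mul_le_mul_right h3 hε2
      exact_mod_cast (h4.trans han.le)
    -- the element `p` goes to one of the remaining bins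
    obtain ⟨b, hb, hbU⟩ : ∃ b ∈ Finset.range (3 * cap + n), b ∉ U₁ ∪ U₂ := by
      refine Finset.exists_mem_notMem_of_card_lt_card ?_
      refine lt_of_le_of_lt (Finset.card_union_le _ _) ?_
      rw [Finset.card_range]
      omega
    rw [Finset.mem_union, not_or] at hbU
    have hold : ∀ q ∈ s, c q = b → f q + 3 ≤ f p := by
      intro q hq hqb
      by_contra! hlt
      exact hbU.1 (Finset.mem_image.2 ⟨q, Finset.mem_filter.2 ⟨hq, hlt⟩, hqb⟩)
    have hne : ∀ q ∈ s, q ≠ p := fun q hq h => hp (h ▸ hq)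
    refine ⟨Function.update c p b, fun q hq => ?_, fun b' => ?_⟩
    · rcases Finset.mem_insert.1 hq with rfl | hq
      · rw [Function.update_self]; exact Finset.mem_range.1 hb
      · rw [Function.update_of_ne (hne q hq)]; exact hc q hq
    · have e1 : s.filter (fun q => Function.update c p b q = b') = s.filter fun q => c q = b' :=
        Finset.filter_congr fun q hq => by rw [Function.update_of_ne (hne q hq)]
      rw [Finset.filter_insert, Function.update_self, e1]
      by_cases hbb : b = b'
      · subst hbb
        rw [if_pos rfl]
        have hpB : p ∉ s.filter fun q => c q = b := fun h => hp (Finset.mem_filter.1 h).1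
        rw [Finset.card_insert_of_notMem hpB, gram_insert _ hpB, pow_succ]
        have hx := hxμ p (Finset.mem_insert_self _ _)
        have hx2 : ε ^ 2 < (x p ⬝ᵥ μ p) ^ 2 := by
          rw [← sq_abs (x p ⬝ᵥ μ p)]
          exact pow_lt_pow_left₀ hx hε.le (by norm_num)
        have hsum : ∑ q ∈ s.filter (fun q => c q = b), (x q ⬝ᵥ μ p) ^ 2 ≤ ε ^ 2 := by
          by_contra! hlt
          refine hbU.2 (Finset.mem_filter.2 ⟨hb, ?_⟩)
          rwa [Finset.filter_congr fun q hq => (⟨fun h => h.2, fun h => ⟨hold q hq h, h⟩⟩ :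
            (f q + 3 ≤ f p ∧ c q = b) ↔ c q = b)]
        have hm := hμ p (Finset.mem_insert_self _ _)
        have hV := posDef_gram (c := ε ^ 2 / 4) (by positivity) (s.filter fun q => c q = b) x
        have h3 := det_add_vecMulVec_ge hV (x := x p) (μ := μ p) ?_ ?_
        · calc _ = 3 / 2 * ((3 / 2 : ℝ) ^ (s.filter fun q => c q = b).card * (ε ^ 2 / 4) ^ d) := by
                ring
            _ ≤ 3 / 2 * _ := by gcongr; exact hdet b
            _ ≤ _ := h3
        · have hμ0 : μ p ≠ 0 := by
            intro h0
            rw [h0, dotProduct_zero, abs_zero] at hx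
            linarith
          simpa using hV.dotProduct_mulVec_pos hμ0
        · rw [dotProduct_gram_mulVec]
          nlinarith
      · rw [if_neg hbb]
        exact hdet b'

/-- The number of elements is at most the number of bins times the capacity of a bin, which is
bounded by comparing the growth of the determinant with the trace. -/
lemma card_le_of_bins {Q : Type*} [DecidableEq Q] (f : Q → ℕ) (x μ : Q → Fin d → ℝ) {ε a : ℝ}
    {cap n M : ℕ} (hd : 1 ≤ d) (hε : 0 < ε) (han : a < n) (E : Finset Q) (hEM : E.card ≤ M)
    (hx : ∀ q ∈ E, ∀ i, |x q i| ≤ 1)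
    (hμ : ∀ q ∈ E, μ q ⬝ᵥ μ q ≤ 4) (hxμ : ∀ q ∈ E, ε < |x q ⬝ᵥ μ q|)
    (hpast : ∀ q ∈ E, ∑ q' ∈ E with f q' + 3 ≤ f q, min ((x q' ⬝ᵥ μ q) ^ 2) (ε ^ 2) ≤ a * ε ^ 2)
    (hcap : ∀ k, (E.filter fun q => f q = k).card ≤ cap) :
    (E.card : ℝ) ≤ (3 * cap + n) * (3 * d * Real.log (d * (1 + 4 * M / ε ^ 2))) := by
  obtain ⟨c, hc, hdet⟩ := exists_bins f x μ hε han E hμ hxμ hpast hcap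
  have hd0 : (1 : ℝ) ≤ d := by exact_mod_cast hd
  have hbin : ∀ b, ((E.filter fun q => c q = b).card : ℝ) ≤
      3 * d * Real.log (d * (1 + 4 * M / ε ^ 2)) := by
    intro b
    set B := E.filter fun q => c q = b with hB
    have hBM : (B.card : ℝ) ≤ M := by
      exact_mod_cast (Finset.card_le_card (Finset.filter_subset _ _)).trans hEM
    have hp : 0 < ε ^ 2 / 4 := by positivity
    have h1 : (3 / 2 : ℝ) ^ B.card * (ε ^ 2 / 4) ^ d ≤ (d * (ε ^ 2 / 4 + M)) ^ d := by
      refine (hdet b).trans ((det_le_trace_pow (posDef_gram hp _ _).posSemidef).trans ?_)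
      refine pow_le_pow_left₀ (posDef_gram hp _ _).posSemidef.trace_nonneg ?_ d
      refine (trace_gram_le _ _ fun q hq => hx q (Finset.mem_filter.1 hq).1).trans ?_
      gcongr
    have h2 : (3 / 2 : ℝ) ^ B.card ≤ (d * (1 + 4 * M / ε ^ 2)) ^ d := by
      have e : (d : ℝ) * (1 + 4 * M / ε ^ 2) = d * (ε ^ 2 / 4 + M) / (ε ^ 2 / 4) := by
        field_simp
      rw [e, div_pow ((d : ℝ) * (ε ^ 2 / 4 + M)), le_div_iff₀ (by positivity)]
      exact h1
    have h3 := Real.log_le_log (by positivity) h2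
    rw [Real.log_pow, Real.log_pow] at h3
    have h4 : (1 : ℝ) / 3 ≤ Real.log (3 / 2) := by
      have := Real.one_sub_inv_le_log_of_pos (show (0 : ℝ) < 3 / 2 by norm_num)
      norm_num at this ⊢
      linarith
    have h5 : (B.card : ℝ) * (1 / 3) ≤ B.card * Real.log (3 / 2) := by gcongr
    linarith
  have h1 : E.card = ∑ b ∈ Finset.range (3 * cap + n), (E.filter fun q => c q = b).card :=
    Finset.card_eq_sum_card_fiberwise fun q hq => Finset.mem_coe.2 (Finset.mem_range.2 (hc q hq))
  rw [h1]
  push_cast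
  refine (Finset.sum_le_card_nsmul _ _ _ fun b _ => hbin b).trans (le_of_eq ?_)
  rw [Finset.card_range, nsmul_eq_mul]
  push_cast
  ring

end Eluder

/-- Among the elements of a sequence with a property, those of rank at most `c` are counted by a
truncated count. -/
lemma card_filter_rank_le (p : ℕ → Prop) [DecidablePred p] (c n : ℕ) :
    ((Finset.Icc 1 n).filter fun u => p u ∧ ((Finset.Icc 1 u).filter p).card ≤ c).card =
      min c ((Finset.Icc 1 n).filter p).card := by
  induction n with
  | zero => simp
  | succ n ih =>
    have hins : Finset.Icc 1 (n + 1) = insert (n + 1) (Finset.Icc 1 n) :=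
      (Finset.insert_Icc_right_eq_Icc_add_one (by omega)).symm
    have hcnt : p (n + 1) → ((Finset.Icc 1 (n + 1)).filter p).card =
        ((Finset.Icc 1 n).filter p).card + 1 := fun hp => by
      rw [hins, Finset.filter_insert, if_pos hp, Finset.card_insert_of_notMem (by simp)]
    by_cases hp : p (n + 1)
    · rw [hcnt hp]
      conv_lhs => rw [hins, Finset.filter_insert]
      by_cases hle : ((Finset.Icc 1 n).filter p).card + 1 ≤ c
      · rw [if_pos ⟨hp, by rw [hcnt hp]; exact hle⟩, Finset.card_insert_of_notMem (by simp), ih]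
        omega
      · rw [if_neg fun h => hle (by rw [← hcnt hp]; exact h.2), ih]
        omega
    · conv_lhs => rw [hins, Finset.filter_insert]
      rw [if_neg fun h => hp h.1, ih, hins, Finset.filter_insert, if_neg hp]

lemma le_sqrt_mul_add_of_sq_le {X b E : ℝ} (hb : 0 ≤ b) (hE : 0 ≤ E) (h : X ^ 2 ≤ b * (E + X)) :
    X ≤ √(b * E) + b := by
  by_contra! hlt
  have h1 := Real.sqrt_nonneg (b * E)
  have h2 := Real.sq_sqrt (mul_nonneg hb hE)
  nlinarith

lemma dotProduct_eq_dot {d : ℕ} (μ : EuclideanSpace ℝ (Fin d)) (x : Fin d → ℝ) :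
    x ⬝ᵥ (fun i => μ i) = dot μ x := by
  simp [dot, dotProduct, mul_comm]

lemma dotProduct_self_le {d : ℕ} {μ : EuclideanSpace ℝ (Fin d)} (hμ : ‖μ‖ ≤ 2) :
    (fun i => μ i) ⬝ᵥ (fun i => μ i) ≤ (4 : ℝ) := by
  have h : ‖μ‖ ^ 2 = (fun i => μ i) ⬝ᵥ (fun i => μ i) := by
    rw [EuclideanSpace.norm_sq_eq]
    simp [dotProduct, sq]
  rw [← h]
  nlinarith [norm_nonneg μ]

namespace Input

variable {d : ℕ} {S A : Type*}

/-! ### Classes of steps, and the truncation of episodes -/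

/-- A step belongs to the class `(m, i, ℓ)` if its variance estimate lies in the layer `i` and its
width is of the order `2 ^ (-ℓ)`; the class `ℓ = 1` collects all large widths. -/
def InClass (D : Input d S A) (θs : EuclideanSpace ℝ (Fin d)) (Θ : Set (EuclideanSpace ℝ (Fin d)))
    (τ : Trajectory S A) (m : ℕ) (i : ℤ) (ℓ h : ℕ) : Prop :=
  D.varEst Θ m h (τ h).1 (τ h).2 ∈ Set.Ioc ((2 : ℝ) ^ (-i)) ((2 : ℝ) ^ (1 - i)) ∧
    (2 : ℝ)⁻¹ ^ ℓ < D.width θs Θ m h (τ h).1 (τ h).2 ∧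
      (ℓ = 1 ∨ D.width θs Θ m h (τ h).1 (τ h).2 ≤ 2 * (2 : ℝ)⁻¹ ^ ℓ)

open Classical in
/-- The number of steps of the class `(m, i, ℓ)` up to step `h`. -/
def classCount (D : Input d S A) (θs : EuclideanSpace ℝ (Fin d))
    (Θ : Set (EuclideanSpace ℝ (Fin d))) (τ : Trajectory S A) (m : ℕ) (i : ℤ) (ℓ h : ℕ) : ℕ :=
  ((Finset.Icc 1 h).filter (D.InClass θs Θ τ m i ℓ)).card

/-- The bound, in units of `4 ^ (-ℓ)`, that the confidence sets put on the sum of the clipped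
squares of the errors of a candidate parameter on a layer. -/
def classBound (D : Input d S A) (i : ℤ) (ℓ : ℕ) : ℝ :=
  128 * D.ι * 4 ^ ℓ * ((2 : ℝ) ^ (-i) + (2 : ℝ)⁻¹ ^ ℓ)

/-- The maximal number of steps of a class that are used in one episode. -/
def classCap (D : Input d S A) (i : ℤ) (ℓ : ℕ) : ℕ := ⌈D.classBound i ℓ⌉₊

/-- The indices `(m, i, ℓ)` of the classes that matter. -/
def classes (D : Input d S A) : Finset (ℕ × ℤ × ℕ) :=
  Finset.range (D.L₀ + 1) ×ˢ D.layers ×ˢ Finset.Icc 1 D.L'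

/-- An episode is used up to the step in which the number of steps of some class exceeds its cap.
Whether step `h` is live is known before the transition out of step `h`. -/
def Live (D : Input d S A) (θs : EuclideanSpace ℝ (Fin d)) (Θ : Set (EuclideanSpace ℝ (Fin d)))
    (τ : Trajectory S A) (h : ℕ) : Prop :=
  ∀ c ∈ D.classes, D.classCount θs Θ τ c.1 c.2.1 c.2.2 h ≤ D.classCap c.2.1 c.2.2

lemma Live.mono {D : Input d S A} {θs : EuclideanSpace ℝ (Fin d)}
    {Θ : Set (EuclideanSpace ℝ (Fin d))} {τ : Trajectory S A} {h h' : ℕ} (hh : h ≤ h')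
    (H : D.Live θs Θ τ h') : D.Live θs Θ τ h := by
  classical
  intro c hc
  have := H c hc
  unfold classCount at this ⊢
  exact (Finset.card_le_card (Finset.filter_subset_filter _
    (Finset.Icc_subset_Icc_right hh))).trans this

lemma live_congr (D : Input d S A) (θs : EuclideanSpace ℝ (Fin d))
    (Θ : Set (EuclideanSpace ℝ (Fin d))) {τ τ' : Trajectory S A} {h : ℕ}
    (hτ : ∀ u ≤ h, τ u = τ' u) : D.Live θs Θ τ h ↔ D.Live θs Θ τ' h := by
  have e : ∀ m i ℓ, D.classCount θs Θ τ m i ℓ h = D.classCount θs Θ τ' m i ℓ h := by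
    intro m i ℓ
    classical
    unfold classCount
    congr 1
    refine Finset.filter_congr fun u hu => ?_
    unfold InClass
    rw [hτ u (Finset.mem_Icc.1 hu).2]
  simp only [Live, e]

/-- A bound for the number of elements in one bin, see `card_le_of_bins`. -/
def binSize (D : Input d S A) : ℝ :=
  3 * d * Real.log (d * (1 + 16 * ((D.H * D.K : ℕ) : ℝ) ^ 3))

variable {D : Input d S A} {P : S → A → PMF S} {θs : EuclideanSpace ℝ (Fin d)} {ω : History S A}

lemma classBound_ge_one (hι : 1 ≤ D.ι) (i : ℤ) (ℓ : ℕ) : 1 ≤ D.classBound i ℓ := by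
  have h1 : (4 : ℝ) ^ ℓ * (2 : ℝ)⁻¹ ^ ℓ = 2 ^ ℓ := by rw [← mul_pow]; norm_num
  have h2 : (1 : ℝ) ≤ 2 ^ ℓ := one_le_pow₀ (by norm_num)
  have h3 : (0 : ℝ) ≤ 4 ^ ℓ * (2 : ℝ) ^ (-i) := by positivity
  have e : D.classBound i ℓ = 128 * (D.ι * (4 ^ ℓ * (2 : ℝ) ^ (-i) + 2 ^ ℓ)) := by
    rw [classBound, ← h1]; ring
  rw [e]
  nlinarith

lemma one_le_classCap (hι : 1 ≤ D.ι) (i : ℤ) (ℓ : ℕ) : 1 ≤ D.classCap i ℓ :=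
  Nat.one_le_iff_ne_zero.2 (Nat.ceil_pos.2 (by linarith [classBound_ge_one hι i ℓ])).ne'

lemma classCap_le (hι : 1 ≤ D.ι) (i : ℤ) (ℓ : ℕ) :
    (D.classCap i ℓ : ℝ) ≤ 2 * D.classBound i ℓ := by
  have h := classBound_ge_one hι i ℓ
  have := Nat.ceil_lt_add_one (show 0 ≤ D.classBound i ℓ by linarith)
  unfold classCap
  linarith

/-- Two parameters in the same confidence set have similar predictions on the data. -/
lemma sum_clip_sq_le (hι : 1 ≤ D.ι) {k : ℕ}
    (hv : ∀ v ∈ Finset.Icc 1 D.K, Valid θs (D.confSet ω (v - 1)))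
    (hk : k ∈ Finset.Icc 1 D.K) {θ : EuclideanSpace ℝ (Fin d)} (hθ : θ ∈ D.confSet ω (k - 1))
    {m : ℕ} (hm : m ∈ Finset.range (D.L₀ + 1)) (i : ℤ) {ℓ : ℕ} (hℓ : ℓ ∈ Finset.Icc 1 D.L') :
    ∑ q ∈ D.layer (D.confSet ω) ω (k - 1 - 1) m i,
        clip ℓ (dot (θ - θs) (D.xAt (D.confSet ω) ω m q.1 q.2)) ^ 2 ≤
      D.classBound i ℓ * ((2 : ℝ)⁻¹ ^ ℓ) ^ 2 := by
  have hk' := Finset.mem_Icc.1 hk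
  have hs := (hv k hk).mem
  have hμ : ‖θ - θs‖ ≤ 2 :=
    (norm_sub_le _ _).trans (by linarith [norm_le_of_mem_confSet hθ, norm_le_of_mem_confSet hs])
  have hp : (0 : ℝ) < (2 : ℝ)⁻¹ ^ ℓ := by positivity
  have hi : (0 : ℝ) < (2 : ℝ) ^ (-i) := by positivity
  rw [confSet_eq] at hθ hs
  have h1 := hθ.2 m hm i ℓ hℓ _ hμ
  have h2 := hs.2 m hm i ℓ hℓ _ hμ
  set T := D.layer (D.confSet ω) ω (k - 1 - 1) m i
  set g : ℕ × ℕ → ℝ := fun q => clip ℓ (dot (θ - θs) (D.xAt (D.confSet ω) ω m q.1 q.2)) with hg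
  have hA : ∑ q ∈ T, g q ^ 2 ≤ ∑ q ∈ T, g q * D.epsAt (D.confSet ω) ω m q.1 q.2 θ -
      ∑ q ∈ T, g q * D.epsAt (D.confSet ω) ω m q.1 q.2 θs := by
    rw [← Finset.sum_sub_distrib]
    refine Finset.sum_le_sum fun q _ => (clip_sq_le_mul _ _).trans (le_of_eq ?_)
    have e := dot_sub_left θ θs (D.xAt (D.confSet ω) ω m q.1 q.2)
    simp only [hg, epsAt]
    linear_combination clip ℓ (dot (θ - θs) (D.xAt (D.confSet ω) ω m q.1 q.2)) * e
  have hB : ∑ q ∈ T, g q ^ 2 * D.etaAt (D.confSet ω) ω m q.1 q.2 * D.ι ≤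
      2 * (2 : ℝ) ^ (-i) * D.ι * ∑ q ∈ T, g q ^ 2 := by
    rw [Finset.mul_sum]
    refine Finset.sum_le_sum fun q hq => ?_
    have h3 := (mem_layer.1 hq).2.2
    rw [sub_eq_add_neg, zpow_add₀ (by norm_num), zpow_one] at h3
    have h4 : 0 ≤ g q ^ 2 * D.ι := mul_nonneg (sq_nonneg _) (by linarith)
    nlinarith
  have hA0 : 0 ≤ ∑ q ∈ T, g q ^ 2 := Finset.sum_nonneg fun _ _ => sq_nonneg _
  generalize ∑ q ∈ T, g q ^ 2 = a at hA hB hA0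
  have h5 := Real.sqrt_le_sqrt hB
  have h6 : √(2 * (2 : ℝ) ^ (-i) * D.ι * a) ≤ a / 16 + 4 * (2 * (2 : ℝ) ^ (-i) * D.ι) := by
    have hc : 0 ≤ 2 * (2 : ℝ) ^ (-i) * D.ι := by positivity
    generalize 2 * (2 : ℝ) ^ (-i) * D.ι = c at hc
    rw [Real.sqrt_le_left (by positivity)]
    nlinarith [sq_nonneg (a / 16 - 4 * c)]
  have h7 := (abs_le.1 h1).2
  have h8 := (abs_le.1 h2).1
  have e : D.classBound i ℓ * ((2 : ℝ)⁻¹ ^ ℓ) ^ 2 =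
      128 * D.ι * ((2 : ℝ) ^ (-i) + (2 : ℝ)⁻¹ ^ ℓ) := by
    have : (4 : ℝ) ^ ℓ * ((2 : ℝ)⁻¹ ^ ℓ) ^ 2 = 1 := by
      rw [← pow_mul, mul_comm ℓ 2, pow_mul, ← mul_pow]; norm_num
    calc _ = 128 * D.ι * (4 ^ ℓ * ((2 : ℝ)⁻¹ ^ ℓ) ^ 2) * ((2 : ℝ) ^ (-i) + (2 : ℝ)⁻¹ ^ ℓ) := by
          rw [classBound]; ring
      _ = _ := by rw [this]; ring
  rw [e]
  nlinarith [mul_nonneg hp.le (by linarith : (0 : ℝ) ≤ D.ι)]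

open Classical in
/-- The steps of a class that are used, episode by episode. -/
def usedSteps (D : Input d S A) (θs : EuclideanSpace ℝ (Fin d)) (ω : History S A) (m : ℕ) (i : ℤ)
    (ℓ : ℕ) : Finset (ℕ × ℕ) :=
  (Finset.Icc 1 D.K ×ˢ Finset.Icc 1 D.H).filter fun q =>
    D.InClass θs (D.confSet ω (q.1 - 1)) (ω q.1) m i ℓ q.2 ∧
      D.classCount θs (D.confSet ω (q.1 - 1)) (ω q.1) m i ℓ q.2 ≤ D.classCap i ℓ

lemma mem_usedSteps {m : ℕ} {i : ℤ} {ℓ : ℕ} {q : ℕ × ℕ} : q ∈ D.usedSteps θs ω m i ℓ ↔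
    q ∈ Finset.Icc 1 D.K ×ˢ Finset.Icc 1 D.H ∧
      D.InClass θs (D.confSet ω (q.1 - 1)) (ω q.1) m i ℓ q.2 ∧
      D.classCount θs (D.confSet ω (q.1 - 1)) (ω q.1) m i ℓ q.2 ≤ D.classCap i ℓ := by
  classical
  unfold usedSteps
  exact Finset.mem_filter

lemma card_usedSteps_fiber {k : ℕ} (hk : k ∈ Finset.Icc 1 D.K) (m : ℕ) (i : ℤ) (ℓ : ℕ) :
    ((D.usedSteps θs ω m i ℓ).filter fun q => q.1 = k).card =
      min (D.classCap i ℓ) (D.classCount θs (D.confSet ω (k - 1)) (ω k) m i ℓ D.H) := by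
  classical
  rw [classCount, ← card_filter_rank_le]
  refine Finset.card_bij (fun q _ => q.2) ?_ ?_ ?_
  · intro q hq
    obtain ⟨hq0, hqk⟩ := Finset.mem_filter.1 hq
    subst hqk
    obtain ⟨hq1, hq2⟩ := mem_usedSteps.1 hq0
    exact Finset.mem_filter.2 ⟨(Finset.mem_product.1 hq1).2, hq2⟩
  · intro q hq q' hq' h
    exact Prod.ext ((Finset.mem_filter.1 hq).2.trans (Finset.mem_filter.1 hq').2.symm) h
  · intro h hh
    obtain ⟨h1, h2⟩ := Finset.mem_filter.1 hh
    exact ⟨(k, h), Finset.mem_filter.2 ⟨mem_usedSteps.2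
      ⟨Finset.mem_product.2 ⟨hk, h1⟩, h2⟩, rfl⟩, rfl⟩

lemma card_usedSteps_fiber_le (k m : ℕ) (i : ℤ) (ℓ : ℕ) :
    ((D.usedSteps θs ω m i ℓ).filter fun q => q.1 = k).card ≤ D.classCap i ℓ := by
  by_cases hk : k ∈ Finset.Icc 1 D.K
  · rw [card_usedSteps_fiber hk]
    exact min_le_left _ _
  · rw [Finset.filter_false_of_mem, Finset.card_empty]
    · exact Nat.zero_le _
    · rintro q hq rfl
      exact hk (Finset.mem_product.1 (mem_usedSteps.1 hq).1).1

lemma binSize_nonneg (hd : 1 ≤ d) : 0 ≤ D.binSize := by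
  have : (1 : ℝ) ≤ d := by exact_mod_cast hd
  refine mul_nonneg (by positivity) (Real.log_nonneg ?_)
  have : (0 : ℝ) ≤ 16 * ((D.H * D.K : ℕ) : ℝ) ^ 3 := by positivity
  nlinarith

/-- Few steps of a class are used: a used step has a large width, in a direction that is hardly
covered by the older steps of the class, and only boundedly many steps of an episode are used. -/
lemma card_usedSteps_le [Nonempty A] (hM : D.Realizes P θs) (hd : 1 ≤ d) (hN : D.H * D.K ≠ 0)
    (hι : 1 ≤ D.ι) (hv : ∀ v ∈ Finset.Icc 1 D.K, Valid θs (D.confSet ω (v - 1))) {m : ℕ}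
    (hm : m ∈ Finset.range (D.L₀ + 1)) (i : ℤ) {ℓ : ℕ} (hℓ : ℓ ∈ Finset.Icc 1 D.L') :
    ((D.usedSteps θs ω m i ℓ).card : ℝ) ≤ 5 * D.classCap i ℓ * D.binSize := by
  classical
  have hN1 : (1 : ℝ) ≤ (D.H * D.K : ℕ) := by exact_mod_cast Nat.pos_of_ne_zero hN
  have hd1 : (1 : ℝ) ≤ d := by exact_mod_cast hd
  have hp : (0 : ℝ) < (2 : ℝ)⁻¹ ^ ℓ := by positivity
  -- a candidate parameter that witnesses the large width
  have hw : ∀ q ∈ D.usedSteps θs ω m i ℓ, ∃ θ ∈ D.confSet ω (q.1 - 1),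
      (2 : ℝ)⁻¹ ^ ℓ < |dot (θ - θs) (D.xAt (D.confSet ω) ω m q.1 q.2)| := fun q hq => by
    obtain ⟨hq1, hq2, _⟩ := mem_usedSteps.1 hq
    exact exists_of_lt_width (hv _ (Finset.mem_product.1 hq1).1) hq2.2.1
  choose! θ hθ hθx using hw
  have hmem : ∀ q ∈ D.usedSteps θs ω m i ℓ, q.1 ∈ Finset.Icc 1 D.K := fun q hq =>
    (Finset.mem_product.1 (mem_usedSteps.1 hq).1).1
  have hcard : (D.usedSteps θs ω m i ℓ).card ≤ D.H * D.K := by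
    refine (Finset.card_le_card (Finset.filter_subset _ _)).trans ?_
    rw [Finset.card_product, Nat.card_Icc, Nat.card_Icc, mul_comm]
    simp
  have key := card_le_of_bins (fun q : ℕ × ℕ => q.1) (fun q => D.xAt (D.confSet ω) ω m q.1 q.2)
    (fun q i => (θ q - θs) i) (ε := (2 : ℝ)⁻¹ ^ ℓ) (a := D.classBound i ℓ) (cap := D.classCap i ℓ)
    (n := D.classCap i ℓ + 1) (M := D.H * D.K) hd hp ?_ (D.usedSteps θs ω m i ℓ) hcard ?_ ?_ ?_ ?_
    (card_usedSteps_fiber_le · m i ℓ)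
  · have hc : (1 : ℝ) ≤ D.classCap i ℓ := by exact_mod_cast one_le_classCap hι i ℓ
    have hlog : 3 * (d : ℝ) * Real.log (d * (1 + 4 * ((D.H * D.K : ℕ) : ℝ) / ((2 : ℝ)⁻¹ ^ ℓ) ^ 2)) ≤
        D.binSize := by
      rw [binSize]
      refine mul_le_mul_of_nonneg_left (Real.log_le_log (by positivity) ?_) (by positivity)
      refine mul_le_mul_of_nonneg_left (add_le_add le_rfl ?_) (by positivity)
      have h2 := two_pow_le_of_mem hN hℓ
      have e : 4 * ((D.H * D.K : ℕ) : ℝ) / ((2 : ℝ)⁻¹ ^ ℓ) ^ 2 =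
          4 * ((D.H * D.K : ℕ) : ℝ) * (2 ^ ℓ) ^ 2 := by
        rw [inv_pow]; field_simp
      rw [e]
      calc 4 * ((D.H * D.K : ℕ) : ℝ) * (2 ^ ℓ) ^ 2
          ≤ 4 * ((D.H * D.K : ℕ) : ℝ) * (2 * (D.H * D.K : ℕ)) ^ 2 := by gcongr
        _ = _ := by ring
    refine key.trans ?_
    refine mul_le_mul ?_ hlog ?_ (by positivity)
    · push_cast; linarith
    · refine mul_nonneg (by positivity) (Real.log_nonneg ?_)
      have : (0 : ℝ) ≤ 4 * ((D.H * D.K : ℕ) : ℝ) / ((2 : ℝ)⁻¹ ^ ℓ) ^ 2 := by positivity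
      nlinarith
  · push_cast
    have := Nat.le_ceil (D.classBound i ℓ)
    unfold classCap
    linarith
  · intro q hq i'
    exact hM.abs_feature_le_one (hv _ (hmem q hq)) _ _ _ _ i'
  · intro q hq
    refine dotProduct_self_le ((norm_sub_le _ _).trans ?_)
    linarith [norm_le_of_mem_confSet (hθ q hq), hM.norm_le]
  · intro q hq
    rw [dotProduct_eq_dot]
    exact hθx q hq
  · intro q hq
    refine le_trans ?_ (sum_clip_sq_le hι hv (hmem q hq) (hθ q hq) hm i hℓ)
    simp only [dotProduct_eq_dot, clip_sq]
    refine Finset.sum_le_sum_of_subset_of_nonneg (fun q' hq' => ?_)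
      fun _ _ _ => le_min (sq_nonneg _) (sq_nonneg _)
    -- `confSet ω (k - 1)` is built from the data of the episodes up to `k - 3`
    obtain ⟨h1, h2⟩ := Finset.mem_filter.1 hq'
    obtain ⟨h3, h4, _⟩ := Finset.mem_filter.1 h1
    obtain ⟨h5, h6⟩ := Finset.mem_product.1 h3
    refine mem_layer.2 ⟨Finset.mem_product.2 ⟨?_, h6⟩, h4.1⟩
    rw [Finset.mem_Icc] at h5 ⊢
    omega

open Classical in
/-- The steps up to the truncation of their episodes. -/
def liveSteps (D : Input d S A) (θs : EuclideanSpace ℝ (Fin d)) (ω : History S A) :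
    Finset (ℕ × ℕ) :=
  (Finset.Icc 1 D.K ×ˢ Finset.Icc 1 D.H).filter fun q =>
    D.Live θs (D.confSet ω (q.1 - 1)) (ω q.1) q.2

open Classical in
/-- The episodes that are truncated. -/
def cutEpisodes (D : Input d S A) (θs : EuclideanSpace ℝ (Fin d)) (ω : History S A) : Finset ℕ :=
  (Finset.Icc 1 D.K).filter fun k => ¬ D.Live θs (D.confSet ω (k - 1)) (ω k) D.H

/-- Few episodes are truncated: each of them fills the cap of some class. -/
lemma card_cutEpisodes_le [Nonempty A] (hM : D.Realizes P θs) (hd : 1 ≤ d) (hN : D.H * D.K ≠ 0)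
    (hι : 1 ≤ D.ι) (hv : ∀ v ∈ Finset.Icc 1 D.K, Valid θs (D.confSet ω (v - 1))) :
    ((D.cutEpisodes θs ω).card : ℝ) ≤ D.classes.card * (5 * D.binSize) := by
  classical
  have hsub : D.cutEpisodes θs ω ⊆ D.classes.biUnion fun c => (Finset.Icc 1 D.K).filter fun k =>
      D.classCap c.2.1 c.2.2 < D.classCount θs (D.confSet ω (k - 1)) (ω k) c.1 c.2.1 c.2.2 D.H := by
    intro k hk
    obtain ⟨h1, h2⟩ := Finset.mem_filter.1 hk
    unfold Live at h2
    push Not at h2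
    obtain ⟨c, hc, hlt⟩ := h2
    exact Finset.mem_biUnion.2 ⟨c, hc, Finset.mem_filter.2 ⟨h1, hlt⟩⟩
  have hone : ∀ c ∈ D.classes, (((Finset.Icc 1 D.K).filter fun k =>
      D.classCap c.2.1 c.2.2 < D.classCount θs (D.confSet ω (k - 1)) (ω k) c.1 c.2.1 c.2.2 D.H).card
        : ℝ) ≤ 5 * D.binSize := by
    intro c hc
    obtain ⟨hm, hc2⟩ := Finset.mem_product.1 hc
    obtain ⟨_, hℓ⟩ := Finset.mem_product.1 hc2
    set F := (Finset.Icc 1 D.K).filter fun k =>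
      D.classCap c.2.1 c.2.2 < D.classCount θs (D.confSet ω (k - 1)) (ω k) c.1 c.2.1 c.2.2 D.H
    have h1 : F.card * D.classCap c.2.1 c.2.2 ≤ (D.usedSteps θs ω c.1 c.2.1 c.2.2).card := by
      rw [← smul_eq_mul]
      calc _ ≤ ∑ k ∈ F, ((D.usedSteps θs ω c.1 c.2.1 c.2.2).filter fun q => q.1 = k).card := by
            refine Finset.card_nsmul_le_sum _ _ _ fun k hk => ?_
            obtain ⟨hk1, hk2⟩ := Finset.mem_filter.1 hk
            rw [card_usedSteps_fiber hk1, min_eq_left hk2.le]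
        _ = (F.biUnion fun k =>
              (D.usedSteps θs ω c.1 c.2.1 c.2.2).filter fun q => q.1 = k).card := by
            rw [Finset.card_biUnion]
            intro k _ k' _ hkk
            refine Finset.disjoint_left.2 fun q hq hq' => hkk ?_
            rw [← (Finset.mem_filter.1 hq).2, (Finset.mem_filter.1 hq').2]
        _ ≤ _ := Finset.card_le_card
            (Finset.biUnion_subset.2 fun k _ => Finset.filter_subset _ _)
    have h2 := card_usedSteps_le (ω := ω) hM hd hN hι hv hm c.2.1 hℓ
    have h3 : (1 : ℝ) ≤ D.classCap c.2.1 c.2.2 := by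
      exact_mod_cast one_le_classCap hι c.2.1 c.2.2
    have h4 : (F.card : ℝ) * D.classCap c.2.1 c.2.2 ≤ 5 * D.classCap c.2.1 c.2.2 * D.binSize := by
      refine le_trans ?_ h2
      exact_mod_cast h1
    have h5 : (F.card : ℝ) * D.classCap c.2.1 c.2.2 ≤ 5 * D.binSize * D.classCap c.2.1 c.2.2 := by
      linarith
    exact le_of_mul_le_mul_right h5 (by linarith)
  calc ((D.cutEpisodes θs ω).card : ℝ) ≤ ((D.classes.biUnion fun c =>
        (Finset.Icc 1 D.K).filter fun k => D.classCap c.2.1 c.2.2 <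
          D.classCount θs (D.confSet ω (k - 1)) (ω k) c.1 c.2.1 c.2.2 D.H).card : ℝ) := by
        exact_mod_cast Finset.card_le_card hsub
    _ ≤ ∑ c ∈ D.classes, (((Finset.Icc 1 D.K).filter fun k => D.classCap c.2.1 c.2.2 <
          D.classCount θs (D.confSet ω (k - 1)) (ω k) c.1 c.2.1 c.2.2 D.H).card : ℝ) := by
        exact_mod_cast Finset.card_biUnion_le
    _ ≤ _ := by
        refine (Finset.sum_le_card_nsmul _ _ _ hone).trans (le_of_eq ?_)
        rw [nsmul_eq_mul]

end Input

namespace Input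

variable {d : ℕ} {S A : Type*}

/-! ### The sum of the widths is controlled by the sum of the variance estimates -/

/-- The width in step `h` of episode `k`. -/
def widthAt (D : Input d S A) (θs : EuclideanSpace ℝ (Fin d)) (ω : History S A) (m k h : ℕ) : ℝ :=
  D.width θs (D.confSet ω (k - 1)) m h (ω k h).1 (ω k h).2

/-- The sum of the widths over the live steps. -/
def sumWidth (D : Input d S A) (θs : EuclideanSpace ℝ (Fin d)) (ω : History S A) (m : ℕ) : ℝ :=
  ∑ q ∈ D.liveSteps θs ω, D.widthAt θs ω m q.1 q.2

/-- The sum of the variance estimates over the live steps. -/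
def sumEta (D : Input d S A) (θs : EuclideanSpace ℝ (Fin d)) (ω : History S A) (m : ℕ) : ℝ :=
  ∑ q ∈ D.liveSteps θs ω, D.etaAt (D.confSet ω) ω m q.1 q.2

/-- The constant in the bound of the widths of one class. -/
def classConst (D : Input d S A) : ℝ := 5120 * D.ι * D.binSize

variable {D : Input d S A} {P : S → A → PMF S} {θs : EuclideanSpace ℝ (Fin d)} {ω : History S A}

lemma mem_liveSteps {q : ℕ × ℕ} : q ∈ D.liveSteps θs ω ↔
    q ∈ Finset.Icc 1 D.K ×ˢ Finset.Icc 1 D.H ∧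
      D.Live θs (D.confSet ω (q.1 - 1)) (ω q.1) q.2 := by
  classical
  unfold liveSteps
  exact Finset.mem_filter

lemma valid_of_mem_liveSteps (hv : ∀ v ∈ Finset.Icc 1 D.K, Valid θs (D.confSet ω (v - 1)))
    {q : ℕ × ℕ} (hq : q ∈ D.liveSteps θs ω) : Valid θs (D.confSet ω (q.1 - 1)) :=
  hv _ (Finset.mem_product.1 (mem_liveSteps.1 hq).1).1

lemma card_liveSteps_le : (D.liveSteps θs ω).card ≤ D.H * D.K := by
  classical
  refine (Finset.card_le_card (Finset.filter_subset _ _)).trans ?_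
  rw [Finset.card_product, Nat.card_Icc, Nat.card_Icc, mul_comm]
  simp

lemma sumEta_nonneg [Nonempty A] (hM : D.Realizes P θs)
    (hv : ∀ v ∈ Finset.Icc 1 D.K, Valid θs (D.confSet ω (v - 1))) (m : ℕ) :
    0 ≤ D.sumEta θs ω m :=
  Finset.sum_nonneg fun _ hq => hM.varEst_nonneg (valid_of_mem_liveSteps hv hq) _ _ _ _

lemma sumWidth_nonneg [Nonempty A] (hM : D.Realizes P θs)
    (hv : ∀ v ∈ Finset.Icc 1 D.K, Valid θs (D.confSet ω (v - 1))) (m : ℕ) :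
    0 ≤ D.sumWidth θs ω m :=
  Finset.sum_nonneg fun _ hq => hM.width_nonneg (valid_of_mem_liveSteps hv hq) _ _ _ _

open Classical in
/-- The live steps of a class. -/
def liveClass (D : Input d S A) (θs : EuclideanSpace ℝ (Fin d)) (ω : History S A) (m : ℕ) (i : ℤ)
    (ℓ : ℕ) : Finset (ℕ × ℕ) :=
  (D.liveSteps θs ω).filter fun q => D.InClass θs (D.confSet ω (q.1 - 1)) (ω q.1) m i ℓ q.2

lemma mem_liveClass {m : ℕ} {i : ℤ} {ℓ : ℕ} {q : ℕ × ℕ} : q ∈ D.liveClass θs ω m i ℓ ↔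
    q ∈ D.liveSteps θs ω ∧ D.InClass θs (D.confSet ω (q.1 - 1)) (ω q.1) m i ℓ q.2 := by
  classical
  unfold liveClass
  exact Finset.mem_filter

lemma card_liveClass_le [Nonempty A] (hM : D.Realizes P θs) (hd : 1 ≤ d) (hN : D.H * D.K ≠ 0)
    (hι : 1 ≤ D.ι) (hv : ∀ v ∈ Finset.Icc 1 D.K, Valid θs (D.confSet ω (v - 1))) {m : ℕ}
    (hm : m ∈ Finset.range (D.L₀ + 1)) {i : ℤ} (hi : i ∈ D.layers) {ℓ : ℕ}
    (hℓ : ℓ ∈ Finset.Icc 1 D.L') : 4 * ((2 : ℝ)⁻¹ ^ ℓ) ^ 2 * (D.liveClass θs ω m i ℓ).card ≤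
      D.classConst * ((2 : ℝ) ^ (-i) + (2 : ℝ)⁻¹ ^ ℓ) := by
  have h1 : (D.liveClass θs ω m i ℓ).card ≤ (D.usedSteps θs ω m i ℓ).card := by
    refine Finset.card_le_card fun q hq => ?_
    obtain ⟨h1, h2⟩ := mem_liveClass.1 hq
    obtain ⟨h3, h4⟩ := mem_liveSteps.1 h1
    exact mem_usedSteps.2 ⟨h3, h2, h4 (m, i, ℓ)
      (Finset.mem_product.2 ⟨hm, Finset.mem_product.2 ⟨hi, hℓ⟩⟩)⟩
  have h2 := card_usedSteps_le hM hd hN hι hv hm i hℓ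
  have h3 : ((D.liveClass θs ω m i ℓ).card : ℝ) ≤ 10 * D.classBound i ℓ * D.binSize := by
    calc ((D.liveClass θs ω m i ℓ).card : ℝ) ≤ (D.usedSteps θs ω m i ℓ).card := by
          exact_mod_cast h1
      _ ≤ 5 * D.classCap i ℓ * D.binSize := h2
      _ ≤ 5 * (2 * D.classBound i ℓ) * D.binSize := by
          have := binSize_nonneg (D := D) hd
          have := classCap_le hι i ℓ
          gcongr
      _ = _ := by ring
  have h4 : (4 : ℝ) ^ ℓ * ((2 : ℝ)⁻¹ ^ ℓ) ^ 2 = 1 := by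
    rw [← pow_mul, mul_comm ℓ 2, pow_mul, ← mul_pow]; norm_num
  calc 4 * ((2 : ℝ)⁻¹ ^ ℓ) ^ 2 * (D.liveClass θs ω m i ℓ).card
      ≤ 4 * ((2 : ℝ)⁻¹ ^ ℓ) ^ 2 * (10 * D.classBound i ℓ * D.binSize) := by gcongr
    _ = (4 ^ ℓ * ((2 : ℝ)⁻¹ ^ ℓ) ^ 2) * (D.classConst * ((2 : ℝ) ^ (-i) + (2 : ℝ)⁻¹ ^ ℓ)) := by
        rw [classBound, classConst]; ring
    _ = _ := by rw [h4, one_mul]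

lemma classConst_nonneg (hd : 1 ≤ d) (hι : 1 ≤ D.ι) : 0 ≤ D.classConst := by
  have := binSize_nonneg (D := D) hd
  unfold classConst
  positivity

/-- The widths of one class. For `ℓ ≠ 1` all widths are comparable to `2 ^ (-ℓ)`, and all variance
estimates to `2 ^ (-i)`, so that the bound on the number of steps reads `X ^ 2 ≤ b * (E + X)` for
the sum `X` of the widths. -/
lemma sum_widthAt_liveClass_le [Nonempty A] (hM : D.Realizes P θs) (hd : 1 ≤ d)
    (hN : D.H * D.K ≠ 0) (hι : 1 ≤ D.ι)
    (hv : ∀ v ∈ Finset.Icc 1 D.K, Valid θs (D.confSet ω (v - 1))) {m : ℕ}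
    (hm : m ∈ Finset.range (D.L₀ + 1)) {i : ℤ} (hi : i ∈ D.layers) {ℓ : ℕ}
    (hℓ : ℓ ∈ Finset.Icc 1 D.L') : ∑ q ∈ D.liveClass θs ω m i ℓ, D.widthAt θs ω m q.1 q.2 ≤
      √(D.classConst * D.sumEta θs ω m) + 3 * d * D.classConst := by
  have hb := classConst_nonneg hd hι
  have hE := sumEta_nonneg hM hv m
  have hd1 : (1 : ℝ) ≤ d := by exact_mod_cast hd
  have hp : (0 : ℝ) < (2 : ℝ)⁻¹ ^ ℓ := by positivity
  have hz : (0 : ℝ) < (2 : ℝ) ^ (-i) := by positivity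
  have hcard := card_liveClass_le hM hd hN hι hv hm hi hℓ
  set b := D.classConst
  set T := D.liveClass θs ω m i ℓ
  set n : ℝ := (T.card : ℝ) with hn
  have hn0 : 0 ≤ n := Nat.cast_nonneg _
  have hT : ∀ q ∈ T, D.InClass θs (D.confSet ω (q.1 - 1)) (ω q.1) m i ℓ q.2 := fun q hq =>
    (mem_liveClass.1 hq).2
  have hTv : ∀ q ∈ T, Valid θs (D.confSet ω (q.1 - 1)) := fun q hq =>
    valid_of_mem_liveSteps hv (mem_liveClass.1 hq).1
  by_cases hℓ1 : ℓ = 1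
  · have hS : ∑ q ∈ T, D.widthAt θs ω m q.1 q.2 ≤ 2 * √d * n := by
      refine (Finset.sum_le_card_nsmul _ _ (2 * √d) fun q hq =>
        hM.width_le (hTv q hq) _ _ _ _).trans (le_of_eq ?_)
      rw [nsmul_eq_mul, hn]; ring
    have hsd : 1 ≤ √(d : ℝ) := Real.one_le_sqrt.2 hd1
    have hsd2 : √(d : ℝ) ^ 2 = d := Real.sq_sqrt (by linarith)
    have hn1 : n ≤ b * (√d + 1 / 2) := by
      rcases T.eq_empty_or_nonempty with h0 | ⟨q, hq⟩
      · rw [hn, h0]; simp only [Finset.card_empty, Nat.cast_zero]; positivity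
      · have h1 : (2 : ℝ) ^ (-i) ≤ √d :=
          (hT q hq).1.1.le.trans (hM.varEst_le (hTv q hq) _ _ _ _)
        rw [hℓ1] at hcard
        have h2 : n ≤ b * ((2 : ℝ) ^ (-i) + 1 / 2) := by norm_num at hcard ⊢; linarith
        exact h2.trans (by gcongr)
    have h3 : 2 * √d * n ≤ 2 * √d * (b * (√d + 1 / 2)) := by gcongr
    have h4 : b * √d ≤ b * d := by
      refine mul_le_mul_of_nonneg_left ?_ hb
      nlinarith
    have h5 : 2 * √d * (b * (√d + 1 / 2)) = 2 * b * d + b * √d := by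
      linear_combination 2 * b * hsd2
    linarith [Real.sqrt_nonneg (b * D.sumEta θs ω m)]
  · set X := ∑ q ∈ T, D.widthAt θs ω m q.1 q.2 with hX
    have h1 : X ≤ 2 * (2 : ℝ)⁻¹ ^ ℓ * n := by
      refine (Finset.sum_le_card_nsmul _ _ (2 * (2 : ℝ)⁻¹ ^ ℓ) fun q hq =>
        (hT q hq).2.2.resolve_left hℓ1).trans (le_of_eq ?_)
      rw [nsmul_eq_mul, hn]; ring
    have h2 : (2 : ℝ)⁻¹ ^ ℓ * n ≤ X := by
      refine (le_of_eq ?_).trans (Finset.card_nsmul_le_sum _ _ ((2 : ℝ)⁻¹ ^ ℓ) fun q hq =>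
        (hT q hq).2.1.le)
      rw [nsmul_eq_mul, hn]; ring
    have h3 : (2 : ℝ) ^ (-i) * n ≤ D.sumEta θs ω m := by
      refine le_trans ((le_of_eq ?_).trans (Finset.card_nsmul_le_sum T
        (fun q => D.etaAt (D.confSet ω) ω m q.1 q.2) ((2 : ℝ) ^ (-i)) fun q hq =>
        (hT q hq).1.1.le)) ?_
      · rw [nsmul_eq_mul, hn]; ring
      · exact Finset.sum_le_sum_of_subset_of_nonneg (fun q hq => (mem_liveClass.1 hq).1)
          fun q hq _ => hM.varEst_nonneg (valid_of_mem_liveSteps hv hq) _ _ _ _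
    have hX0 : 0 ≤ X := le_trans (by positivity) h2
    have h4 : X ^ 2 ≤ b * (D.sumEta θs ω m + X) := by
      calc X ^ 2 ≤ (2 * (2 : ℝ)⁻¹ ^ ℓ * n) ^ 2 := by gcongr
        _ = (4 * ((2 : ℝ)⁻¹ ^ ℓ) ^ 2 * n) * n := by ring
        _ ≤ b * ((2 : ℝ) ^ (-i) + (2 : ℝ)⁻¹ ^ ℓ) * n := by gcongr
        _ = b * ((2 : ℝ) ^ (-i) * n + (2 : ℝ)⁻¹ ^ ℓ * n) := by ring
        _ ≤ _ := by gcongr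
    have h5 := le_sqrt_mul_add_of_sq_le hb hE h4
    nlinarith

/-- Every step with a width that is not negligible belongs to one of the classes. -/
lemma widthAt_le [Nonempty A] (hM : D.Realizes P θs) (hd : 1 ≤ d) (hN : 2 ≤ D.H * D.K) {k : ℕ}
    (hv : Valid θs (D.confSet ω (k - 1)))
    (hball : ∀ θ : EuclideanSpace ℝ (Fin d), ‖θ‖ ≤ 1 →
      (1 - 1 / ((D.H * D.K : ℕ) : ℝ)) • θs + (1 / ((D.H * D.K : ℕ) : ℝ)) • θ ∈ D.confSet ω (k - 1))
    (m h : ℕ) :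
    D.widthAt θs ω m k h ≤ 5 / ((D.H * D.K : ℕ) : ℝ) ∨ ∃ i ∈ D.layers, ∃ ℓ ∈ Finset.Icc 1 D.L',
      D.InClass θs (D.confSet ω (k - 1)) (ω k) m i ℓ h := by
  have hN2 : (2 : ℝ) ≤ (D.H * D.K : ℕ) := by exact_mod_cast hN
  have hd1 : (1 : ℝ) ≤ d := by exact_mod_cast hd
  set N : ℝ := ((D.H * D.K : ℕ) : ℝ) with hNdef
  set η := D.varEst (D.confSet ω (k - 1)) m h (ω k h).1 (ω k h).2 with hη
  set W := D.width θs (D.confSet ω (k - 1)) m h (ω k h).1 (ω k h).2 with hW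
  have hη0 : 0 ≤ η := hM.varEst_nonneg hv _ _ _ _
  by_cases hW1 : W ≤ 5 / N
  · exact Or.inl hW1
  right
  push Not at hW1
  -- the variance estimate cannot be tiny
  have hη1 : 1 / (d * N ^ 3) < η := by
    by_contra! hle
    have h1 := hM.width_le_of_ball (σ := 1 / N) hv (by positivity)
      (by rw [div_le_div_iff₀ (by positivity) (by norm_num)]; linarith) hd hball m h
      (ω k h).1 (ω k h).2
    have h2 : √(d * (η / (1 / N))) ≤ 1 / N := by
      rw [Real.sqrt_le_left (by positivity)]
      calc d * (η / (1 / N)) = η * (d * N) := by field_simp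
        _ ≤ 1 / (d * N ^ 3) * (d * N) := by gcongr
        _ = (1 / N) ^ 2 := by field_simp
    have h3 : W ≤ 5 * (1 / N) := h1.trans (by gcongr)
    rw [mul_one_div] at h3
    linarith
  have hηpos : 0 < η := lt_trans (by positivity) hη1
  -- the layer
  obtain ⟨j, hj⟩ := exists_mem_Ioc_zpow (x := η) (y := (2 : ℝ)) hηpos (by norm_num)
  have hj1 : η ∈ Set.Ioc ((2 : ℝ) ^ (-(-j))) ((2 : ℝ) ^ (1 - -j)) := by
    rw [neg_neg, sub_neg_eq_add, add_comm]; exact hj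
  have hjl : -j ∈ D.layers := by
    rw [layers, Finset.mem_Ioc]
    constructor
    · have h1 : (2 : ℝ) ^ j < (2 : ℝ) ^ (logCeil d : ℤ) := by
        rw [zpow_natCast]
        refine hj.1.trans_le ((hM.varEst_le hv _ _ _ _).trans ?_)
        refine le_trans ?_ (lt_two_pow_logCeil d).le
        rw [Real.sqrt_le_left (by positivity)]
        nlinarith
      have := (zpow_lt_zpow_iff_right₀ (by norm_num : (1 : ℝ) < 2)).1 h1
      omega
    · have h1 : (2 : ℝ) ^ (-(logCeil (d * (D.H * D.K) ^ 3) : ℤ)) < (2 : ℝ) ^ (j + 1) := by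
        refine lt_of_lt_of_le (lt_trans ?_ hη1) hj.2
        rw [zpow_neg, zpow_natCast, ← one_div]
        refine one_div_lt_one_div_of_lt (by positivity) ?_
        have := lt_two_pow_logCeil (d * (D.H * D.K) ^ 3)
        push_cast at this hNdef ⊢
        rw [hNdef]
        exact this
      have := (zpow_lt_zpow_iff_right₀ (by norm_num : (1 : ℝ) < 2)).1 h1
      omega
  refine ⟨-j, hjl, ?_⟩
  have hL : (2 : ℝ)⁻¹ ^ D.L' < W := by
    refine lt_trans ?_ hW1
    have h1 : N < 2 ^ D.L' := lt_two_pow_logCeil _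
    rw [inv_pow, ← one_div, div_lt_div_iff₀ (by positivity) (by positivity)]
    linarith
  have hex : ∃ ℓ, 1 ≤ ℓ ∧ (2 : ℝ)⁻¹ ^ ℓ < W := ⟨D.L', by unfold L'; omega, hL⟩
  classical
  have hf := Nat.find_spec hex
  refine ⟨Nat.find hex, Finset.mem_Icc.2 ⟨hf.1, Nat.find_min' hex ⟨by unfold L'; omega, hL⟩⟩,
    hj1, hf.2, ?_⟩
  by_cases h1 : Nat.find hex = 1
  · exact Or.inl h1
  · right
    by_contra! hlt
    have hf1 := hf.1
    refine Nat.find_min hex (m := Nat.find hex - 1) (by omega) ⟨by omega, ?_⟩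
    refine lt_of_eq_of_lt ?_ hlt
    obtain ⟨n, hn⟩ : ∃ n, Nat.find hex = n + 1 := ⟨Nat.find hex - 1, by omega⟩
    rw [hn, Nat.add_sub_cancel, pow_succ]
    ring

/-- The sum of the widths over the live steps is of the order of the square root of the sum of the
variance estimates. -/
lemma sumWidth_le [Nonempty A] (hM : D.Realizes P θs) (hd : 1 ≤ d) (hN : 2 ≤ D.H * D.K)
    (hι : 1 ≤ D.ι) (hv : ∀ v ∈ Finset.Icc 1 D.K, Valid θs (D.confSet ω (v - 1)))
    (hball : ∀ v ∈ Finset.Icc 1 D.K, ∀ θ : EuclideanSpace ℝ (Fin d), ‖θ‖ ≤ 1 →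
      (1 - 1 / ((D.H * D.K : ℕ) : ℝ)) • θs + (1 / ((D.H * D.K : ℕ) : ℝ)) • θ ∈ D.confSet ω (v - 1))
    {m : ℕ} (hm : m ∈ Finset.range (D.L₀ + 1)) :
    D.sumWidth θs ω m ≤ 5 + (D.layers.card * D.L' : ℕ) *
      (√(D.classConst * D.sumEta θs ω m) + 3 * d * D.classConst) := by
  classical
  have hN0 : D.H * D.K ≠ 0 := by omega
  have hNpos : (0 : ℝ) < (D.H * D.K : ℕ) := by exact_mod_cast Nat.pos_of_ne_zero hN0
  have hpt : ∀ q ∈ D.liveSteps θs ω, D.widthAt θs ω m q.1 q.2 ≤ 5 / ((D.H * D.K : ℕ) : ℝ) +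
      ∑ c ∈ D.layers ×ˢ Finset.Icc 1 D.L',
        if q ∈ D.liveClass θs ω m c.1 c.2 then D.widthAt θs ω m q.1 q.2 else 0 := by
    intro q hq
    have hqv := valid_of_mem_liveSteps hv hq
    have hqk := (Finset.mem_product.1 (mem_liveSteps.1 hq).1).1
    have hw0 : 0 ≤ D.widthAt θs ω m q.1 q.2 := hM.width_nonneg hqv _ _ _ _
    have hnn : ∀ c ∈ D.layers ×ˢ Finset.Icc 1 D.L',
        0 ≤ if q ∈ D.liveClass θs ω m c.1 c.2 then D.widthAt θs ω m q.1 q.2 else 0 := by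
      intro c _
      split_ifs
      · exact hw0
      · exact le_rfl
    rcases widthAt_le hM hd hN hqv (hball _ hqk) m q.2 with h | ⟨i, hi, ℓ, hℓ, hc⟩
    · exact h.trans (le_add_of_nonneg_right (Finset.sum_nonneg hnn))
    · have h1 := Finset.single_le_sum hnn (Finset.mem_product.2 ⟨hi, hℓ⟩ : (i, ℓ) ∈ _)
      simp only [if_pos (mem_liveClass.2 ⟨hq, hc⟩)] at h1
      exact h1.trans (le_add_of_nonneg_left (by positivity))
  refine (Finset.sum_le_sum hpt).trans ?_
  rw [Finset.sum_add_distrib, Finset.sum_comm, Finset.sum_const, nsmul_eq_mul]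
  refine add_le_add ?_ ?_
  · have : ((D.liveSteps θs ω).card : ℝ) ≤ (D.H * D.K : ℕ) := by exact_mod_cast card_liveSteps_le
    rw [mul_div_assoc', div_le_iff₀ hNpos]
    nlinarith
  · refine (Finset.sum_le_card_nsmul _ _
      (√(D.classConst * D.sumEta θs ω m) + 3 * d * D.classConst) fun c hc => ?_).trans (le_of_eq ?_)
    · obtain ⟨h1, h2⟩ := Finset.mem_product.1 hc
      refine le_trans (le_of_eq ?_) (sum_widthAt_liveClass_le hM hd hN0 hι hv hm h1 h2)
      rw [← Finset.sum_filter]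
      refine Finset.sum_congr ?_ fun _ _ => rfl
      ext q
      simp only [Finset.mem_filter, and_iff_right_iff_imp]
      exact fun h => (mem_liveClass.1 h).1
    · rw [nsmul_eq_mul, Finset.card_product, Nat.card_Icc, Nat.add_sub_cancel]

end Input

/-! ### Recursion for the sums of the variance estimates -/

/-- Telescoping up to a truncation: what is left over is the value at the truncation. -/
lemma sum_filter_sub_le {f : ℕ → ℝ} {I : ℕ → Prop} [DecidablePred I] (hI : ∀ n, I (n + 1) → I n)
    (h0 : ∀ n, 0 ≤ f n) (h1 : ∀ n, f n ≤ 1) (n : ℕ) :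
    |f 1 - ∑ h ∈ Finset.Icc 1 n, if I h then f h - f (h + 1) else 0| ≤ 1 ∧
    (I n → ∑ h ∈ Finset.Icc 1 n, (if I h then f h - f (h + 1) else 0) = f 1 - f (n + 1)) := by
  induction n with
  | zero => simpa [abs_of_nonneg (h0 1)] using h1 1
  | succ n ih =>
    rw [Finset.sum_Icc_succ_top (by omega)]
    by_cases hn : I (n + 1)
    · rw [if_pos hn, ih.2 (hI n hn)]
      refine ⟨?_, fun _ => by ring⟩
      rw [show f 1 - (f 1 - f (n + 1) + (f (n + 1) - f (n + 1 + 1))) = f (n + 2) by ring,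
        abs_of_nonneg (h0 _)]
      exact h1 _
    · rw [if_neg hn, add_zero]
      exact ⟨ih.1, fun h => absurd h hn⟩

/-- Powers with exponent `n` on `[0, 1]` are Lipschitz with constant `n`. -/
lemma pow_sub_pow_le {x y c : ℝ} (hx0 : 0 ≤ x) (hx : x ≤ 1) (hy0 : 0 ≤ y) (hy : y ≤ 1)
    (hc : 0 ≤ c) (h : x ≤ y + c) (n : ℕ) : x ^ n - y ^ n ≤ n * c := by
  induction n with
  | zero => simp
  | succ n ih =>
    have h1 : 0 ≤ x ^ n := pow_nonneg hx0 n
    have h2 : x ^ n ≤ 1 := pow_le_one₀ hx0 hx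
    have h3 : 0 ≤ (n : ℝ) * c := by positivity
    have e : x ^ (n + 1) - y ^ (n + 1) = x ^ n * (x - y) + y * (x ^ n - y ^ n) := by ring
    have h4 : x ^ n * (x - y) ≤ c := by
      calc x ^ n * (x - y) ≤ x ^ n * c := by gcongr; linarith
        _ ≤ 1 * c := by gcongr
        _ = c := one_mul c
    have h5 : y * (x ^ n - y ^ n) ≤ n * c := by
      calc y * (x ^ n - y ^ n) ≤ y * (n * c) := by gcongr
        _ ≤ 1 * (n * c) := by gcongr
        _ = n * c := one_mul _
    rw [e]
    push_cast
    linarith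

/-- The recursion that relates the sums `E m` of the variance estimates of the powers `2 ^ m` of
the values, and the sums `R m` of the widths. The factor `2 ^ (m + 1)` is harmless since the number
of levels is logarithmic in the horizon: at the last level the trivial bound is good enough. -/
lemma recursion_bound {E R : ℕ → ℝ} {L : ℕ} {Λ Γ G k A : ℝ} (hE : ∀ m, 0 ≤ E m) (hR : 0 ≤ R 0)
    (hΓ : 0 ≤ Γ) (hG : 0 ≤ G) (hk : 0 ≤ k) (hA : 0 ≤ A)
    (hRE : ∀ m ≤ L, R m ≤ Λ * √(E m) + Γ)
    (hrec : ∀ m < L, E m ≤ E (m + 1) / 16 + G + 2 ^ (m + 1) * (k + R 0) + R (m + 1) + 2 * R m)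
    (hL : E L ≤ 2 ^ L * A) :
    E 0 ≤ 4 * G + 48 * Λ ^ 2 + 20 * Γ + 8 * k + 2 * A := by
  have hs : ∀ m, √(E m) ^ 2 = E m := fun m => Real.sq_sqrt (hE m)
  set B := 2 * (G + 8 * Λ ^ 2 + 3 * Γ) + 4 * (k + R 0) + A with hB
  have hB0 : 0 ≤ B := by positivity
  have key : ∀ n ≤ L, E (L - n) ≤ 2 ^ (L - n) * B := by
    intro n
    induction n with
    | zero =>
      intro _
      refine hL.trans ?_
      rw [Nat.sub_zero]
      gcongr
      rw [hB]
      nlinarith [sq_nonneg Λ]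
    | succ n ih =>
      intro hn
      obtain ⟨m, hm⟩ : ∃ m, L - (n + 1) = m := ⟨_, rfl⟩
      have hm1 : L - n = m + 1 := by omega
      have ih := ih (by omega)
      rw [hm1] at ih
      rw [hm]
      have h1 := hRE m (by omega)
      have h2 := hRE (m + 1) (by omega)
      have h3 := hrec m (by omega)
      have h4 : 1 ≤ (2 : ℝ) ^ m := one_le_pow₀ (by norm_num)
      rw [pow_succ] at ih h3
      have h5 := hs m
      have h6 := hs (m + 1)
      have h7 : 2 * (Λ * √(E m)) ≤ E m / 4 + 4 * Λ ^ 2 := by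
        nlinarith [sq_nonneg (√(E m) / 2 - 2 * Λ)]
      have h8 : Λ * √(E (m + 1)) ≤ E (m + 1) / 16 + 4 * Λ ^ 2 := by
        nlinarith [sq_nonneg (√(E (m + 1)) / 4 - 2 * Λ)]
      have h9 : 3 / 4 * E m ≤ 2 ^ m * (B / 4) + (G + 8 * Λ ^ 2 + 3 * Γ) +
          2 ^ m * (2 * (k + R 0)) := by linarith
      have h10 : G + 8 * Λ ^ 2 + 3 * Γ ≤ 2 ^ m * (G + 8 * Λ ^ 2 + 3 * Γ) :=
        le_mul_of_one_le_left (by positivity) h4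
      have h11 : 0 ≤ (2 : ℝ) ^ m * A := by positivity
      have h12 : (2 : ℝ) ^ m * B = 2 ^ m * (2 * (G + 8 * Λ ^ 2 + 3 * Γ)) +
          2 ^ m * (4 * (k + R 0)) + 2 ^ m * A := by rw [hB]; ring
      nlinarith
  have h0 := key L le_rfl
  rw [Nat.sub_self, pow_zero, one_mul] at h0
  have h1 := hRE 0 (Nat.zero_le _)
  have h2 : 4 * (Λ * √(E 0)) ≤ E 0 / 2 + 8 * Λ ^ 2 := by
    nlinarith [sq_nonneg (√(E 0) - 4 * Λ), hs 0]
  rw [hB] at h0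
  linarith

namespace Input

variable {d : ℕ} {S A : Type*}

/-- The properties that almost every history has: the total reward of an episode is at most `1`,
and the actions are greedy. -/
structure Typical (D : Input d S A) (ω : History S A) : Prop where
  reward_le : ∀ k ∈ Finset.Icc 1 D.K, ∑ h ∈ Finset.Icc 1 D.H, D.reward (ω k h).1 (ω k h).2 ≤ 1
  greedy : ∀ k ∈ Finset.Icc 1 D.K, ∀ h ∈ Finset.Icc 1 D.H, ∀ a,
    D.planQ (D.confSet ω (k - 1)) h (ω k h).1 a ≤
      D.planQ (D.confSet ω (k - 1)) h (ω k h).1 (ω k h).2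

/-- The planned value of the state in step `h` of episode `k`. -/
def valueAt (D : Input d S A) (ω : History S A) (k h : ℕ) : ℝ :=
  D.planValue (D.confSet ω (k - 1)) (D.H + 1 - h) (ω k h).1

/-- The sum of the prediction errors of the true parameter over the live steps. -/
def sumEps (D : Input d S A) (θs : EuclideanSpace ℝ (Fin d)) (ω : History S A) (m : ℕ) : ℝ :=
  ∑ q ∈ D.liveSteps θs ω, D.epsAt (D.confSet ω) ω m q.1 q.2 θs

/-- The sum of the true variances over the live steps. -/
def sumTrueVar (D : Input d S A) (θs : EuclideanSpace ℝ (Fin d)) (ω : History S A) (m : ℕ) : ℝ :=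
  ∑ q ∈ D.liveSteps θs ω, D.trueVarAt θs ω m q.1 q.2

open Classical in
/-- The indicator of the live steps. -/
def liveWeight (D : Input d S A) (θs : EuclideanSpace ℝ (Fin d)) :
    ℕ → Set (EuclideanSpace ℝ (Fin d)) → Trajectory S A → ℕ → ℝ :=
  fun _ Θ τ h => if D.Live θs Θ τ h then 1 else 0

variable {D : Input d S A} {P : S → A → PMF S} {θs : EuclideanSpace ℝ (Fin d)} {ω : History S A}

open Classical in
lemma sum_liveSteps (f : ℕ → ℕ → ℝ) : ∑ q ∈ D.liveSteps θs ω, f q.1 q.2 =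
    ∑ k ∈ Finset.Icc 1 D.K, ∑ h ∈ Finset.Icc 1 D.H,
      if D.Live θs (D.confSet ω (k - 1)) (ω k) h then f k h else 0 := by
  unfold liveSteps
  rw [Finset.sum_filter, Finset.sum_product]

lemma freedmanSum_liveWeight (hv : ∀ v ∈ Finset.Icc 1 D.K, Valid θs (D.confSet ω (v - 1)))
    (m : ℕ) (l : ℝ) : D.freedmanSum θs m (D.liveWeight θs) l ω =
      l * D.sumEps θs ω m - l ^ 2 * D.sumTrueVar θs ω m := by
  classical
  rw [sumEps, sumTrueVar, sum_liveSteps (f := fun k h => D.epsAt (D.confSet ω) ω m k h θs),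
    sum_liveSteps, freedmanSum]
  simp only [Finset.mul_sum]
  rw [← Finset.sum_sub_distrib]
  refine Finset.sum_congr rfl fun k hk => ?_
  rw [← Finset.sum_sub_distrib]
  refine Finset.sum_congr rfl fun h _ => ?_
  rw [if_pos (hv k hk).mem, liveWeight]
  split_ifs <;> ring

lemma epsAt_eq (m k h : ℕ) : D.epsAt (D.confSet ω) ω m k h θs =
    dot θs (D.xAt (D.confSet ω) ω m k h) - D.valueAt ω k (h + 1) ^ 2 ^ m := by
  rw [epsAt, valueAt, Nat.add_sub_add_right]

lemma valueAt_last (k : ℕ) : D.valueAt ω k (D.H + 1) = 0 := by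
  rw [valueAt, Nat.sub_self, planValue]

/-- A telescoping sum over the live steps. -/
lemma abs_sum_liveSteps_sub_le {f : ℕ → ℕ → ℝ}
    (h0 : ∀ k ∈ Finset.Icc 1 D.K, ∀ h, 0 ≤ f k h) (h1 : ∀ k ∈ Finset.Icc 1 D.K, ∀ h, f k h ≤ 1)
    (hf : ∀ k ∈ Finset.Icc 1 D.K, f k (D.H + 1) = 0) :
    |∑ k ∈ Finset.Icc 1 D.K, f k 1 - ∑ q ∈ D.liveSteps θs ω, (f q.1 q.2 - f q.1 (q.2 + 1))| ≤
      (D.cutEpisodes θs ω).card := by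
  classical
  rw [sum_liveSteps (f := fun k h => f k h - f k (h + 1)), ← Finset.sum_sub_distrib]
  refine (Finset.abs_sum_le_sum_abs _ _).trans ?_
  unfold cutEpisodes
  rw [Finset.card_filter]
  push_cast
  refine Finset.sum_le_sum fun k hk => ?_
  have := sum_filter_sub_le (f := f k) (I := D.Live θs (D.confSet ω (k - 1)) (ω k))
    (fun n hn => hn.mono (Nat.le_succ n)) (h0 k hk) (h1 k hk) D.H
  split_ifs with hl
  · rw [this.2 (not_not.1 (by simpa using hl)), hf k hk]; simp
  · exact this.1

lemma valueAt_nonneg [Nonempty A] (hM : D.Realizes P θs)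
    (hv : ∀ v ∈ Finset.Icc 1 D.K, Valid θs (D.confSet ω (v - 1))) {k : ℕ}
    (hk : k ∈ Finset.Icc 1 D.K) (h : ℕ) : 0 ≤ D.valueAt ω k h :=
  hM.planValue_nonneg (hv k hk) _ _

lemma valueAt_le_one [Nonempty A] (hM : D.Realizes P θs)
    (hv : ∀ v ∈ Finset.Icc 1 D.K, Valid θs (D.confSet ω (v - 1))) {k : ℕ}
    (hk : k ∈ Finset.Icc 1 D.K) (h : ℕ) : D.valueAt ω k h ≤ 1 :=
  hM.planValue_le_one (hv k hk) _ _

lemma valueAt_le [Nonempty A] (hM : D.Realizes P θs)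
    (hv : ∀ v ∈ Finset.Icc 1 D.K, Valid θs (D.confSet ω (v - 1))) (hω : D.Typical ω) {k h : ℕ}
    (hk : k ∈ Finset.Icc 1 D.K) (hh : h ∈ Finset.Icc 1 D.H) :
    D.valueAt ω k h ≤ dot θs (D.xAt (D.confSet ω) ω 0 k h) +
      (D.reward (ω k h).1 (ω k h).2 + D.widthAt θs ω 0 k h) := by
  rw [valueAt, planValue_eq_planQ hh (hω.greedy k hk h hh)]
  have := hM.planQ_le (hv k hk) h (ω k h).1 (ω k h).2
  unfold xAt widthAt
  linarith

lemma sum_reward_liveSteps_le (hM : D.Realizes P θs) : ∑ q ∈ D.liveSteps θs ω,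
    D.reward (ω q.1 q.2).1 (ω q.1 q.2).2 ≤ ∑ k ∈ Finset.Icc 1 D.K, ∑ h ∈ Finset.Icc 1 D.H,
      D.reward (ω k h).1 (ω k h).2 := by
  classical
  rw [← Finset.sum_product']
  exact Finset.sum_le_sum_of_subset_of_nonneg (fun q hq => (mem_liveSteps.1 hq).1)
    fun _ _ _ => hM.reward_nonneg _ _

/-- The planned values of the initial states exceed the rewards only by widths, prediction errors
and the number of truncated episodes. -/
lemma sum_valueAt_le [Nonempty A] (hM : D.Realizes P θs)
    (hv : ∀ v ∈ Finset.Icc 1 D.K, Valid θs (D.confSet ω (v - 1))) (hω : D.Typical ω) :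
    ∑ k ∈ Finset.Icc 1 D.K, D.valueAt ω k 1 ≤ ∑ k ∈ Finset.Icc 1 D.K, ∑ h ∈ Finset.Icc 1 D.H,
      D.reward (ω k h).1 (ω k h).2 + D.sumWidth θs ω 0 + D.sumEps θs ω 0 +
        (D.cutEpisodes θs ω).card := by
  have h1 := (abs_le.1 (abs_sum_liveSteps_sub_le (θs := θs) (ω := ω) (f := D.valueAt ω)
    (fun k hk => valueAt_nonneg hM hv hk) (fun k hk => valueAt_le_one hM hv hk)
    fun k _ => valueAt_last k)).2
  have h2 : ∑ q ∈ D.liveSteps θs ω, (D.valueAt ω q.1 q.2 - D.valueAt ω q.1 (q.2 + 1)) ≤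
      ∑ q ∈ D.liveSteps θs ω, (D.reward (ω q.1 q.2).1 (ω q.1 q.2).2 +
        D.widthAt θs ω 0 q.1 q.2 + D.epsAt (D.confSet ω) ω 0 q.1 q.2 θs) := by
    refine Finset.sum_le_sum fun q hq => ?_
    obtain ⟨hk, hh⟩ := Finset.mem_product.1 (mem_liveSteps.1 hq).1
    have := valueAt_le hM hv hω hk hh
    rw [epsAt_eq, pow_zero, pow_one]
    linarith
  rw [Finset.sum_add_distrib, Finset.sum_add_distrib] at h2
  have h3 := sum_reward_liveSteps_le (θs := θs) (ω := ω) hM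
  unfold sumWidth sumEps
  linarith

/-- The variances of the powers `2 ^ m` are controlled by the prediction errors of the powers
`2 ^ (m + 1)`, since the values telescope along an episode. -/
lemma sumTrueVar_le [Nonempty A] (hM : D.Realizes P θs)
    (hv : ∀ v ∈ Finset.Icc 1 D.K, Valid θs (D.confSet ω (v - 1))) (hω : D.Typical ω) (m : ℕ) :
    D.sumTrueVar θs ω m ≤ D.sumEps θs ω (m + 1) + (D.cutEpisodes θs ω).card +
      2 ^ (m + 1) * (D.K + D.sumWidth θs ω 0) := by
  have h1 := (abs_le.1 (abs_sum_liveSteps_sub_le (θs := θs) (ω := ω)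
    (f := fun k h => D.valueAt ω k h ^ 2 ^ (m + 1))
    (fun k hk h => pow_nonneg (valueAt_nonneg hM hv hk h) _)
    (fun k hk h => pow_le_one₀ (valueAt_nonneg hM hv hk h) (valueAt_le_one hM hv hk h))
    fun k _ => by rw [valueAt_last, zero_pow (by positivity)])).2
  have h0 : 0 ≤ ∑ k ∈ Finset.Icc 1 D.K, D.valueAt ω k 1 ^ 2 ^ (m + 1) :=
    Finset.sum_nonneg fun k hk => pow_nonneg (valueAt_nonneg hM hv hk _) _
  have h2 : D.sumTrueVar θs ω m ≤ ∑ q ∈ D.liveSteps θs ω,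
      (D.epsAt (D.confSet ω) ω (m + 1) q.1 q.2 θs -
        (D.valueAt ω q.1 q.2 ^ 2 ^ (m + 1) - D.valueAt ω q.1 (q.2 + 1) ^ 2 ^ (m + 1)) +
        2 ^ (m + 1) * (D.reward (ω q.1 q.2).1 (ω q.1 q.2).2 + D.widthAt θs ω 0 q.1 q.2)) := by
    refine Finset.sum_le_sum fun q hq => ?_
    obtain ⟨hk, hh⟩ := Finset.mem_product.1 (mem_liveSteps.1 hq).1
    have hΘ := hv _ hk
    have h3 := valueAt_le hM hv hω hk hh
    have h4 := pow_sub_pow_le (valueAt_nonneg hM hv hk _) (valueAt_le_one hM hv hk _)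
      (hM.dot_feature_nonneg hΘ 0 q.2 _ _) (hM.dot_feature_le_one hΘ 0 q.2 _ _)
      (add_nonneg (hM.reward_nonneg _ _) (hM.width_nonneg hΘ _ _ _ _)) h3 (2 ^ (m + 1))
    have h5 : dot θs (D.xAt (D.confSet ω) ω 0 q.1 q.2) ^ 2 ^ (m + 1) ≤
        dot θs (D.xAt (D.confSet ω) ω m q.1 q.2) ^ 2 := by
      unfold xAt
      rw [pow_succ, pow_mul, hM.dot_feature hΘ, hM.dot_feature hΘ]
      refine pow_le_pow_left₀ (pow_nonneg (expect_nonneg _ (hM.planValue_pow_nonneg hΘ _ _)) _) ?_ 2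
      simp only [pow_zero, pow_one]
      exact pow_two_pow_expect_le _ (hM.planValue_nonneg hΘ _) (hM.planValue_le_one hΘ _) m
    rw [epsAt_eq]
    unfold trueVarAt trueVar
    push_cast at h4
    unfold xAt at h5 ⊢
    unfold widthAt
    linarith
  rw [Finset.sum_add_distrib, Finset.sum_sub_distrib, ← Finset.mul_sum,
    Finset.sum_add_distrib] at h2
  have h6 : ∑ q ∈ D.liveSteps θs ω, D.reward (ω q.1 q.2).1 (ω q.1 q.2).2 ≤ D.K := by
    refine (sum_reward_liveSteps_le hM).trans ((Finset.sum_le_card_nsmul _ _ 1 fun k hk =>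
      hω.reward_le k hk).trans ?_)
    simp
  have h7 : (2 : ℝ) ^ (m + 1) * (∑ q ∈ D.liveSteps θs ω, D.reward (ω q.1 q.2).1 (ω q.1 q.2).2 +
      D.sumWidth θs ω 0) ≤ 2 ^ (m + 1) * (D.K + D.sumWidth θs ω 0) := by gcongr
  unfold sumEps
  unfold sumWidth at h7 ⊢
  linarith

lemma sumEta_le [Nonempty A] (hM : D.Realizes P θs)
    (hv : ∀ v ∈ Finset.Icc 1 D.K, Valid θs (D.confSet ω (v - 1))) (m : ℕ) :
    D.sumEta θs ω m ≤ D.sumTrueVar θs ω m + D.sumWidth θs ω (m + 1) + 2 * D.sumWidth θs ω m := by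
  unfold sumEta sumTrueVar sumWidth
  rw [Finset.mul_sum, ← Finset.sum_add_distrib, ← Finset.sum_add_distrib]
  exact Finset.sum_le_sum fun _ hq =>
    hM.varEst_le_trueVar_add (valid_of_mem_liveSteps hv hq) _ _ _ _

lemma sumTrueVar_le_sumEta [Nonempty A] (hM : D.Realizes P θs)
    (hv : ∀ v ∈ Finset.Icc 1 D.K, Valid θs (D.confSet ω (v - 1))) (m : ℕ) :
    D.sumTrueVar θs ω m ≤ D.sumEta θs ω m :=
  Finset.sum_le_sum fun _ hq => hM.trueVar_le_varEst (valid_of_mem_liveSteps hv hq) _ _ _ _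

/-- At the last level, `2 ^ L₀` is of the order of the horizon. -/
lemma sumEta_le_trivial [Nonempty A] (hM : D.Realizes P θs)
    (hv : ∀ v ∈ Finset.Icc 1 D.K, Valid θs (D.confSet ω (v - 1))) :
    D.sumEta θs ω D.L₀ ≤ 2 ^ D.L₀ * (2 * √d * D.K) := by
  have h1 : D.sumEta θs ω D.L₀ ≤ (D.liveSteps θs ω).card * √d := by
    rw [← nsmul_eq_mul]
    exact Finset.sum_le_card_nsmul _ _ _ fun q hq =>
      hM.varEst_le (valid_of_mem_liveSteps hv hq) _ _ _ _
  have h2 : ((D.liveSteps θs ω).card : ℝ) ≤ D.H * D.K := by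
    exact_mod_cast card_liveSteps_le
  have h3 : (D.H : ℝ) ≤ 2 ^ D.L₀ * 2 := by
    rw [← pow_succ]
    exact (lt_two_pow_logCeil D.H).le
  calc _ ≤ _ := h1
    _ ≤ (2 ^ D.L₀ * 2 * D.K) * √d := by gcongr; exact h2.trans (by gcongr)
    _ = _ := by ring

/-- The event on which the regret is small: besides the confidence sets, it controls the prediction
errors on the live steps and the rewards. The scale `l` is the optimal one for the number of
episodes. -/
structure RegretEvent (D : Input d S A) (P : S → A → PMF S) (θs : EuclideanSpace ℝ (Fin d))
    (alg : Learner S A) (l : ℝ) (ω : History S A) : Prop where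
  conf : D.ConfEvent θs ω
  eps : ∀ m ∈ Finset.range (D.L₀ + 1), D.freedmanSum θs m (D.liveWeight θs) (1 / 16) ω ≤ 2 * D.ι
  eps_zero : D.freedmanSum θs 0 (D.liveWeight θs) l ω ≤ 2 * D.ι
  reward : ∑ k ∈ Finset.Icc 1 D.K, (l * (∑ h ∈ Finset.Icc 1 D.H, D.reward (ω k h).1 (ω k h).2 -
    policyValue P D.reward (alg.policy k ω) D.H 1 (ω k 1).1) - l ^ 2) ≤ 2 * D.ι

/-- The sum of the widths is at most
`widthSlope * √(sum of the variance estimates) + widthOffset`. -/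
def widthSlope (D : Input d S A) : ℝ := (D.layers.card * D.L' : ℕ) * √D.classConst

/-- The additive term in the bound of the widths. -/
def widthOffset (D : Input d S A) : ℝ :=
  5 + (D.layers.card * D.L' : ℕ) * (3 * d * D.classConst)

lemma widthSlope_nonneg : 0 ≤ D.widthSlope := by unfold widthSlope; positivity

lemma widthOffset_nonneg (hd : 1 ≤ d) (hι : 1 ≤ D.ι) : 0 ≤ D.widthOffset := by
  have := classConst_nonneg hd hι
  unfold widthOffset
  positivity

/-- The bound on the number of truncated episodes. -/
def cutBound (D : Input d S A) : ℝ := D.classes.card * (5 * D.binSize)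

/-- The planned values exceed the values of the policies by little in total. -/
lemma RegretEvent.sum_valueAt_sub_le [Nonempty A] {alg : Learner S A} {l : ℝ}
    (hE : D.RegretEvent P θs alg l ω) (hM : D.Realizes P θs) (hω : D.Typical ω) (hd : 1 ≤ d)
    (hN : 2 ≤ D.H * D.K) (hι : 4 * ((d : ℝ) + 3) ≤ D.ι) (hl0 : 0 < l) (hl1 : l ≤ 1)
    (hl : l * D.K ≤ √(D.ι * D.K)) (hl' : D.ι / l ≤ D.ι + √(D.ι * D.K)) :
    ∑ k ∈ Finset.Icc 1 D.K, (D.valueAt ω k 1 -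
      policyValue P D.reward (alg.policy k ω) D.H 1 (ω k 1).1) ≤
      400 * (D.ι + D.cutBound + D.widthSlope ^ 2 + D.widthOffset) +
        20 * (D.widthSlope * √(√d * D.K) + √d * √(D.ι * D.K)) := by
  have hN0 : D.H * D.K ≠ 0 := by omega
  have hι1 : 1 ≤ D.ι := by
    have : (0 : ℝ) ≤ d := Nat.cast_nonneg d
    linarith
  have hd1 : (1 : ℝ) ≤ d := by exact_mod_cast hd
  have hv : ∀ v ∈ Finset.Icc 1 D.K, Valid θs (D.confSet ω (v - 1)) := fun v hvk =>
    hE.conf.valid hM (by omega) hN0 hι hvk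
  have hNpos : (0 : ℝ) < (D.H * D.K : ℕ) := by exact_mod_cast Nat.pos_of_ne_zero hN0
  have hball : ∀ v ∈ Finset.Icc 1 D.K, ∀ θ : EuclideanSpace ℝ (Fin d), ‖θ‖ ≤ 1 →
      (1 - 1 / ((D.H * D.K : ℕ) : ℝ)) • θs + (1 / ((D.H * D.K : ℕ) : ℝ)) • θ ∈
        D.confSet ω (v - 1) := fun v hvk θ hθ => by
    have := Finset.mem_Icc.1 hvk
    exact hE.conf.ball_subset hM (by omega) hN0 hι (v - 1) (by omega) θ hθ _ (by positivity) le_rfl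
  have hT : ((D.cutEpisodes θs ω).card : ℝ) ≤ D.cutBound :=
    card_cutEpisodes_le hM hd hN0 hι1 hv
  have hT0 : 0 ≤ D.cutBound := (Nat.cast_nonneg _).trans hT
  have hΓ0 := widthOffset_nonneg (D := D) hd hι1
  have hΛ0 := widthSlope_nonneg (D := D)
  have hR0 := sumWidth_nonneg (m := 0) hM hv
  have hE0 := sumEta_nonneg hM hv
  have hRE : ∀ m ≤ D.L₀, D.sumWidth θs ω m ≤
      D.widthSlope * √(D.sumEta θs ω m) + D.widthOffset := fun m hm => by
    refine (sumWidth_le hM hd hN hι1 hv hball (Finset.mem_range.2 (by omega))).trans (le_of_eq ?_)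
    rw [Real.sqrt_mul (classConst_nonneg hd hι1), widthSlope, widthOffset]
    ring
  have hV0 := sumTrueVar_le_sumEta (ω := ω) hM hv
  have hrec : ∀ m < D.L₀, D.sumEta θs ω m ≤ D.sumEta θs ω (m + 1) / 16 +
      (32 * D.ι + D.cutBound) + 2 ^ (m + 1) * (D.K + D.sumWidth θs ω 0) + D.sumWidth θs ω (m + 1) +
        2 * D.sumWidth θs ω m := fun m hm => by
    have h1 := sumEta_le (ω := ω) hM hv m
    have h2 := sumTrueVar_le hM hv hω m
    have h3 := hE.eps (m + 1) (Finset.mem_range.2 (by omega))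
    rw [freedmanSum_liveWeight hv] at h3
    have h4 := hV0 (m + 1)
    linarith
  have hmain := recursion_bound (A := 2 * √d * D.K) (G := 32 * D.ι + D.cutBound) hE0 hR0 hΓ0
    (by positivity) (Nat.cast_nonneg D.K) (by positivity) hRE hrec (sumEta_le_trivial hM hv)
  have hsd : 1 ≤ √(d : ℝ) := Real.one_le_sqrt.2 hd1
  have hKd : (D.K : ℝ) ≤ √d * D.K := le_mul_of_one_le_left (Nat.cast_nonneg _) hsd
  have h0 := hRE 0 (Nat.zero_le _)
  have h1 := sum_valueAt_le hM hv hω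
  have h2 := hE.eps_zero
  rw [freedmanSum_liveWeight hv] at h2
  have h3 := hV0 0
  have h4 := hE.reward
  rw [Finset.sum_sub_distrib, ← Finset.mul_sum, Finset.sum_sub_distrib, Finset.sum_const,
    Nat.card_Icc, nsmul_eq_mul, Nat.add_sub_cancel] at h4
  rw [Finset.sum_sub_distrib]
  set X := D.ι + D.cutBound + D.widthSlope ^ 2 + D.widthOffset with hX
  have hX0 : 0 ≤ X := by positivity
  have hEX : D.sumEta θs ω 0 ≤ 128 * X + 12 * (√d * D.K) := by
    rw [hX]; nlinarith [sq_nonneg D.widthSlope]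
  have hsq : √(D.sumEta θs ω 0) ≤ 12 * √X + 4 * √(√d * D.K) := by
    rw [Real.sqrt_le_left (by positivity)]
    have e1 : √X ^ 2 = X := Real.sq_sqrt hX0
    have e2 : √(√d * D.K) ^ 2 = √d * D.K := Real.sq_sqrt (by positivity)
    have e3 : 0 ≤ √X * √(√d * D.K) := by positivity
    nlinarith
  have hΛX : D.widthSlope * √X ≤ X := by
    have e1 : D.widthSlope ≤ √X := Real.le_sqrt_of_sq_le (by rw [hX]; linarith)
    calc _ ≤ √X * √X := by gcongr
      _ = X := Real.mul_self_sqrt hX0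
  have hR : D.sumWidth θs ω 0 ≤ 12 * X + 4 * (D.widthSlope * √(√d * D.K)) + D.widthOffset := by
    have := mul_le_mul_of_nonneg_left hsq hΛ0
    linarith
  have hlE : l * D.sumEta θs ω 0 ≤ 128 * X + 12 * (√d * √(D.ι * D.K)) := by
    calc l * D.sumEta θs ω 0 ≤ l * (128 * X + 12 * (√d * D.K)) := by gcongr
      _ = l * (128 * X) + 12 * (√d * (l * D.K)) := by ring
      _ ≤ 1 * (128 * X) + 12 * (√d * √(D.ι * D.K)) := by gcongr
      _ = _ := by ring
  have hM0 : D.sumEps θs ω 0 ≤ 2 * (D.ι / l) + l * D.sumEta θs ω 0 := by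
    have h5 : l * D.sumEps θs ω 0 ≤ l * (2 * (D.ι / l) + l * D.sumEta θs ω 0) := by
      have e : l * (2 * (D.ι / l) + l * D.sumEta θs ω 0) = 2 * D.ι + l ^ 2 * D.sumEta θs ω 0 := by
        field_simp
      rw [e]
      have : l ^ 2 * D.sumTrueVar θs ω 0 ≤ l ^ 2 * D.sumEta θs ω 0 := by gcongr
      linarith
    exact le_of_mul_le_mul_left h5 hl0
  have hZ : ∑ k ∈ Finset.Icc 1 D.K, ∑ h ∈ Finset.Icc 1 D.H, D.reward (ω k h).1 (ω k h).2 -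
      ∑ k ∈ Finset.Icc 1 D.K, policyValue P D.reward (alg.policy k ω) D.H 1 (ω k 1).1 ≤
        2 * (D.ι / l) + l * D.K := by
    refine le_of_mul_le_mul_left (?_ : l * _ ≤ l * _) hl0
    have e : l * (2 * (D.ι / l) + l * D.K) = 2 * D.ι + D.K * l ^ 2 := by field_simp
    rw [e]
    linarith
  have hsι : √(D.ι * D.K) ≤ √d * √(D.ι * D.K) := le_mul_of_one_le_left (Real.sqrt_nonneg _) hsd
  have hXι : D.ι + D.cutBound + D.widthOffset ≤ X := by
    rw [hX]; linarith [sq_nonneg D.widthSlope]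
  have hs0 : 0 ≤ D.widthSlope * √(√d * D.K) := by positivity
  have hs1 := Real.sqrt_nonneg (D.ι * D.K)
  linarith

end Input

/-! ### The probability of the good event -/

lemma toOuterMeasure_biUnion_le {X I : Type*} (p : PMF X) (s : Finset I) {f : I → Set X}
    {c : ENNReal} (h : ∀ i ∈ s, p.toOuterMeasure (f i) ≤ c) :
    p.toOuterMeasure (⋃ i ∈ s, f i) ≤ s.card * c := by
  refine (MeasureTheory.measure_biUnion_finset_le s f).trans ?_
  rw [← nsmul_eq_mul]
  exact Finset.sum_le_card_nsmul _ _ _ h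

lemma logCeil_le {n : ℕ} (hn : n ≠ 0) : logCeil n ≤ n :=
  Nat.log_lt_self 2 hn

namespace Input

variable {d : ℕ} {S A : Type*} {D : Input d S A} {P : S → A → PMF S}
  {θs : EuclideanSpace ℝ (Fin d)} {ω : History S A}

lemma exp_neg_iota (hδ : 0 < D.δ) (hN : D.H * D.K ≠ 0) : Real.exp (-(2 * D.ι)) =
    (D.δ / ((2 * (D.H * D.K) : ℕ) : ℝ) ^ (2 * (d + 3))) ^ 4 := by
  have hNpos : (0 : ℝ) < ((2 * (D.H * D.K) : ℕ) : ℝ) := by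
    exact_mod_cast Nat.pos_of_ne_zero (mul_ne_zero two_ne_zero hN)
  have e : 2 * (D.H : ℝ) * D.K = ((2 * (D.H * D.K) : ℕ) : ℝ) := by push_cast; ring
  rw [ι, e]
  set X := ((2 * (D.H * D.K) : ℕ) : ℝ) ^ (2 * (d + 3))
  have hX : 0 < X := by positivity
  rw [show -(2 * (2 * Real.log (X / D.δ))) = (4 : ℕ) * Real.log (D.δ / X) by
    rw [Real.log_div hX.ne' hδ.ne', Real.log_div hδ.ne' hX.ne']; push_cast; ring,
    Real.exp_nat_mul, Real.exp_log (by positivity)]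

lemma iota_eq (hδ : 0 < D.δ) (hN : D.H * D.K ≠ 0) : D.ι =
    4 * ((d : ℝ) + 3) * Real.log ((2 * (D.H * D.K) : ℕ) : ℝ) + 2 * Real.log (1 / D.δ) := by
  have hNpos : (0 : ℝ) < ((2 * (D.H * D.K) : ℕ) : ℝ) := by
    exact_mod_cast Nat.pos_of_ne_zero (mul_ne_zero two_ne_zero hN)
  have e : 2 * (D.H : ℝ) * D.K = ((2 * (D.H * D.K) : ℕ) : ℝ) := by push_cast; ring
  rw [ι, e, Real.log_div (by positivity) hδ.ne', Real.log_pow, one_div, Real.log_inv]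
  push_cast
  ring

lemma one_le_log_two_mul (hN : 3 ≤ D.H * D.K) :
    1 ≤ Real.log ((2 * (D.H * D.K) : ℕ) : ℝ) := by
  have h6 : (6 : ℝ) ≤ ((2 * (D.H * D.K) : ℕ) : ℝ) := by
    exact_mod_cast (by omega : 6 ≤ 2 * (D.H * D.K))
  rw [Real.le_log_iff_exp_le (by linarith)]
  linarith [Real.exp_one_lt_d9]

lemma four_mul_le_iota (hδ : 0 < D.δ) (hδ1 : D.δ ≤ 1) (hN : 3 ≤ D.H * D.K) :
    4 * ((d : ℝ) + 3) ≤ D.ι := by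
  have h1 := one_le_log_two_mul hN
  have h2 : 0 ≤ Real.log (1 / D.δ) := Real.log_nonneg (one_le_one_div hδ hδ1)
  have h3 : (0 : ℝ) ≤ d := Nat.cast_nonneg d
  rw [iota_eq hδ (by omega)]
  nlinarith

/-- The indices of the inequalities that make up the event for the confidence sets. -/
def confIndex (D : Input d S A) : Finset (ℕ × ℕ × ℤ × ℕ × (Fin d → ℤ) × ℕ × ℝ) :=
  Finset.range D.K ×ˢ Finset.range (D.L₀ + 1) ×ˢ D.layers ×ˢ Finset.Icc 1 D.L' ×ˢ
    gridBox d (D.H * D.K) ×ˢ Finset.range (logCeil (D.H * D.K) + 1) ×ˢ {1, -1}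

lemma card_layers (D : Input d S A) :
    D.layers.card = logCeil (d * (D.H * D.K) ^ 3) + logCeil d := by
  rw [layers, Int.card_Ioc]
  omega

lemma card_gridBox (d n : ℕ) : (gridBox d n).card = (512 * n ^ 2 + 1) ^ d := by
  rw [gridBox, Fintype.card_piFinset_const, Int.card_Icc]
  congr 1
  omega

lemma L₀_lt (hN : D.H * D.K ≠ 0) : D.L₀ + 1 ≤ D.H * D.K := by
  have hH : D.H ≠ 0 := fun h => hN (by rw [h, zero_mul])
  have hK : D.K ≠ 0 := fun h => hN (by rw [h, mul_zero])
  exact (logCeil_le hH).trans (Nat.le_mul_of_pos_right _ (Nat.pos_of_ne_zero hK))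

/-- The size of the net, of order `(HK) ^ (2 d)`, dominates the number of inequalities. -/
lemma card_confIndex_le (hd : 1 ≤ d) (hN : 3 ≤ D.H * D.K) :
    D.confIndex.card ≤ (2 * (D.H * D.K)) ^ (6 * d + 8) := by
  have hH : 1 ≤ D.H := Nat.one_le_iff_ne_zero.2 fun h => by rw [h, zero_mul] at hN; omega
  have hKN : D.K ≤ D.H * D.K := Nat.le_mul_of_pos_left _ hH
  have hL₀ := L₀_lt (D := D) (by omega)
  have hL' : D.L' ≤ D.H * D.K := logCeil_le (n := D.H * D.K) (by omega)
  have hlog : logCeil (D.H * D.K) ≤ D.H * D.K := logCeil_le (by omega)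
  have hlay := card_layers D
  have hlay1 : logCeil d ≤ d := logCeil_le (by omega)
  have hlay2 : logCeil (d * (D.H * D.K) ^ 3) ≤ d * (D.H * D.K) ^ 3 :=
    logCeil_le (mul_ne_zero (by omega) (pow_ne_zero 3 (by omega)))
  unfold confIndex
  rw [Finset.card_product, Finset.card_product, Finset.card_product, Finset.card_product,
    Finset.card_product, Finset.card_product, Finset.card_range, Finset.card_range,
    Finset.card_range, Nat.card_Icc, card_gridBox]
  generalize D.H * D.K = n at *
  set M := 2 * n with hM
  have hdM : d ≤ M ^ d := (Nat.lt_pow_self (by omega)).le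
  have h1 : D.layers.card ≤ M ^ d * M ^ 3 := by
    have h2 : d ≤ d * n ^ 3 := Nat.le_mul_of_pos_right _ (by positivity)
    calc D.layers.card ≤ d * (2 * n ^ 3) := by rw [hlay]; linarith
      _ ≤ M ^ d * M ^ 3 := by
          refine Nat.mul_le_mul hdM ?_
          rw [hM, mul_pow]
          exact Nat.mul_le_mul_right _ (by norm_num)
  have h2 : (512 * n ^ 2 + 1) ^ d ≤ (M ^ 5) ^ d := by
    refine Nat.pow_le_pow_left ?_ d
    have h3 : 3 ^ 3 ≤ n ^ 3 := Nat.pow_le_pow_left hN 3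
    have h4 : 1 ≤ n ^ 2 := Nat.one_le_pow _ _ (by omega)
    calc 512 * n ^ 2 + 1 ≤ 32 * 3 ^ 3 * n ^ 2 := by omega
      _ ≤ 32 * n ^ 3 * n ^ 2 := by gcongr
      _ = M ^ 5 := by rw [hM]; ring
  have h3 : ({1, -1} : Finset ℝ).card ≤ M := Finset.card_le_two.trans (by omega)
  calc D.K * ((D.L₀ + 1) * (D.layers.card * ((D.L' + 1 - 1) * ((512 * n ^ 2 + 1) ^ d *
        ((logCeil n + 1) * ({1, -1} : Finset ℝ).card)))))
      ≤ M * (M * ((M ^ d * M ^ 3) * (M * ((M ^ 5) ^ d * (M * M))))) := by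
        gcongr <;> omega
    _ = M ^ (6 * d + 8) := by rw [← pow_mul]; ring

/-- The number of inequalities is small enough for the union bound. -/
lemma count_mul_exp_le (hd : 1 ≤ d) (hN : 3 ≤ D.H * D.K) (hδ : 0 < D.δ) (hδ1 : D.δ ≤ 1) :
    ((D.confIndex.card + (D.L₀ + 1) + (D.L₀ + 1) + 1 + 1 : ℕ) : ℝ) *
      Real.exp (-(2 * D.ι)) ≤ D.δ := by
  rw [exp_neg_iota hδ (by omega)]
  have h1 := card_confIndex_le hd hN
  have h2 := L₀_lt (D := D) (by omega)
  have h3 : D.confIndex.card + (D.L₀ + 1) + (D.L₀ + 1) + 1 + 1 ≤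
      ((2 * (D.H * D.K)) ^ (2 * (d + 3))) ^ 4 := by
    generalize D.H * D.K = n at *
    set M := 2 * n with hM
    have h4 : M ≤ M ^ (6 * d + 8) := Nat.le_self_pow (by omega) M
    calc D.confIndex.card + (D.L₀ + 1) + (D.L₀ + 1) + 1 + 1
        ≤ M ^ (6 * d + 8) * M := by nlinarith
      _ = M ^ (6 * d + 9) := by rw [← pow_succ]
      _ ≤ M ^ (2 * (d + 3) * 4) := Nat.pow_le_pow_right (by omega) (by omega)
      _ = _ := by rw [pow_mul]
  have h3' : ((D.confIndex.card + (D.L₀ + 1) + (D.L₀ + 1) + 1 + 1 : ℕ) : ℝ) ≤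
      (((2 * (D.H * D.K) : ℕ) : ℝ) ^ (2 * (d + 3))) ^ 4 := by exact_mod_cast h3
  have hpos : (0 : ℝ) < (((2 * (D.H * D.K) : ℕ) : ℝ) ^ (2 * (d + 3))) ^ 4 := by
    have : (0 : ℝ) < ((2 * (D.H * D.K) : ℕ) : ℝ) := by
      exact_mod_cast (by omega : 0 < 2 * (D.H * D.K))
    positivity
  rw [div_pow, mul_div_assoc', div_le_iff₀ hpos]
  have h5 : D.δ ^ 4 ≤ D.δ := pow_le_of_le_one hδ.le hδ1 (by norm_num)
  calc _ ≤ (((2 * (D.H * D.K) : ℕ) : ℝ) ^ (2 * (d + 3))) ^ 4 * D.δ := by gcongr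
    _ = _ := mul_comm _ _

lemma confWeight_past (k₀ m : ℕ) (i : ℤ) (ℓ : ℕ) (μ : EuclideanSpace ℝ (Fin d)) (σ : ℝ) (k : ℕ)
    (Θ : Set (EuclideanSpace ℝ (Fin d))) (τ τ' : Trajectory S A) (h : ℕ)
    (hτ : ∀ u ≤ h, τ u = τ' u) :
    D.confWeight k₀ m i ℓ μ σ k Θ τ h = D.confWeight k₀ m i ℓ μ σ k Θ τ' h := by
  unfold confWeight
  rw [hτ h le_rfl]

lemma abs_confWeight_le_one (k₀ m : ℕ) (i : ℤ) (ℓ : ℕ) (μ : EuclideanSpace ℝ (Fin d)) {σ : ℝ}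
    (hσ : |σ| ≤ 1) (k : ℕ) (Θ : Set (EuclideanSpace ℝ (Fin d))) (τ : Trajectory S A) (h : ℕ) :
    |D.confWeight k₀ m i ℓ μ σ k Θ τ h| ≤ 1 := by
  unfold confWeight
  split_ifs
  · rw [abs_mul]
    exact mul_le_one₀ hσ (abs_nonneg _) (abs_unitClip_le_one _ _)
  · simp

lemma liveWeight_past (k : ℕ) (Θ : Set (EuclideanSpace ℝ (Fin d))) (τ τ' : Trajectory S A) (h : ℕ)
    (hτ : ∀ u ≤ h, τ u = τ' u) : D.liveWeight θs k Θ τ h = D.liveWeight θs k Θ τ' h := by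
  classical
  unfold liveWeight
  simp only [D.live_congr θs Θ hτ]

lemma abs_liveWeight_le_one (k : ℕ) (Θ : Set (EuclideanSpace ℝ (Fin d))) (τ : Trajectory S A)
    (h : ℕ) : |D.liveWeight θs k Θ τ h| ≤ 1 := by
  classical
  unfold liveWeight
  split_ifs <;> simp

/-- Union bound: the good event fails with probability at most `δ`. -/
lemma toOuterMeasure_not_regretEvent_le [Nonempty S] [Nonempty A] (hM : D.Realizes P θs)
    (hd : 1 ≤ d) (hN : 3 ≤ D.H * D.K) (hδ : 0 < D.δ) (hδ1 : D.δ ≤ 1)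
    {init : ℕ → History S A → PMF S} (hinit : ∀ k ∈ Finset.Icc 1 D.K, ∀ ω,
      ∀ s ∈ (init k ω).support, TotalRewardLeOne P D.reward D.H s) {alg : Learner S A}
    (halg : ∀ k ω ω', (∀ v < k, ω v = ω' v) → alg k ω = alg k ω') {l : ℝ} (hl0 : 0 ≤ l)
    (hl1 : l ≤ 1) :
    (historyLaw P D.H init alg D.K).toOuterMeasure {ω | ¬ D.RegretEvent P θs alg l ω} ≤
      ENNReal.ofReal D.δ := by
  have hH : 1 ≤ D.H := Nat.one_le_iff_ne_zero.2 fun h => by rw [h, zero_mul] at hN; omega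
  set μ := (historyLaw P D.H init alg D.K).toOuterMeasure with hμ
  set c := ENNReal.ofReal (Real.exp (-(2 * D.ι))) with hc
  set B₁ := ⋃ g ∈ D.confIndex, {ω : History S A | 2 * D.ι < D.freedmanSum θs g.2.1
    (D.confWeight g.1 g.2.1 g.2.2.1 g.2.2.2.1 (gridPoint (D.H * D.K) g.2.2.2.2.1) g.2.2.2.2.2.2)
    ((2 : ℝ)⁻¹ ^ g.2.2.2.2.2.1) ω} with hB₁
  set B₂ := ⋃ m ∈ Finset.range (D.L₀ + 1), {ω : History S A | 2 * D.ι < D.tinySum θs m ω} with hB₂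
  set B₃ := ⋃ m ∈ Finset.range (D.L₀ + 1), {ω : History S A | 2 * D.ι <
    D.freedmanSum θs m (D.liveWeight θs) (1 / 16) ω} with hB₃
  set B₄ := {ω : History S A | 2 * D.ι < D.freedmanSum θs 0 (D.liveWeight θs) l ω} with hB₄
  set B₅ := {ω : History S A | 2 * D.ι < ∑ k ∈ Finset.Icc 1 D.K, (l * (∑ h ∈ Finset.Icc 1 D.H,
    D.reward (ω k h).1 (ω k h).2 - policyValue P D.reward (alg.policy k ω) D.H 1 (ω k 1).1) -
      l ^ 2)} with hB₅
  have h₁ : μ B₁ ≤ D.confIndex.card * c := by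
    refine toOuterMeasure_biUnion_le _ _ fun g hg => ?_
    obtain ⟨k₀, m, i, ℓ, z, j, σ⟩ := g
    have hσ : |σ| ≤ 1 := by
      unfold confIndex at hg
      simp only [Finset.mem_product, Finset.mem_insert, Finset.mem_singleton] at hg
      rcases hg.2.2.2.2.2.2 with rfl | rfl <;> simp
    exact hM.freedman hH init alg m (confWeight_past _ _ _ _ _ _)
      (abs_confWeight_le_one _ _ _ _ _ hσ) (by positivity)
      (pow_le_one₀ (by norm_num) (by norm_num)) _
  have h₂ : μ B₂ ≤ (D.L₀ + 1 : ℕ) * c := by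
    rw [← Finset.card_range (D.L₀ + 1)]
    exact toOuterMeasure_biUnion_le _ _ fun m _ => hM.sum_abs_eps_tail hH init alg m _ _
  have h₃ : μ B₃ ≤ (D.L₀ + 1 : ℕ) * c := by
    rw [← Finset.card_range (D.L₀ + 1)]
    exact toOuterMeasure_biUnion_le _ _ fun m _ => hM.freedman hH init alg m liveWeight_past
      abs_liveWeight_le_one (by norm_num) (by norm_num) _
  have h₄ : μ B₄ ≤ c := hM.freedman hH init alg 0 liveWeight_past abs_liveWeight_le_one hl0 hl1 _
  have h₅ : μ B₅ ≤ c := hM.sum_reward_tail init hinit hH halg hl0 hl1 _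
  have hsub : {ω | ¬ D.RegretEvent P θs alg l ω} ⊆ B₁ ∪ B₂ ∪ B₃ ∪ B₄ ∪ B₅ := by
    intro ω hω
    by_contra hn
    simp only [Set.mem_union, not_or] at hn
    obtain ⟨⟨⟨⟨n₁, n₂⟩, n₃⟩, n₄⟩, n₅⟩ := hn
    simp only [hB₁, hB₂, hB₃, Set.mem_iUnion, Set.mem_ofPred_eq, not_exists, not_lt] at n₁ n₂ n₃
    refine hω ⟨⟨fun k₀ hk m hm i hi ℓ hℓ z hz j hj σ hσ => ?_, n₂⟩, n₃, not_lt.1 n₄, not_lt.1 n₅⟩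
    refine n₁ (k₀, m, i, ℓ, z, j, σ) ?_
    unfold confIndex
    simp only [Finset.mem_product]
    exact ⟨hk, hm, hi, hℓ, hz, hj, hσ⟩
  calc μ {ω | ¬ D.RegretEvent P θs alg l ω} ≤ μ (B₁ ∪ B₂ ∪ B₃ ∪ B₄ ∪ B₅) :=
        MeasureTheory.measure_mono hsub
    _ ≤ μ B₁ + μ B₂ + μ B₃ + μ B₄ + μ B₅ := by
        refine (MeasureTheory.measure_union_le _ _).trans (add_le_add ?_ le_rfl)
        refine (MeasureTheory.measure_union_le _ _).trans (add_le_add ?_ le_rfl)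
        refine (MeasureTheory.measure_union_le _ _).trans (add_le_add ?_ le_rfl)
        exact MeasureTheory.measure_union_le _ _
    _ ≤ D.confIndex.card * c + (D.L₀ + 1 : ℕ) * c + (D.L₀ + 1 : ℕ) * c + c + c := by gcongr
    _ = (D.confIndex.card + (D.L₀ + 1) + (D.L₀ + 1) + 1 + 1 : ℕ) * c := by push_cast; ring
    _ = ENNReal.ofReal (((D.confIndex.card + (D.L₀ + 1) + (D.L₀ + 1) + 1 + 1 : ℕ) : ℝ) *
          Real.exp (-(2 * D.ι))) := by
        rw [ENNReal.ofReal_mul (Nat.cast_nonneg _), ENNReal.ofReal_natCast]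
    _ ≤ _ := ENNReal.ofReal_le_ofReal (count_mul_exp_le hd hN hδ hδ1)

/-! ### From the planned values to the regret -/

/-- The Euclidean norm of the weights of a model is at most their `ℓ¹` norm. -/
lemma realizes_of_model {d : ℕ} {S A : Type*} (M : LinearMixtureMDP d S A) (H K : ℕ) (δ : ℝ) :
    Realizes ⟨M.base, M.reward, H, K, δ⟩ M.trans (WithLp.toLp 2 M.θ) where
  trans_eq := M.trans_eq
  norm_le := by
    have h0 : 0 ≤ ∑ i, |M.θ i| := Finset.sum_nonneg fun _ _ => abs_nonneg _
    rw [EuclideanSpace.norm_eq, Real.sqrt_le_left zero_le_one, one_pow]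
    calc ∑ i, ‖(WithLp.toLp 2 M.θ : EuclideanSpace ℝ (Fin d)) i‖ ^ 2
        ≤ (∑ i, |M.θ i|) ^ 2 := by
          simpa using Finset.sum_sq_le_sq_sum_of_nonneg (s := Finset.univ) (f := fun i => |M.θ i|)
            fun i _ => abs_nonneg _
      _ ≤ 1 := pow_le_one₀ h0 M.theta_mem_l1_ball
  reward_nonneg := M.reward_nonneg
  reward_le_one := M.reward_le_one

lemma restLeOne_of_mem_support [Nonempty S] [Nonempty A] {init : ℕ → History S A → PMF S}
    (hH : 1 ≤ D.H) (hinit : ∀ k ∈ Finset.Icc 1 D.K, ∀ ω, ∀ s ∈ (init k ω).support,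
      TotalRewardLeOne P D.reward D.H s) {alg : Learner S A}
    (hω : ω ∈ (historyLaw P D.H init alg D.K).support) {k : ℕ} (hk : k ∈ Finset.Icc 1 D.K) :
    RestLeOne P D.reward D.H 0 (ω k 1).1 := by
  obtain ⟨ω', -, s, hs, h⟩ := exists_of_mem_support_historyLaw hω k hk
  rw [(eq_of_mem_support_runSteps h).2 (by omega)]
  exact (hinit k hk ω' s hs).restLeOne

lemma typical_of_mem_support [Nonempty S] [Nonempty A] {init : ℕ → History S A → PMF S}
    (hinit : ∀ k ∈ Finset.Icc 1 D.K, ∀ ω, ∀ s ∈ (init k ω).support,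
      TotalRewardLeOne P D.reward D.H s) {alg : Learner S A} (halg : D.IsVARLin2 alg)
    (hω : ω ∈ (historyLaw P D.H init alg D.K).support) : D.Typical ω where
  reward_le k hk := by
    obtain ⟨ω', -, s, hs, h⟩ := exists_of_mem_support_historyLaw hω k hk
    exact hinit k hk ω' s hs _ _ h
  greedy k hk h hh a := by
    obtain ⟨ω', hω', s, hs, h'⟩ := exists_of_mem_support_historyLaw hω k hk
    have hh' := Finset.mem_Icc.1 hh
    have := action_of_mem_support_runSteps (f := alg k ω') (fun _ _ => rfl) h' h hh'.1 (by omega)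
    rw [this, halg.past_only k ω' ω hω']
    exact halg.greedy k hk ω h hh _ a

/-- Optimism: the regret is at most the difference of the planned values and the values of the
executed policies. -/
lemma regret_le [Nonempty A] (hM : D.Realizes P θs)
    (hv : ∀ v ∈ Finset.Icc 1 D.K, Valid θs (D.confSet ω (v - 1))) {alg : Learner S A}
    (hrest : ∀ k ∈ Finset.Icc 1 D.K, RestLeOne P D.reward D.H 0 (ω k 1).1) :
    regret P D.reward D.H D.K alg ω ≤ ∑ k ∈ Finset.Icc 1 D.K, (D.valueAt ω k 1 -
      policyValue P D.reward (alg.policy k ω) D.H 1 (ω k 1).1) := by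
  refine Finset.sum_le_sum fun k hk => sub_le_sub_right ?_ _
  have : Nonempty (Policy S A) := ⟨fun _ _ => PMF.pure (Classical.arbitrary A)⟩
  exact ciSup_le fun π => hM.policyValue_le_planValue (hv k hk) π 1 le_rfl (hrest k hk)

/-- The trivial bound: all values lie in `[0, 1]`. -/
lemma regret_le_natCast [Nonempty A] (hM : D.Realizes P θs) {alg : Learner S A}
    (hrest : ∀ k ∈ Finset.Icc 1 D.K, RestLeOne P D.reward D.H 0 (ω k 1).1) :
    regret P D.reward D.H D.K alg ω ≤ D.K := by
  have : Nonempty (Policy S A) := ⟨fun _ _ => PMF.pure (Classical.arbitrary A)⟩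
  refine (Finset.sum_le_card_nsmul _ _ 1 fun k hk => ?_).trans (by simp)
  have h1 : optimalValue P D.reward D.H (ω k 1).1 ≤ 1 := ciSup_le fun π => by
    simpa using (hrest k hk).policyValue_le hM.reward_nonneg hM.reward_le_one π 1
  have h2 := policyValue_nonneg (P := P) hM.reward_nonneg (alg.policy k ω) D.H 1 (ω k 1).1
  linarith

/-- The scale that is optimal for the number of episodes. -/
def scale (D : Input d S A) : ℝ := min 1 √(D.ι / D.K)

lemma scale_pos (hι : 0 < D.ι) (hK : 1 ≤ D.K) : 0 < D.scale := by
  have : (0 : ℝ) < D.K := by exact_mod_cast hK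
  exact lt_min one_pos (Real.sqrt_pos.2 (by positivity))

lemma scale_mul_le (hι : 0 < D.ι) (hK : 1 ≤ D.K) : D.scale * D.K ≤ √(D.ι * D.K) := by
  have hK0 : (0 : ℝ) < D.K := by exact_mod_cast hK
  calc D.scale * D.K ≤ √(D.ι / D.K) * √((D.K : ℝ) ^ 2) := by
        rw [Real.sqrt_sq hK0.le]
        gcongr
        exact min_le_right _ _
    _ = √(D.ι * D.K) := by
        rw [← Real.sqrt_mul (by positivity)]
        congr 1
        field_simp

lemma iota_div_scale_le (hι : 0 < D.ι) (hK : 1 ≤ D.K) :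
    D.ι / D.scale ≤ D.ι + √(D.ι * D.K) := by
  have hK0 : (0 : ℝ) < D.K := by exact_mod_cast hK
  have hs : 0 < √(D.ι / D.K) := Real.sqrt_pos.2 (by positivity)
  rcases min_choice (1 : ℝ) √(D.ι / D.K) with h | h
  · rw [scale, h, div_one]
    linarith [Real.sqrt_nonneg (D.ι * D.K)]
  · rw [scale, h]
    have e : D.ι / √(D.ι / D.K) = √(D.ι * D.K) := by
      rw [div_eq_iff hs.ne', ← Real.sqrt_mul (by positivity)]
      rw [show D.ι * D.K * (D.ι / D.K) = D.ι ^ 2 by field_simp, Real.sqrt_sq hι.le]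
    rw [e]
    linarith

/-- The regret bound in terms of the scales of the argument. -/
lemma toOuterMeasure_regret_ge [Nonempty S] [Nonempty A] (hM : D.Realizes P θs)
    (hd : 1 ≤ d) (hN : 3 ≤ D.H * D.K) (hδ : 0 < D.δ) (hδ1 : D.δ ≤ 1)
    {init : ℕ → History S A → PMF S} (hinit : ∀ k ∈ Finset.Icc 1 D.K, ∀ ω,
      ∀ s ∈ (init k ω).support, TotalRewardLeOne P D.reward D.H s) {alg : Learner S A}
    (halg : D.IsVARLin2 alg) :
    ENNReal.ofReal (1 - D.δ) ≤ (historyLaw P D.H init alg D.K).toOuterMeasure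
      {ω | regret P D.reward D.H D.K alg ω ≤
        400 * (D.ι + D.cutBound + D.widthSlope ^ 2 + D.widthOffset) +
          20 * (D.widthSlope * √(√d * D.K) + √d * √(D.ι * D.K))} := by
  have hH : 1 ≤ D.H := Nat.one_le_iff_ne_zero.2 fun h => by rw [h, zero_mul] at hN; omega
  have hK : 1 ≤ D.K := Nat.one_le_iff_ne_zero.2 fun h => by rw [h, mul_zero] at hN; omega
  have hι := four_mul_le_iota hδ hδ1 hN
  have hι0 : 0 < D.ι := by
    have : (0 : ℝ) ≤ d := Nat.cast_nonneg d
    linarith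
  have hl0 := scale_pos hι0 hK
  have hl1 : D.scale ≤ 1 := min_le_left _ _
  refine one_sub_le_toOuterMeasure _ hδ.le (toOuterMeasure_not_regretEvent_le hM hd hN hδ hδ1 hinit
    halg.past_only hl0.le hl1) fun ω hω hE => ?_
  have hE : D.RegretEvent P θs alg D.scale ω := not_not.1 hE
  refine (regret_le hM (fun v hv => hE.conf.valid hM (by omega) (by omega) hι hv) fun k hk =>
    restLeOne_of_mem_support hH hinit hω hk).trans ?_
  exact hE.sum_valueAt_sub_le hM (typical_of_mem_support hinit halg hω) hd (by omega) hι hl0 hl1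
    (scale_mul_le hι0 hK) (iota_div_scale_le hι0 hK)

end Input

/-! ### The scales in terms of the parameters -/

lemma logCeil_le_log {n : ℕ} (hn : n ≠ 0) : (logCeil n : ℝ) ≤ 2 * Real.log n + 1 := by
  have h1 : ((2 ^ Nat.log 2 n : ℕ) : ℝ) ≤ n := by exact_mod_cast Nat.pow_log_le_self 2 hn
  have h2 := Real.log_le_log (by positivity) h1
  push_cast at h2
  rw [Real.log_pow] at h2
  have h3 : (0 : ℝ) ≤ Nat.log 2 n := Nat.cast_nonneg _
  have h4 := Real.log_two_gt_d9
  rw [logCeil]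
  push_cast
  nlinarith

namespace Input

variable {d : ℕ} {S A : Type*} {D : Input d S A}

/-- The logarithmic factor in the regret bound. -/
def logFactor (D : Input d S A) : ℝ := 1 + Real.log (d * D.K * D.H * Real.log (1 / D.δ))

lemma one_add_log_le_logFactor (hd : 1 ≤ d) (hN : D.H * D.K ≠ 0) (hy : 1 ≤ Real.log (1 / D.δ)) :
    1 + Real.log d + Real.log ((D.H * D.K : ℕ) : ℝ) ≤ D.logFactor := by
  have hd0 : (0 : ℝ) < d := by exact_mod_cast hd
  have hNpos : (0 : ℝ) < ((D.H * D.K : ℕ) : ℝ) := by exact_mod_cast Nat.pos_of_ne_zero hN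
  rw [logFactor, add_assoc, ← Real.log_mul hd0.ne' hNpos.ne']
  refine add_le_add le_rfl (Real.log_le_log (by positivity) ?_)
  have e : (d : ℝ) * D.K * D.H * Real.log (1 / D.δ) =
      d * ((D.H * D.K : ℕ) : ℝ) * Real.log (1 / D.δ) := by push_cast; ring
  rw [e]
  exact le_mul_of_one_le_right (by positivity) hy

lemma iota_le (hd : 1 ≤ d) (hN : D.H * D.K ≠ 0) (hδ : 0 < D.δ) (hy : 1 ≤ Real.log (1 / D.δ)) :
    D.ι ≤ 18 * (d * D.logFactor * Real.log (1 / D.δ)) := by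
  have hd1 : (1 : ℝ) ≤ d := by exact_mod_cast hd
  have hNpos : (0 : ℝ) < ((D.H * D.K : ℕ) : ℝ) := by exact_mod_cast Nat.pos_of_ne_zero hN
  have h1 := one_add_log_le_logFactor hd hN hy
  have h2 := Real.log_natCast_nonneg d
  have h3 := Real.log_natCast_nonneg (D.H * D.K)
  have h4 : Real.log ((2 * (D.H * D.K) : ℕ) : ℝ) ≤ D.logFactor := by
    rw [Nat.cast_mul, Real.log_mul (by norm_num) hNpos.ne']
    have := Real.log_two_lt_d9
    push_cast at h1 ⊢
    linarith
  have h5 : 1 ≤ D.logFactor := by linarith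
  rw [iota_eq hδ hN]
  set t := D.logFactor
  set y := Real.log (1 / D.δ)
  have h6 : 4 * ((d : ℝ) + 3) * Real.log ((2 * (D.H * D.K) : ℕ) : ℝ) ≤ 16 * (d * t * y) := by
    calc _ ≤ 4 * ((d : ℝ) + 3) * t := by gcongr
      _ ≤ 16 * (d * t) := by nlinarith
      _ ≤ 16 * (d * t * y) := by
          have : d * t ≤ d * t * y := le_mul_of_one_le_right (by positivity) hy
          linarith
  have h7 : y ≤ d * t * y := le_mul_of_one_le_left (by linarith) (by nlinarith)
  linarith

lemma binSize_le (hd : 1 ≤ d) (hN : D.H * D.K ≠ 0) (hy : 1 ≤ Real.log (1 / D.δ)) :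
    D.binSize ≤ 9 * (d * D.logFactor) := by
  have hd1 : (1 : ℝ) ≤ d := by exact_mod_cast hd
  have hN1 : (1 : ℝ) ≤ ((D.H * D.K : ℕ) : ℝ) := by exact_mod_cast Nat.pos_of_ne_zero hN
  have h1 := one_add_log_le_logFactor hd hN hy
  have h2 := Real.log_natCast_nonneg d
  have h3 : Real.log (d * (1 + 16 * ((D.H * D.K : ℕ) : ℝ) ^ 3)) ≤ 3 * D.logFactor := by
    have h4 : (1 : ℝ) ≤ ((D.H * D.K : ℕ) : ℝ) ^ 3 := one_le_pow₀ hN1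
    have h5 : Real.log (d * (1 + 16 * ((D.H * D.K : ℕ) : ℝ) ^ 3)) ≤
        Real.log (d * (Real.exp 3 * ((D.H * D.K : ℕ) : ℝ) ^ 3)) := by
      refine Real.log_le_log (by positivity) ?_
      have h6 : (17 : ℝ) ≤ Real.exp 3 := by
        have e : Real.exp 3 = Real.exp 1 ^ 3 := by rw [← Real.exp_nat_mul]; norm_num
        have := Real.exp_one_gt_d9
        rw [e]
        calc (17 : ℝ) ≤ 2.7 ^ 3 := by norm_num
          _ ≤ _ := by gcongr; linarith
      gcongr
      nlinarith
    have h7 : Real.log (d * (Real.exp 3 * ((D.H * D.K : ℕ) : ℝ) ^ 3)) =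
        Real.log d + (3 + 3 * Real.log ((D.H * D.K : ℕ) : ℝ)) := by
      rw [Real.log_mul (by positivity) (by positivity),
        Real.log_mul (by positivity) (by positivity), Real.log_exp, Real.log_pow]
      norm_num
    rw [h7] at h5
    linarith
  rw [binSize]
  nlinarith

lemma card_layers_le (hd : 1 ≤ d) (hN : D.H * D.K ≠ 0) (hy : 1 ≤ Real.log (1 / D.δ)) :
    (D.layers.card : ℝ) ≤ 8 * D.logFactor := by
  have h1 := one_add_log_le_logFactor hd hN hy
  have hd0 : (d : ℝ) ≠ 0 := by exact_mod_cast (by omega : d ≠ 0)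
  have hN0 : ((D.H * D.K : ℕ) : ℝ) ≠ 0 := by exact_mod_cast hN
  have h2 := logCeil_le_log (n := d) (by omega)
  have h3 := logCeil_le_log (n := d * (D.H * D.K) ^ 3) (mul_ne_zero (by omega) (pow_ne_zero 3 hN))
  have h4 := Real.log_natCast_nonneg d
  have h5 := Real.log_natCast_nonneg (D.H * D.K)
  rw [Nat.cast_mul, Nat.cast_pow, Real.log_mul hd0 (pow_ne_zero 3 hN0), Real.log_pow] at h3
  rw [card_layers, Nat.cast_add]
  push_cast at h3 ⊢
  push_cast at h1 h5
  linarith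

lemma L'_le (hd : 1 ≤ d) (hN : D.H * D.K ≠ 0) (hy : 1 ≤ Real.log (1 / D.δ)) :
    (D.L' : ℝ) ≤ 2 * D.logFactor := by
  have h1 := one_add_log_le_logFactor hd hN hy
  have h2 : (D.L' : ℝ) ≤ 2 * Real.log ((D.H * D.K : ℕ) : ℝ) + 1 := logCeil_le_log hN
  have h4 := Real.log_natCast_nonneg d
  linarith

lemma L₀_le (hd : 1 ≤ d) (hN : D.H * D.K ≠ 0) (hy : 1 ≤ Real.log (1 / D.δ)) :
    ((D.L₀ + 1 : ℕ) : ℝ) ≤ 2 * D.logFactor := by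
  have hH : D.H ≠ 0 := fun h => hN (by rw [h, zero_mul])
  have hK : D.K ≠ 0 := fun h => hN (by rw [h, mul_zero])
  have h1 := one_add_log_le_logFactor hd hN hy
  have h2 : ((D.L₀ + 1 : ℕ) : ℝ) ≤ 2 * Real.log (D.H : ℝ) + 1 := logCeil_le_log hH
  have h3 : Real.log (D.H : ℝ) ≤ Real.log ((D.H * D.K : ℕ) : ℝ) := by
    refine Real.log_le_log (by exact_mod_cast Nat.pos_of_ne_zero hH) ?_
    exact_mod_cast Nat.le_mul_of_pos_right _ (Nat.pos_of_ne_zero hK)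
  have h4 := Real.log_natCast_nonneg d
  linarith

lemma rpow_three_halves (d : ℕ) : (d : ℝ) ^ (3 / 2 : ℝ) = d * √d := by
  rcases Nat.eq_zero_or_pos d with rfl | h
  · norm_num
  · have hd : (0 : ℝ) < d := by exact_mod_cast h
    rw [show (3 / 2 : ℝ) = 1 + 1 / 2 by norm_num, Real.rpow_add hd, Real.rpow_one,
      Real.sqrt_eq_rpow]

/-- The bound in terms of the scales is of the desired form. -/
lemma scales_le (hd : 1 ≤ d) (hN : D.H * D.K ≠ 0) (hδ : 0 < D.δ) (hι : 0 ≤ D.ι)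
    (hy : 1 ≤ Real.log (1 / D.δ)) :
    400 * (D.ι + D.cutBound + D.widthSlope ^ 2 + D.widthOffset) +
        20 * (D.widthSlope * √(√d * D.K) + √d * √(D.ι * D.K)) ≤
      10 ^ 12 * D.logFactor ^ 6 * ((d : ℝ) ^ (3 / 2 : ℝ) * √(D.K * Real.log (1 / D.δ)) +
        (d : ℝ) ^ 3 * Real.log (1 / D.δ) ^ 3) := by
  have hd1 : (1 : ℝ) ≤ d := by exact_mod_cast hd
  have ht : 1 ≤ D.logFactor := by
    have h1 := one_add_log_le_logFactor hd hN hy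
    have h2 := Real.log_natCast_nonneg d
    have h3 := Real.log_natCast_nonneg (D.H * D.K)
    linarith
  have hb0 := binSize_nonneg (D := D) hd
  have hb := binSize_le hd hN hy
  have hι1 := iota_le hd hN hδ hy
  have hlay := card_layers_le hd hN hy
  have hL' := L'_le hd hN hy
  have hL₀ := L₀_le hd hN hy
  set t := D.logFactor
  set y := Real.log (1 / D.δ)
  have ht0 : 0 ≤ t := by linarith
  have hy0 : 0 ≤ y := by linarith
  have hd0 : (0 : ℝ) ≤ d := by linarith
  have hQ : ((D.layers.card * D.L' : ℕ) : ℝ) ≤ 16 * t ^ 2 := by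
    push_cast
    calc (D.layers.card : ℝ) * D.L' ≤ (8 * t) * (2 * t) := by gcongr
      _ = _ := by ring
  have hcls : (D.classes.card : ℝ) ≤ 32 * t ^ 3 := by
    rw [classes, Finset.card_product, Finset.card_product, Finset.card_range, Nat.card_Icc,
      Nat.add_sub_cancel, Nat.cast_mul]
    calc _ ≤ (2 * t) * (16 * t ^ 2) := by gcongr
      _ = _ := by ring
  have hc : D.classConst ≤ 829440 * (d ^ 2 * t ^ 2 * y) := by
    rw [classConst]
    calc 5120 * D.ι * D.binSize ≤ 5120 * (18 * (d * t * y)) * (9 * (d * t)) := by gcongr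
      _ = _ := by ring
  have hc0 : 0 ≤ D.classConst := by unfold classConst; positivity
  have hcut : D.cutBound ≤ 1440 * (t ^ 4 * d) := by
    rw [cutBound]
    calc D.classes.card * (5 * D.binSize) ≤ (32 * t ^ 3) * (5 * (9 * (d * t))) := by gcongr
      _ = _ := by ring
  have hΛ2 : D.widthSlope ^ 2 ≤ 20000 ^ 2 * (t ^ 6 * d ^ 2 * y) := by
    rw [widthSlope, mul_pow, Real.sq_sqrt hc0]
    calc ((D.layers.card * D.L' : ℕ) : ℝ) ^ 2 * D.classConst
        ≤ (16 * t ^ 2) ^ 2 * (829440 * (d ^ 2 * t ^ 2 * y)) := by gcongr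
      _ = 212336640 * (t ^ 6 * d ^ 2 * y) := by ring
      _ ≤ _ := by gcongr; norm_num
  have hΓ : D.widthOffset ≤ 5 + 39813120 * (t ^ 4 * d ^ 3 * y) := by
    rw [widthOffset]
    calc 5 + ((D.layers.card * D.L' : ℕ) : ℝ) * (3 * d * D.classConst)
        ≤ 5 + (16 * t ^ 2) * (3 * d * (829440 * (d ^ 2 * t ^ 2 * y))) := by gcongr
      _ = _ := by ring
  have hΛ : D.widthSlope ≤ 20000 * (t ^ 3 * d * √y) := by
    refine le_of_sq_le_sq ?_ (by positivity)
    rw [mul_pow, mul_pow, mul_pow, Real.sq_sqrt hy0]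
    exact hΛ2.trans (le_of_eq (by ring))
  set Z := t ^ 6 * ((d : ℝ) ^ 3 * y ^ 3) with hZ
  have hpow : ∀ {a b c : ℕ}, a ≤ 6 → b ≤ 3 → c ≤ 3 → t ^ a * (d : ℝ) ^ b * y ^ c ≤ Z :=
    fun ha hb hc => by
      rw [hZ, ← mul_assoc]
      gcongr
  have z1 : (d : ℝ) * t * y ≤ Z := by
    have := hpow (a := 1) (b := 1) (c := 1) (by norm_num) (by norm_num) (by norm_num)
    linarith
  have z2 : t ^ 4 * (d : ℝ) ≤ Z := by
    have := hpow (a := 4) (b := 1) (c := 0) (by norm_num) (by norm_num) (by norm_num)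
    linarith
  have z3 : t ^ 6 * (d : ℝ) ^ 2 * y ≤ Z := by
    have := hpow (a := 6) (b := 2) (c := 1) (by norm_num) (by norm_num) (by norm_num)
    linarith
  have z4 : t ^ 4 * (d : ℝ) ^ 3 * y ≤ Z := by
    have := hpow (a := 4) (b := 3) (c := 1) (by norm_num) (by norm_num) (by norm_num)
    linarith
  have z5 : 1 ≤ Z := by
    have := hpow (a := 0) (b := 0) (c := 0) (by norm_num) (by norm_num) (by norm_num)
    linarith
  have hsd : √(d : ℝ) ≤ d := by rw [Real.sqrt_le_left hd0]; nlinarith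
  have hsum1 : D.widthSlope * √(√d * D.K) ≤ 20000 * (t ^ 6 * (d * √d * √(D.K * y))) := by
    calc D.widthSlope * √(√d * D.K) ≤ 20000 * (t ^ 3 * d * √y) * √(d * D.K) := by gcongr
      _ = 20000 * (t ^ 3 * (d * √d * √(D.K * y))) := by
          rw [Real.sqrt_mul hd0, Real.sqrt_mul (Nat.cast_nonneg D.K)]; ring
      _ ≤ _ := by gcongr; norm_num
  have hsum2 : √d * √(D.ι * D.K) ≤ 5 * (t ^ 6 * (d * √d * √(D.K * y))) := by
    have h1 : √(D.ι * D.K) ≤ 5 * (t ^ 6 * (d * √(D.K * y))) := by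
      rw [Real.sqrt_le_left (by positivity)]
      have e : (5 * (t ^ 6 * (d * √(D.K * y)))) ^ 2 = 25 * ((t ^ 12 * d ^ 2) * (D.K * y)) := by
        rw [mul_pow, mul_pow, mul_pow, Real.sq_sqrt (by positivity)]; ring
      rw [e]
      have h2 : t * (d : ℝ) ≤ t ^ 12 * d ^ 2 := by
        gcongr
        · exact le_self_pow₀ ht (by norm_num)
        · exact le_self_pow₀ hd1 (by norm_num)
      calc D.ι * D.K ≤ 18 * (d * t * y) * D.K := by gcongr
        _ = 18 * ((t * d) * (D.K * y)) := by ring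
        _ ≤ 25 * ((t ^ 12 * d ^ 2) * (D.K * y)) := by gcongr; norm_num
    calc √d * √(D.ι * D.K) ≤ √d * (5 * (t ^ 6 * (d * √(D.K * y)))) := by gcongr
      _ = _ := by ring
  rw [rpow_three_halves]
  have hW : 0 ≤ t ^ 6 * (d * √d * √(D.K * y)) := by positivity
  have e : 10 ^ 12 * t ^ 6 * (d * √d * √(D.K * y) + (d : ℝ) ^ 3 * y ^ 3) =
      10 ^ 12 * (t ^ 6 * (d * √d * √(D.K * y))) + 10 ^ 12 * Z := by rw [hZ]; ring
  rw [e]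
  linarith

end Input

end LinMix

end

theorem theorem2 :
    ∃ (C : ℝ) (p : ℕ),
      ∀ (S A : Type*) [Nonempty S] [Nonempty A] (d H K : ℕ), 1 ≤ d → 1 ≤ H → 1 ≤ K →
      ∀ (δ : ℝ), 0 < δ → δ ≤ Real.exp (-1) →
      ∀ (M : LinMix.LinearMixtureMDP d S A) (init : ℕ → LinMix.History S A → PMF S),
        (∀ k ∈ Finset.Icc 1 K, ∀ ω, ∀ s ∈ (init k ω).support,
          LinMix.TotalRewardLeOne M.trans M.reward H s) →
      ∀ (alg : LinMix.Learner S A),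
        LinMix.Input.IsVARLin2 ⟨M.base, M.reward, H, K, δ⟩ alg →
        ENNReal.ofReal (1 - δ) ≤
          (LinMix.historyLaw M.trans H init alg K).toOuterMeasure
            {ω | LinMix.regret M.trans M.reward H K alg ω ≤
              C * (1 + Real.log (d * K * H * Real.log (1 / δ))) ^ p *
                ((d : ℝ) ^ (3 / 2 : ℝ) * √(K * Real.log (1 / δ)) +
                  (d : ℝ) ^ 3 * Real.log (1 / δ) ^ 3)} := by
  refine ⟨10 ^ 12, 6, ?_⟩
  intro S A _ _ d H K hd hH hK δ hδ hδe M init hinit alg halg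
  set D : LinMix.Input d S A := ⟨M.base, M.reward, H, K, δ⟩ with hD
  have hM : D.Realizes M.trans (WithLp.toLp 2 M.θ) := LinMix.Input.realizes_of_model M H K δ
  have hδ1 : D.δ ≤ 1 := hδe.trans (Real.exp_le_one_iff.2 (by norm_num))
  have hy : 1 ≤ Real.log (1 / D.δ) := by
    rw [one_div, Real.log_inv]
    have := Real.log_le_log hδ hδe
    rw [Real.log_exp] at this
    linarith
  have hN0 : D.H * D.K ≠ 0 := Nat.mul_ne_zero (Nat.ne_of_gt hH) (Nat.ne_of_gt hK)
  by_cases hN : 3 ≤ D.H * D.K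
  · refine (LinMix.Input.toOuterMeasure_regret_ge hM hd hN hδ hδ1 hinit halg).trans ?_
    refine MeasureTheory.measure_mono fun ω hω => ?_
    rw [Set.mem_ofPred_eq] at hω ⊢
    refine hω.trans (LinMix.Input.scales_le hd hN0 hδ ?_ hy)
    have := LinMix.Input.four_mul_le_iota (D := D) hδ hδ1 hN
    have : (0 : ℝ) ≤ d := Nat.cast_nonneg d
    linarith
  -- with at most two steps in total, the regret is at most `2`
  · refine LinMix.one_sub_le_toOuterMeasure (s := ∅) _ hδ.le (by simp) fun ω hω _ => ?_
    refine (LinMix.Input.regret_le_natCast (D := D) hM fun k hk =>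
      LinMix.Input.restLeOne_of_mem_support hH hinit hω hk).trans ?_
    have hK2 : (K : ℝ) ≤ 2 := by
      have h1 : K ≤ D.H * D.K := Nat.le_mul_of_pos_left _ hH
      exact_mod_cast (by omega : K ≤ 2)
    have ht : 1 ≤ D.logFactor := by
      have h1 := LinMix.Input.one_add_log_le_logFactor (D := D) hd hN0 hy
      linarith [Real.log_natCast_nonneg d, Real.log_natCast_nonneg (D.H * D.K)]
    have hd1 : (1 : ℝ) ≤ (d : ℝ) ^ 3 := one_le_pow₀ (by exact_mod_cast hd)
    have hy1 : 1 ≤ Real.log (1 / δ) ^ 3 := one_le_pow₀ hy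
    have ht1 : 1 ≤ D.logFactor ^ 6 := one_le_pow₀ ht
    have hW : 0 ≤ (d : ℝ) ^ (3 / 2 : ℝ) * √(K * Real.log (1 / δ)) := by positivity
    have hZ : 1 ≤ (d : ℝ) ^ 3 * Real.log (1 / δ) ^ 3 := one_le_mul_of_one_le_of_one_le hd1 hy1
    calc (K : ℝ) ≤ 10 ^ 12 * 1 * 1 := by linarith
      _ ≤ 10 ^ 12 * D.logFactor ^ 6 * ((d : ℝ) ^ (3 / 2 : ℝ) * √(K * Real.log (1 / δ)) +
          (d : ℝ) ^ 3 * Real.log (1 / δ) ^ 3) := by gcongr; linarith
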